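/- Let $d\ge 1$ be an integer, $\gamma\in[0,2]$ and $a(p,p')=|p-p'|^\gamma$ for $p,p'\in\mathbb{R}^d$ (with $a\equiv 1$ if $\gamma=0$). Consider the equation $$\partial_t f=Q_1(f,f)-Q_2(f,f)\ \text{ in }(0,\infty)\times\mathbb{R}^d,\qquad f(0)=f_{in},$$ $$Q_1(f,f)(p)=\tfrac12\int_{\mathbb{R}^d}a(p',p-p')\,f(p')\,f(p-p')\,dp',\qquad Q_2(f,f)(p)=\int_{\mathbb{R}^d}a(p,p')\,f(p)\,f(p')\,dp',$$ for nonnegative measures $f(t)$ on $\mathbb{R}^d$: for a measure $\mu$, $Q_1(\mu,\mu)$ is $\frac12$ times the image of $a(p,p')\mu(dp)\mu(dp')$ under $(p,p')\mapsto p+p'$, and $Q_2(\mu,\mu)(dp)=\left(\int a(p,p')\mu(dp')\right)\mu(dp)$. For $\beta\ge0$ put $M_\beta(\mu)=\int|p|^\beta\mu(dp)$ (so $M_0(\mu)=\mu(\mathbb{R}^d)$), let $M^1_\beta$ be the set of nonnegative Borel measures $\mu$ with $\int(1+|p|^\beta)\,\mu(dp)<\infty$, and write $M_\beta(t)=M_\beta(f(t))$.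 A measure is even if it is invariant under $p\mapsto-p$, and radially symmetric if it is invariant under every $R\in SO(d)$. For an integer $\alpha\ge2$ and $0<T<\infty$, an even solution on $[0,T)$ in the class $C([0,T);M^1\text{-weak})\cap L^\infty(0,T;M^1_{2\alpha})$ is a family $(f(t))_{0\le t<T}$ of finite nonnegative even measures, continuous in $t$ for the weak convergence of measures, with $f(0)=f_{in}$ and $\operatorname{ess\,sup}_{0<t<T}\int(1+|p|^{2\alpha})f(t,dp)<\infty$, such that for all $\varphi\in C_c^\infty(\mathbb{R}^d)$ and $t\in[0,T)$ $$\int\varphi\,df(t)=\int\varphi\,df_{in}+\int_0^t\left(\int\varphi\,dQ_1(f(s),f(s))-\int\varphi\,dQ_2(f(s),f(s))\right)ds .$$ Then there are constants $k_1,k_2\in(0,\infty)$ depending only on $\gamma$ and $d$ such that for every integer $\alpha\ge2$ and every even $f_{in}\in M^1_{2\alpha}$ the following hold. (i) There is a family $(f(t))_{t\ge0}$ of finite nonnegative measures that is an even solution in the above class on $[0,T)$ for every $T>0$, and every even solution in that class on some $[0,T)$ coincides with $f$ on $[0,T)$. For every $\beta\in[0,1]$ the function $t\mapsto M_\beta(t)$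 is nonincreasing on $[0,\infty)$. If moreover $f_{in}$ is radially symmetric, then $f(t)$ is radially symmetric for every $t\ge0$. (ii) With the conventions $1/0=\infty$ and $1/\infty=0$, $$\frac1{M_\gamma(0)^{-1}+k_1t}\le M_\gamma(t)\le\frac1{M_\gamma(0)^{-1}+k_2t}\qquad\text{for all }t\ge0 .$$ -/

import Mathlib

open MeasureTheory Set
open scoped ENNReal NNReal ContDiff

noncomputable section

namespace ImpulsionAggregation

/-- The momentum space `ℝ^d` with its Euclidean norm and Borel sigma-algebra. -/
abbrev Space (d : ℕ) : Type := EuclideanSpace ℝ (Fin d)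

/-- The aggregation rate `a(p, p') = |p - p'|^γ` (identically `1` when `γ = 0`). -/
def kernel {d : ℕ} (γ : ℝ) (p q : Space d) : ℝ := ‖p - q‖ ^ γ

/-- The moment `M_β(μ) = ∫ |p|^β μ(dp)`, with values in `[0, ∞]`; here `|0|^0 = 1`. -/
def moment {d : ℕ} (β : ℝ) (μ : Measure (Space d)) : ℝ≥0∞ := ∫⁻ p, ‖p‖ₑ ^ β ∂μ

/-- The norm `∫ (1 + |p|^β) μ(dp)` of a nonnegative measure in `M^1_β`, with values in `[0, ∞]`. -/
def weightedMass {d : ℕ} (β : ℝ) (μ : Measure (Space d)) : ℝ≥0∞ := ∫⁻ p, (1 + ‖p‖ₑ ^ β) ∂μ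

/-- Invariance under `p ↦ -p`. -/
def IsEven {d : ℕ} (μ : Measure (Space d)) : Prop := μ.map (fun p => -p) = μ

/-- Invariance under the rotation group `SO(d)` (the linear isometries of determinant one). -/
def IsRadial {d : ℕ} (μ : Measure (Space d)) : Prop :=
  ∀ R : Space d ≃ₗᵢ[ℝ] Space d,
    LinearMap.det (R.toLinearEquiv : Space d →ₗ[ℝ] Space d) = 1 → μ.map R = μ

/-- The gain part `Q₁(μ, μ)` of the collision operator, as a measure: half the image under
`(p, p') ↦ p + p'` of the measure `a(p, p') μ(dp) μ(dp')`. If `μ` has a density `f`, it has the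
density `p ↦ (1/2) ∫ a(p', p - p') f(p') f(p - p') dp'`. -/
def gain {d : ℕ} (a : Space d → Space d → ℝ) (μ : Measure (Space d)) : Measure (Space d) :=
  (2⁻¹ : ℝ≥0∞) •
    ((μ.prod μ).withDensity (fun x => ENNReal.ofReal (a x.1 x.2))).map (fun x => x.1 + x.2)

/-- The loss part `Q₂(μ, μ)` of the collision operator: `μ` multiplied by the function
`p ↦ ∫ a(p, p') μ(dp')`. -/
def loss {d : ℕ} (a : Space d → Space d → ℝ) (μ : Measure (Space d)) : Measure (Space d) :=
  μ.withDensity (fun p => ∫⁻ q, ENNReal.ofReal (a p q) ∂μ)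

/-- `f` is an even measure-valued solution on `[0, T)` of `∂ₜ f = Q₁(f, f) - Q₂(f, f)` for the rate
`|p - p'|^γ`, with initial datum `fin`, in the class
`C([0, T); M^1-weak) ∩ L^∞(0, T; M^1_{2α})`. The topology of `FiniteMeasure` is that of weak
convergence of measures. -/
structure IsEvenSolution {d : ℕ} (γ : ℝ) (α : ℕ) (fin : FiniteMeasure (Space d)) (T : ℝ)
    (f : ℝ → FiniteMeasure (Space d)) : Prop where
  initial : f 0 = fin
  even : ∀ t ∈ Ico 0 T, IsEven (f t : Measure (Space d))
  weak_continuous : ContinuousOn f (Ico 0 T)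
  bounded : ∃ C : ℝ≥0, ∀ᵐ t ∂(volume.restrict (Ioo 0 T)),
    weightedMass (2 * α) (f t : Measure (Space d)) ≤ C
  /-- the equation, in the sense of distributions in `p` and integrated in time -/
  equation : ∀ φ : Space d → ℝ, ContDiff ℝ ∞ φ → HasCompactSupport φ → ∀ t ∈ Ico 0 T,
    ∫ p, φ p ∂(f t : Measure (Space d)) = ∫ p, φ p ∂(fin : Measure (Space d)) +
      ∫ s in (0 : ℝ)..t,
        ((∫ p, φ p ∂(gain (kernel γ) (f s : Measure (Space d)))) -
          ∫ p, φ p ∂(loss (kernel γ) (f s : Measure (Space d))))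

end ImpulsionAggregation

end

noncomputable section

namespace ImpulsionAggregation

open Filter Topology ProbabilityTheory

variable {d : ℕ}

/-! ### Weights and integrability -/

/-! Tested against `φ`, the equation says that the derivative of `∫ φ` is `coll a φ`, half the
integral of `a(p,q) (φ(p+q) - φ(p) - φ(q))`. Evenness allows averaging over `q ↦ -q`, and `a(p,q) ≤
a(p,-q)` as soon as `⟨p,q⟩ ≥ 0`. Hence the average of `a(p,q) ⟨p,q⟩`, even with a nonnegative factor
depending on `p` alone, is nonpositive (`IsRate.integral_mul_inner_nonpos`). This sign compensates
for the quadratic growth of the rate and is the source of well-posedness.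

Stability. Let `σ` be the density of the difference of two solutions with respect to their sum, and
test the difference against `wt · sgn σ`, where `wt = 1 + |p|²`. The dangerous contribution `a(p,q)
wt(p) |σ(p)|` of the gain is cancelled by the loss. What remains is `|σ(p)| a(p,q) (2 wt(q) + 2
⟨p,q⟩)`: the inner product has the good sign, and the rest is controlled by the moment of order
four. Grönwall's inequality closes the estimate in total variation weighted by `wt`. Rigorously, the
weight is cut off and the sign frozen on short time intervals, at the price of an error quadratic in
the time step (`IsStrongSolution.stability`). The two solutions may have different rates and data,
so the same estimate yields uniqueness and the convergence of approximations.

Existence. A bounded rate which vanishes unless both momenta lie in a ball is solved explicitly by a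
Wild sum (`IsTruncatedRate.isStrongSolution_wildFlow`). High moments propagate uniformly in the
truncation: after averaging over `q ↦ -q` their production is linear in the high moment
(`exists_production_le`). By stability the approximations form a Cauchy sequence in weighted total
variation, hence converge. Conversely, a solution in the sense of distributions is strong: weak
continuity turns the essential moment bound into one for every time, and a Dynkin class argument
extends the equation to bounded measurable test functions (`testEquation_of_contDiff`). Uniqueness
therefore holds in the whole class.

Qualitative properties. For `β ≤ 1` the function `|p|^β` is subadditive, so its moment decreases.
Rotations preserve the rate, so uniqueness propagates radial symmetry. For `M_γ`, the averaged
production is at least `-8 |p|^γ |q|^γ` and at most `-(1 - γ/2) |p|^γ |q|^γ`. The upper bound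
degenerates at `γ = 2`, where the production is exactly `-8 ⟨p,q⟩²` and Cauchy–Schwarz on the matrix
of second moments replaces the pointwise estimate. Thus `-2 M_γ² ≤ M_γ' ≤ -k M_γ²` in integrated
form, with `k` equal to `(1 - γ/2)/4` or `2/d`, and comparison with the Riccati equation gives both
bounds. -/

/-- The weight `1 + |p|²`. -/
def wt (p : Space d) : ℝ := 1 + ‖p‖ ^ 2

lemma one_le_wt (p : Space d) : 1 ≤ wt p := by
  have := sq_nonneg ‖p‖
  unfold wt; linarith

lemma wt_pos (p : Space d) : 0 < wt p := zero_lt_one.trans_le (one_le_wt p)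

lemma wt_nonneg (p : Space d) : 0 ≤ wt p := (wt_pos p).le

lemma continuous_wt : Continuous (wt : Space d → ℝ) := by
  unfold wt; fun_prop

@[fun_prop]
lemma measurable_wt : Measurable (wt : Space d → ℝ) := continuous_wt.measurable

lemma wt_add_le (p q : Space d) : wt (p + q) ≤ 2 * wt p * wt q := by
  unfold wt
  have h : ‖p + q‖ ≤ ‖p‖ + ‖q‖ := norm_add_le p q
  have h0 := norm_nonneg (p + q)
  nlinarith [sq_nonneg (‖p‖ - ‖q‖), sq_nonneg (‖p‖ * ‖q‖), norm_nonneg p, norm_nonneg q,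
    mul_self_le_mul_self h0 h]

lemma wt_le_wt_sq (p : Space d) : wt p ≤ wt p ^ 2 := by
  nlinarith [one_le_wt p]

/-- The measure `μ` satisfies `∫ (1 + |p|²)² dμ ≤ D < ∞`. -/
structure MomentBound (D : ℝ) (μ : Measure (Space d)) : Prop where
  integrable : Integrable (fun p => wt p ^ 2) μ
  le : ∫ p, wt p ^ 2 ∂μ ≤ D

namespace MomentBound

variable {D D' : ℝ} {μ ν : Measure (Space d)}

lemma isFiniteMeasure (h : MomentBound D μ) : IsFiniteMeasure μ := by
  have : Integrable (fun _ : Space d => (1 : ℝ)) μ :=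
    h.integrable.mono' aestronglyMeasurable_const
      (ae_of_all _ fun p => by rw [norm_one]; exact one_le_pow₀ (one_le_wt p))
  rw [integrable_const_iff] at this
  simpa using this

lemma nonneg (h : MomentBound D μ) : 0 ≤ D :=
  (integral_nonneg fun _ => by positivity).trans h.le

lemma mono (h : MomentBound D μ) (hD : D ≤ D') : MomentBound D' μ := ⟨h.integrable, h.le.trans hD⟩

lemma integrable_wt (h : MomentBound D μ) : Integrable wt μ :=
  h.integrable.mono' measurable_wt.aestronglyMeasurable
    (ae_of_all _ fun p => by rw [Real.norm_of_nonneg (wt_nonneg p)]; exact wt_le_wt_sq p)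

lemma integral_wt_le (h : MomentBound D μ) : ∫ p, wt p ∂μ ≤ D :=
  (integral_mono h.integrable_wt h.integrable wt_le_wt_sq).trans h.le

lemma integrable_of_le (h : MomentBound D μ) {φ : Space d → ℝ} (hm : Measurable φ) {C : ℝ}
    (hφ : ∀ p, |φ p| ≤ C * wt p) : Integrable φ μ :=
  (h.integrable_wt.const_mul C).mono' hm.aestronglyMeasurable (ae_of_all _ hφ)

lemma integrable_prod (h : MomentBound D μ) (h' : MomentBound D' ν) :
    Integrable (fun x : Space d × Space d => wt x.1 ^ 2 * wt x.2 ^ 2) (μ.prod ν) :=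
  h.integrable.mul_prod h'.integrable

lemma integral_prod_le (h : MomentBound D μ) (h' : MomentBound D' ν) :
    ∫ x, wt x.1 ^ 2 * wt x.2 ^ 2 ∂(μ.prod ν) ≤ D * D' := by
  have := h.isFiniteMeasure
  have := h'.isFiniteMeasure
  rw [integral_prod_mul (fun p => wt p ^ 2) (fun p => wt p ^ 2)]
  exact mul_le_mul h.le h'.le (integral_nonneg fun _ => by positivity) h.nonneg

lemma integrable_prod_of_le (h : MomentBound D μ) (h' : MomentBound D' ν)
    {F : Space d × Space d → ℝ} (hm : Measurable F) {C : ℝ}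
    (hF : ∀ x, |F x| ≤ C * (wt x.1 ^ 2 * wt x.2 ^ 2)) : Integrable F (μ.prod ν) :=
  ((h.integrable_prod h').const_mul C).mono' hm.aestronglyMeasurable (ae_of_all _ hF)

lemma abs_integral_prod_le (h : MomentBound D μ) (h' : MomentBound D' ν)
    {F : Space d × Space d → ℝ} {C : ℝ} (hC : 0 ≤ C)
    (hF : ∀ x, |F x| ≤ C * (wt x.1 ^ 2 * wt x.2 ^ 2)) :
    |∫ x, F x ∂(μ.prod ν)| ≤ C * (D * D') := by
  refine (norm_integral_le_of_norm_le (f := F) ((h.integrable_prod h').const_mul C)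
    (ae_of_all _ hF)).trans ?_
  rw [integral_const_mul]
  exact mul_le_mul_of_nonneg_left (h.integral_prod_le h') hC

lemma add (h : MomentBound D μ) (h' : MomentBound D' ν) : MomentBound (D + D') (μ + ν) where
  integrable := h.integrable.add_measure h'.integrable
  le := by
    rw [integral_add_measure h.integrable h'.integrable]
    exact add_le_add h.le h'.le

end MomentBound

/-! ### Aggregation rates and the weak collision operator -/

/-- The properties of an aggregation rate that are used below. -/
structure IsRate (a : Space d → Space d → ℝ) : Prop where
  meas : Measurable (fun x : Space d × Space d => a x.1 x.2)
  nonneg : ∀ p q, 0 ≤ a p q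
  symm : ∀ p q, a p q = a q p
  neg : ∀ p q, a (-p) (-q) = a p q
  mono : ∀ p q, 0 ≤ inner ℝ p q → a p q ≤ a p (-q)
  bound : ∀ p q, a p q ≤ 2 * (1 + ‖p‖ ^ 2 + ‖q‖ ^ 2)

/-- The variation of `∫ φ` in an aggregation event. -/
def defect (φ : Space d → ℝ) (x : Space d × Space d) : ℝ := φ (x.1 + x.2) - φ x.1 - φ x.2

/-- The weak form of `Q₁(μ, μ) - Q₂(μ, μ)`. -/
def coll (a : Space d → Space d → ℝ) (φ : Space d → ℝ) (μ : Measure (Space d)) : ℝ :=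
  2⁻¹ * ∫ x, a x.1 x.2 * defect φ x ∂(μ.prod μ)

lemma measurable_defect {φ : Space d → ℝ} (hφ : Measurable φ) : Measurable (defect φ) := by
  unfold defect; fun_prop

lemma abs_defect_le {φ : Space d → ℝ} {C : ℝ} (hφ : ∀ p, |φ p| ≤ C * wt p)
    (x : Space d × Space d) : |defect φ x| ≤ 4 * C * (wt x.1 * wt x.2) := by
  have hC : 0 ≤ C := by
    by_contra! h
    have h1 := hφ 0
    have h2 := abs_nonneg (φ 0)
    nlinarith [wt_pos (0 : Space d)]
  have h1 := hφ (x.1 + x.2)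
  have h2 := hφ x.1
  have h3 := hφ x.2
  have h4 := mul_le_mul_of_nonneg_left (wt_add_le x.1 x.2) hC
  have h5 : wt x.1 ≤ wt x.1 * wt x.2 := le_mul_of_one_le_right (wt_nonneg _) (one_le_wt _)
  have h6 : wt x.2 ≤ wt x.1 * wt x.2 := le_mul_of_one_le_left (wt_nonneg _) (one_le_wt _)
  have h7 := mul_le_mul_of_nonneg_left h5 hC
  have h8 := mul_le_mul_of_nonneg_left h6 hC
  unfold defect
  have := abs_sub (φ (x.1 + x.2) - φ x.1) (φ x.2)
  have := abs_sub (φ (x.1 + x.2)) (φ x.1)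
  linarith

namespace IsRate

variable {a : Space d → Space d → ℝ}

lemma le_wt (ha : IsRate a) (p q : Space d) : a p q ≤ 2 * wt p * wt q := by
  refine (ha.bound p q).trans ?_
  unfold wt
  nlinarith [mul_nonneg (sq_nonneg ‖p‖) (sq_nonneg ‖q‖)]

lemma measurable_mul_defect (ha : IsRate a) {φ : Space d → ℝ} (hφ : Measurable φ) :
    Measurable (fun x : Space d × Space d => a x.1 x.2 * defect φ x) :=
  ha.meas.mul (measurable_defect hφ)

lemma abs_mul_le (ha : IsRate a) {C : ℝ} {x : Space d × Space d} {r : ℝ}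
    (hr : |r| ≤ C * (wt x.1 * wt x.2)) :
    |a x.1 x.2 * r| ≤ 2 * C * (wt x.1 ^ 2 * wt x.2 ^ 2) := by
  rw [abs_mul, abs_of_nonneg (ha.nonneg _ _)]
  calc a x.1 x.2 * |r| ≤ (2 * wt x.1 * wt x.2) * (C * (wt x.1 * wt x.2)) :=
        mul_le_mul (ha.le_wt _ _) hr (abs_nonneg _)
          (mul_nonneg (mul_nonneg zero_le_two (wt_nonneg _)) (wt_nonneg _))
    _ = _ := by ring

/-- The rate and the defect each cost one factor `wt` in each variable. This is why `MomentBound`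
controls `wt ^ 2`, that is, the moment of order four. -/
lemma abs_mul_defect_le (ha : IsRate a) {φ : Space d → ℝ} {C : ℝ}
    (hφ : ∀ p, |φ p| ≤ C * wt p) (x : Space d × Space d) :
    |a x.1 x.2 * defect φ x| ≤ 8 * C * (wt x.1 ^ 2 * wt x.2 ^ 2) := by
  refine (ha.abs_mul_le (abs_defect_le hφ x)).trans (le_of_eq (by ring))

lemma integrable_mul_defect (ha : IsRate a) {φ : Space d → ℝ} (hm : Measurable φ) {C : ℝ}
    (hφ : ∀ p, |φ p| ≤ C * wt p) {D D' : ℝ} {μ ν : Measure (Space d)} (h : MomentBound D μ)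
    (h' : MomentBound D' ν) :
    Integrable (fun x : Space d × Space d => a x.1 x.2 * defect φ x) (μ.prod ν) :=
  h.integrable_prod_of_le h' (ha.measurable_mul_defect hm) (ha.abs_mul_defect_le hφ)

lemma abs_coll_le (ha : IsRate a) {φ : Space d → ℝ} {C : ℝ} (hC : 0 ≤ C)
    (hφ : ∀ p, |φ p| ≤ C * wt p) {D : ℝ} {μ : Measure (Space d)} (h : MomentBound D μ) :
    |coll a φ μ| ≤ 4 * C * D ^ 2 := by
  have := h.abs_integral_prod_le h (mul_nonneg (by norm_num) hC) (ha.abs_mul_defect_le hφ)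
  unfold coll
  rw [abs_mul, abs_of_pos (by norm_num : (0 : ℝ) < 2⁻¹)]
  linarith

end IsRate

/-- Solutions are encoded as kernels from time to space so that measurability in time of such double
integrals comes from the product kernel `f ×ₖ f`. -/
lemma measurable_coll {a : Space d → Space d → ℝ} (ha : IsRate a) {φ : Space d → ℝ}
    (hφ : Measurable φ) (f : Kernel ℝ (Space d)) [IsFiniteKernel f] :
    Measurable (fun t => coll a φ (f t)) := by
  have := (ha.measurable_mul_defect hφ).stronglyMeasurable.integral_kernel (κ := f ×ₖ f)
  simp only [Kernel.prod_apply] at this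
  exact this.measurable.const_mul _

/-- Strong (that is, tested against functions of quadratic growth) even solutions on `[0, T]`,
extended to all times, with a uniform bound on the moment of order four. -/
structure IsStrongSolution (a : Space d → Space d → ℝ) (T D : ℝ) (f : Kernel ℝ (Space d)) :
    Prop where
  even : ∀ t, IsEven (f t)
  moment : ∀ t, MomentBound D (f t)
  equation : ∀ φ : Space d → ℝ, Measurable φ → (∃ C, ∀ p, |φ p| ≤ C * wt p) → ∀ t ∈ Icc 0 T,
    ∫ p, φ p ∂(f t) = ∫ p, φ p ∂(f 0) + ∫ s in (0 : ℝ)..t, coll a φ (f s)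

lemma isFiniteKernel_of_momentBound {D : ℝ} {f : Kernel ℝ (Space d)}
    (h : ∀ t, MomentBound D (f t)) : IsFiniteKernel f := by
  refine ⟨ENNReal.ofReal D, ENNReal.ofReal_lt_top, fun t => ?_⟩
  have := (h t).isFiniteMeasure
  rw [← ENNReal.ofReal_toReal (measure_ne_top (f t) univ)]
  refine ENNReal.ofReal_le_ofReal (le_trans ?_ (h t).le)
  have : ((f t) univ).toReal = ∫ _, (1 : ℝ) ∂(f t) := by simp [Measure.real]
  rw [this]
  exact integral_mono (integrable_const _) (h t).integrable
    fun p => one_le_pow₀ (one_le_wt p)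

lemma intervalIntegrable_coll {a : Space d → Space d → ℝ} (ha : IsRate a) {φ : Space d → ℝ}
    (hφ : Measurable φ) {C : ℝ} (hC : 0 ≤ C) (hb : ∀ p, |φ p| ≤ C * wt p) {D : ℝ}
    {f : Kernel ℝ (Space d)} (h : ∀ t, MomentBound D (f t)) (s t : ℝ) :
    IntervalIntegrable (fun τ => coll a φ (f τ)) volume s t := by
  have := isFiniteKernel_of_momentBound h
  refine (intervalIntegrable_const (c := 4 * C * D ^ 2)).mono_fun'
    (measurable_coll ha hφ f).aestronglyMeasurable (ae_of_all _ fun τ => ?_)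
  exact ha.abs_coll_le hC hb (h τ)

/-- The weak form of the equation is stable under dominated convergence of test functions. -/
lemma equation_of_tendsto {a : Space d → Space d → ℝ} (ha : IsRate a) {D : ℝ}
    {f : Kernel ℝ (Space d)} (h : ∀ t, MomentBound D (f t)) {t : ℝ} {φ : Space d → ℝ}
    {ψ : ℕ → Space d → ℝ} (hψm : ∀ n, Measurable (ψ n)) {C : ℝ} (hC : 0 ≤ C)
    (hψ : ∀ n p, |ψ n p| ≤ C * wt p) (hlim : ∀ p, Tendsto (fun n => ψ n p) atTop (𝓝 (φ p)))
    (heq : ∀ n, ∫ p, ψ n p ∂(f t) = ∫ p, ψ n p ∂(f 0) + ∫ s in (0 : ℝ)..t, coll a (ψ n) (f s)) :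
    ∫ p, φ p ∂(f t) = ∫ p, φ p ∂(f 0) + ∫ s in (0 : ℝ)..t, coll a φ (f s) := by
  have := isFiniteKernel_of_momentBound h
  have hint : ∀ s, Tendsto (fun n => ∫ p, ψ n p ∂(f s)) atTop (𝓝 (∫ p, φ p ∂(f s))) := fun s =>
    tendsto_integral_of_dominated_convergence (fun p => C * wt p)
      (fun n => (hψm n).aestronglyMeasurable) ((h s).integrable_wt.const_mul C)
      (fun n => ae_of_all _ (hψ n)) (ae_of_all _ hlim)
  have hcoll : ∀ s, Tendsto (fun n => coll a (ψ n) (f s)) atTop (𝓝 (coll a φ (f s))) := fun s => by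
    refine Tendsto.const_mul _ (tendsto_integral_of_dominated_convergence
      (fun x => 8 * C * (wt x.1 ^ 2 * wt x.2 ^ 2))
      (fun n => (ha.measurable_mul_defect (hψm n)).aestronglyMeasurable)
      (((h s).integrable_prod (h s)).const_mul _)
      (fun n => ae_of_all _ (ha.abs_mul_defect_le (hψ n))) (ae_of_all _ fun x => ?_))
    exact (((hlim _).sub (hlim _)).sub (hlim _)).const_mul _
  refine tendsto_nhds_unique (hint t) ?_
  simp_rw [heq]
  refine (hint 0).add (intervalIntegral.tendsto_integral_filter_of_dominated_convergence
    (fun _ => 4 * C * D ^ 2)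
    (Eventually.of_forall fun n => (measurable_coll ha (hψm n) f).aestronglyMeasurable)
    (Eventually.of_forall fun n => ae_of_all _ fun s _ => ha.abs_coll_le hC (hψ n) (h s))
    intervalIntegrable_const (ae_of_all _ fun s _ => hcoll s))

/-- It is enough to test the equation against bounded functions. -/
lemma IsStrongSolution.of_bounded {a : Space d → Space d → ℝ} (ha : IsRate a) {T D : ℝ}
    {f : Kernel ℝ (Space d)} (heven : ∀ t, IsEven (f t)) (h : ∀ t, MomentBound D (f t))
    (heq : ∀ φ : Space d → ℝ, Measurable φ → (∃ C, ∀ p, |φ p| ≤ C) → ∀ t ∈ Icc 0 T,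
      ∫ p, φ p ∂(f t) = ∫ p, φ p ∂(f 0) + ∫ s in (0 : ℝ)..t, coll a φ (f s)) :
    IsStrongSolution a T D f where
  even := heven
  moment := h
  equation := by
    rintro φ hφ ⟨C, hC⟩ t ht
    have hC0 : 0 ≤ C := by
      by_contra! hn
      nlinarith [hC 0, abs_nonneg (φ 0), wt_pos (0 : Space d)]
    refine equation_of_tendsto ha h (ψ := fun n => {p | |φ p| ≤ n}.indicator φ)
      (fun n => hφ.indicator (measurableSet_le hφ.abs measurable_const)) hC0 ?_ ?_ ?_
    · intro n p
      by_cases hp : |φ p| ≤ n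
      · simpa [indicator, hp] using hC p
      · simpa [indicator, hp] using mul_nonneg hC0 (wt_nonneg p)
    · intro p
      obtain ⟨N, hN⟩ := exists_nat_ge |φ p|
      refine tendsto_const_nhds.congr' ?_
      filter_upwards [eventually_ge_atTop N] with n hn
      have : |φ p| ≤ n := hN.trans (by exact_mod_cast hn)
      simp [indicator, this]
    · intro n
      refine heq _ (hφ.indicator (measurableSet_le hφ.abs measurable_const)) ⟨n, fun p => ?_⟩ t ht
      by_cases hp : |φ p| ≤ n
      · simp [indicator, hp]
      · simp [indicator, hp]

namespace IsStrongSolution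

variable {a : Space d → Space d → ℝ} {T D : ℝ} {f : Kernel ℝ (Space d)}

lemma equation_interval (hf : IsStrongSolution a T D f) (ha : IsRate a) {φ : Space d → ℝ}
    (hφ : Measurable φ) {C : ℝ} (hC : 0 ≤ C) (hb : ∀ p, |φ p| ≤ C * wt p) {s t : ℝ}
    (hs : 0 ≤ s) (hst : s ≤ t) (ht : t ≤ T) :
    ∫ p, φ p ∂(f t) = ∫ p, φ p ∂(f s) + ∫ τ in s..t, coll a φ (f τ) := by
  have h := fun u v => intervalIntegrable_coll ha hφ hC hb hf.moment u v
  rw [hf.equation φ hφ ⟨C, hb⟩ t ⟨hs.trans hst, ht⟩,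
    hf.equation φ hφ ⟨C, hb⟩ s ⟨hs, hst.trans ht⟩, add_assoc,
    intervalIntegral.integral_add_adjacent_intervals (h 0 s) (h s t)]

lemma abs_integral_sub_le (hf : IsStrongSolution a T D f) (ha : IsRate a) {φ : Space d → ℝ}
    (hφ : Measurable φ) {C : ℝ} (hC : 0 ≤ C) (hb : ∀ p, |φ p| ≤ C * wt p) {s t : ℝ}
    (hs : s ∈ Icc 0 T) (ht : t ∈ Icc 0 T) :
    |∫ p, φ p ∂(f t) - ∫ p, φ p ∂(f s)| ≤ 4 * C * D ^ 2 * |t - s| := by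
  wlog hst : s ≤ t generalizing s t
  · rw [abs_sub_comm, abs_sub_comm t]
    exact this ht hs (le_of_not_ge hst)
  rw [hf.equation_interval ha hφ hC hb hs.1 hst ht.2, add_sub_cancel_left]
  exact intervalIntegral.norm_integral_le_of_norm_le_const (f := fun τ => coll a φ (f τ))
    fun τ _ => ha.abs_coll_le hC hb (hf.moment τ)

end IsStrongSolution

/-! ### Two real-variable lemmas -/

/-- Grönwall's inequality in integral form. -/
lemma le_mul_exp_of_le_add_integral {N : ℝ → ℝ} {A k T : ℝ} (hk : 0 < k)
    (hN : ContinuousOn N (Icc 0 T))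
    (h : ∀ t ∈ Icc 0 T, N t ≤ A + k * ∫ s in (0 : ℝ)..t, N s) {t : ℝ} (ht : t ∈ Icc 0 T) :
    N t ≤ A * Real.exp (k * t) := by
  have hT : 0 ≤ T := ht.1.trans ht.2
  -- Extending `N` by its end values makes its primitive differentiable on the whole line.
  set N' : ℝ → ℝ := IccExtend hT ((Icc 0 T).domRestrict N) with hN'
  have hcont : Continuous N' := (continuousOn_iff_continuous_domRestrict.1 hN).Icc_extend'
  have heq : ∀ s ∈ Icc 0 T, N' s = N s := fun s hs => by
    rw [hN', IccExtend_of_mem hT _ hs]; rfl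
  have hint : ∀ s ∈ Icc 0 T, ∫ τ in (0 : ℝ)..s, N τ = ∫ τ in (0 : ℝ)..s, N' τ := fun s hs => by
    refine intervalIntegral.integral_congr fun τ hτ => (heq τ ?_).symm
    rw [uIcc_of_le hs.1] at hτ
    exact ⟨hτ.1, hτ.2.trans hs.2⟩
  have hder : ∀ x, HasDerivAt (fun u => ∫ τ in (0 : ℝ)..u, N' τ) (N' x) x := fun x =>
    intervalIntegral.integral_hasDerivAt_right (hcont.intervalIntegrable _ _)
      hcont.aestronglyMeasurable.stronglyMeasurableAtFilter hcont.continuousAt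
  -- The differential inequality holds for the primitive of `N`; `N` itself is only continuous.
  have key := le_gronwallBound_of_liminf_deriv_right_le (f := fun u => ∫ τ in (0 : ℝ)..u, N' τ)
    (f' := N') (δ := 0) (K := k) (ε := A) (a := 0) (b := T)
    (fun x _ => (hder x).continuousAt.continuousWithinAt)
    (fun x _ r hr => by
      simpa [slope, smul_eq_mul] using (hder x).hasDerivWithinAt.liminf_right_slope_le hr)
    (by simp)
    (fun x hx => by
      have hx' : x ∈ Icc 0 T := ⟨hx.1, hx.2.le⟩
      have := h x hx'
      rw [hint x hx'] at this
      rw [heq x hx']; linarith) t ht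
  rw [gronwallBound_of_K_ne_0 hk.ne'] at key
  have h1 := h t ht
  rw [hint t ht] at h1
  have h2 := mul_le_mul_of_nonneg_left key hk.le
  simp only [zero_mul, zero_add, sub_zero] at h2
  have h3 : k * (A / k * (Real.exp (k * t) - 1)) = A * (Real.exp (k * t) - 1) := by
    field_simp
  linarith

/-- A quadratic error in the increments disappears after refinement. -/
lemma sub_le_sub_of_le_add_sq {Φ J : ℝ → ℝ} {K t : ℝ} (ht : 0 ≤ t)
    (h : ∀ s ∈ Icc 0 t, ∀ s' ∈ Icc 0 t, s ≤ s' →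
      Φ s' - Φ s ≤ J s' - J s + K * (s' - s) ^ 2) : Φ t - Φ 0 ≤ J t - J 0 := by
  -- With `n + 1` equal steps the increments telescope, and the errors add up to `K t² / (n + 1)`.
  have key : ∀ n : ℕ, Φ t - Φ 0 ≤ J t - J 0 + K * t ^ 2 * (1 / ((n : ℝ) + 1)) := by
    intro n
    have hn : (0 : ℝ) < (n : ℝ) + 1 := by positivity
    set u : ℕ → ℝ := fun i => i * (t / (n + 1)) with hu
    have hu0 : u 0 = 0 := by simp [hu]
    have hun : u (n + 1) = t := by simp only [hu]; push_cast; field_simp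
    have hmem : ∀ i ≤ n + 1, u i ∈ Icc 0 t := fun i hi => by
      refine ⟨by positivity, ?_⟩
      rw [← hun]
      exact mul_le_mul_of_nonneg_right (by exact_mod_cast hi) (by positivity)
    have hstep : ∀ i, u (i + 1) - u i = t / (n + 1) := fun i => by
      simp only [hu]; push_cast; ring
    have := Finset.sum_le_sum fun i (hi : i ∈ Finset.range (n + 1)) =>
      h (u i) (hmem i (Finset.mem_range.1 hi).le) (u (i + 1)) (hmem _ (Finset.mem_range.1 hi))
        (by have := hstep i; have : 0 ≤ t / ((n : ℝ) + 1) := by positivity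
            linarith)
    rw [Finset.sum_range_sub (fun i => Φ (u i)), Finset.sum_add_distrib,
      Finset.sum_range_sub (fun i => J (u i)), hu0, hun] at this
    simp only [hstep, Finset.sum_const, Finset.card_range, nsmul_eq_mul] at this
    refine this.trans (le_of_eq ?_)
    push_cast
    field_simp
  have hlim : Tendsto (fun n : ℕ => J t - J 0 + K * t ^ 2 * (1 / ((n : ℝ) + 1))) atTop
      (𝓝 (J t - J 0 + K * t ^ 2 * 0)) :=
    (tendsto_one_div_add_atTop_nhds_zero_nat.const_mul _).const_add _
  rw [mul_zero, add_zero] at hlim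
  exact ge_of_tendsto' hlim key

/-! ### The difference of two measures -/

/-- The difference of two finite measures has a density, bounded by one, with respect to their
sum. -/
lemma exists_density_sub (μ ν : Measure (Space d)) [IsFiniteMeasure μ] [IsFiniteMeasure ν] :
    ∃ σ : Space d → ℝ, Measurable σ ∧ (∀ p, |σ p| ≤ 1) ∧
      ∀ ψ : Space d → ℝ, Integrable ψ (μ + ν) →
        ∫ p, ψ p ∂μ - ∫ p, ψ p ∂ν = ∫ p, ψ p * σ p ∂(μ + ν) := by
  have := Measure.haveLebesgueDecomposition_of_sigmaFinite μ (μ + ν)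
  have := Measure.haveLebesgueDecomposition_of_sigmaFinite ν (μ + ν)
  have hμ : μ ≤ μ + ν := Measure.le_add_right le_rfl
  have hν : ν ≤ μ + ν := Measure.le_add_left le_rfl
  set α := μ.rnDeriv (μ + ν)
  set β := ν.rnDeriv (μ + ν)
  have hαβ : ∀ᵐ p ∂(μ + ν), |(α p).toReal - (β p).toReal| ≤ 1 := by
    filter_upwards [Measure.rnDeriv_le_one_of_le hμ, Measure.rnDeriv_le_one_of_le hν] with p h1 h2
    have h3 : (α p).toReal ≤ 1 := by
      simpa using ENNReal.toReal_mono ENNReal.one_ne_top h1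
    have h4 : (β p).toReal ≤ 1 := by
      simpa using ENNReal.toReal_mono ENNReal.one_ne_top h2
    have h5 : 0 ≤ (α p).toReal := ENNReal.toReal_nonneg
    have h6 : 0 ≤ (β p).toReal := ENNReal.toReal_nonneg
    rw [abs_le]; constructor <;> linarith
  -- The difference of the Radon–Nikodym derivatives lies in `[-1, 1]` only almost everywhere;
  -- clamping it gives the bound at every point.
  refine ⟨fun p => max (-1) (min 1 ((α p).toReal - (β p).toReal)), ?_, ?_, ?_⟩
  · have h1 : Measurable α := Measure.measurable_rnDeriv _ _
    have h2 : Measurable β := Measure.measurable_rnDeriv _ _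
    fun_prop
  · intro p
    rw [abs_le]
    exact ⟨le_max_left _ _, max_le (by norm_num) (min_le_left _ _)⟩
  · intro ψ hψ
    have e1 := integral_rnDeriv_smul (f := ψ) (Measure.absolutelyContinuous_of_le hμ)
    have e2 := integral_rnDeriv_smul (f := ψ) (Measure.absolutelyContinuous_of_le hν)
    have i1 := (integrable_rnDeriv_smul_iff (f := ψ)
      (Measure.absolutelyContinuous_of_le hμ)).2 (hψ.mono_measure hμ)
    have i2 := (integrable_rnDeriv_smul_iff (f := ψ)
      (Measure.absolutelyContinuous_of_le hν)).2 (hψ.mono_measure hν)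
    rw [← e1, ← e2, ← integral_sub i1 i2]
    refine integral_congr_ae ?_
    filter_upwards [hαβ] with p hp
    rw [abs_le] at hp
    rw [min_eq_right hp.2, max_eq_right hp.1]
    simp only [smul_eq_mul]; ring

/-- The factorization of `μ ⊗ μ - ν ⊗ ν` on symmetric functions. -/
lemma integral_prod_sub_prod {μ ν : Measure (Space d)} [IsFiniteMeasure μ] [IsFiniteMeasure ν]
    {σ : Space d → ℝ} (hσm : Measurable σ) (hσ1 : ∀ p, |σ p| ≤ 1)
    (hσ : ∀ ψ : Space d → ℝ, Integrable ψ (μ + ν) →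
        ∫ p, ψ p ∂μ - ∫ p, ψ p ∂ν = ∫ p, ψ p * σ p ∂(μ + ν))
    {F : Space d × Space d → ℝ} (hF : ∀ x, F x.swap = F x)
    (hint : Integrable F ((μ + ν).prod (μ + ν))) :
    ∫ x, F x ∂(μ.prod μ) - ∫ x, F x ∂(ν.prod ν) =
      ∫ x, F x * σ x.1 ∂((μ + ν).prod (μ + ν)) := by
  have hdec : (μ + ν).prod (μ + ν) = (μ.prod μ + μ.prod ν) + (ν.prod μ + ν.prod ν) := by
    rw [Measure.prod_add, Measure.add_prod, Measure.add_prod]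
    abel
  have hint' := hint
  rw [hdec] at hint'
  have hμμ := hint'.left_of_add_measure.left_of_add_measure
  have hμν := hint'.left_of_add_measure.right_of_add_measure
  have hνμ := hint'.right_of_add_measure.left_of_add_measure
  have hνν := hint'.right_of_add_measure.right_of_add_measure
  -- By symmetry of `F` the two cross terms agree, so that on `F` the measure `μ ⊗ μ - ν ⊗ ν` acts
  -- as `(μ - ν) ⊗ (μ + ν)`.
  have hsw : ∫ x, F x ∂(μ.prod ν) = ∫ x, F x ∂(ν.prod μ) := by
    rw [← integral_prod_swap F]
    simp [hF]
  have h1 : ∫ x, F x ∂(μ.prod (μ + ν)) = ∫ x, F x ∂(μ.prod μ) + ∫ x, F x ∂(μ.prod ν) := by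
    rw [Measure.prod_add, integral_add_measure hμμ hμν]
  have h2 : ∫ x, F x ∂(ν.prod (μ + ν)) = ∫ x, F x ∂(ν.prod μ) + ∫ x, F x ∂(ν.prod ν) := by
    rw [Measure.prod_add, integral_add_measure hνμ hνν]
  have i1 : Integrable F (μ.prod (μ + ν)) := by
    rw [Measure.prod_add]; exact hμμ.add_measure hμν
  have i2 : Integrable F (ν.prod (μ + ν)) := by
    rw [Measure.prod_add]; exact hνμ.add_measure hνν
  have hFσ : Integrable (fun x => F x * σ x.1) ((μ + ν).prod (μ + ν)) :=
    hint.mul_bdd (c := 1) (hσm.comp measurable_fst).aestronglyMeasurable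
      (ae_of_all _ fun x => hσ1 x.1)
  have h3 := hσ (fun p => ∫ q, F (p, q) ∂(μ + ν)) hint.integral_prod_left
  rw [← integral_prod F i1, ← integral_prod F i2] at h3
  rw [integral_prod _ hFσ]
  simp_rw [integral_mul_const]
  linarith

lemma IsEven.integral_comp_neg {ν : Measure (Space d)} (hν : IsEven ν) (F : Space d → ℝ) :
    ∫ q, F (-q) ∂ν = ∫ q, F q ∂ν := by
  conv_rhs => rw [← hν]
  exact (integral_map_equiv (MeasurableEquiv.neg (Space d)) F).symm

/-- Symmetrization in the second variable. -/
lemma IsEven.integral_prod_symmetrize {μ ν : Measure (Space d)} [SFinite μ] [SFinite ν]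
    (hν : IsEven ν) {F : Space d × Space d → ℝ} (hF : Integrable F (μ.prod ν)) :
    Integrable (fun x : Space d × Space d => F (x.1, -x.2)) (μ.prod ν) ∧
    ∫ x, F x ∂(μ.prod ν) = ∫ x, 2⁻¹ * (F x + F (x.1, -x.2)) ∂(μ.prod ν) := by
  have hmp : MeasurePreserving (((MeasurableEquiv.refl (Space d)).prodCongr
      (MeasurableEquiv.neg (Space d)))) (μ.prod ν) (μ.prod ν) := by
    have h1 : MeasurePreserving (fun q : Space d => -q) ν ν := ⟨measurable_neg, hν⟩
    exact (MeasurePreserving.id μ).prod h1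
  have hi : Integrable (fun x : Space d × Space d => F (x.1, -x.2)) (μ.prod ν) :=
    hmp.integrable_comp_of_integrable hF
  have he : ∫ x, F (x.1, -x.2) ∂(μ.prod ν) = ∫ x, F x ∂(μ.prod ν) := hmp.integral_comp' F
  refine ⟨hi, ?_⟩
  rw [integral_const_mul, integral_add hF hi, he]
  ring

lemma abs_inner_le_wt (p q : Space d) : |inner ℝ p q| ≤ wt p * wt q := by
  refine (abs_real_inner_le_norm p q).trans ?_
  unfold wt
  exact mul_le_mul (by nlinarith [sq_nonneg (‖p‖ - 1)]) (by nlinarith [sq_nonneg (‖q‖ - 1)])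
    (norm_nonneg _) (by positivity)

lemma measurable_inner' : Measurable (fun x : Space d × Space d => inner ℝ x.1 x.2) :=
  (continuous_fst.inner continuous_snd).measurable

/-- The sign that makes the moment of order two dissipative. -/
lemma IsRate.integral_mul_inner_nonpos {a : Space d → Space d → ℝ} (ha : IsRate a)
    {D D' : ℝ} {μ ν : Measure (Space d)} (hμ : MomentBound D μ) (h : MomentBound D' ν)
    (hν : IsEven ν) {g : Space d → ℝ} (hg : Measurable g) (hg0 : ∀ p, 0 ≤ g p)
    (hg1 : ∀ p, g p ≤ 1) :
    Integrable (fun x : Space d × Space d => a x.1 x.2 * (g x.1 * inner ℝ x.1 x.2)) (μ.prod ν) ∧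
    ∫ x, a x.1 x.2 * (g x.1 * inner ℝ x.1 x.2) ∂(μ.prod ν) ≤ 0 := by
  have := hμ.isFiniteMeasure
  have := h.isFiniteMeasure
  have hint : Integrable (fun x : Space d × Space d => a x.1 x.2 * (g x.1 * inner ℝ x.1 x.2))
      (μ.prod ν) := by
    refine hμ.integrable_prod_of_le h
      (ha.meas.mul ((hg.comp measurable_fst).mul measurable_inner')) (C := 2 * 1)
      fun x => ha.abs_mul_le ?_
    rw [abs_mul, abs_of_nonneg (hg0 _)]
    exact mul_le_mul (hg1 _) (abs_inner_le_wt _ _) (abs_nonneg _) zero_le_one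
  refine ⟨hint, ?_⟩
  -- Averaging over `q ↦ -q` turns the integrand into half of `g(p) (a(p,q) - a(p,-q)) ⟨p,q⟩`, whose
  -- last two factors have opposite signs by `IsRate.mono`.
  rw [(hν.integral_prod_symmetrize hint).2]
  refine integral_nonpos fun x => ?_
  have key : (a x.1 x.2 - a x.1 (-x.2)) * inner ℝ x.1 x.2 ≤ 0 := by
    rcases le_total 0 (inner ℝ x.1 x.2) with hx | hx
    · exact mul_nonpos_of_nonpos_of_nonneg (sub_nonpos.2 (ha.mono _ _ hx)) hx
    · have := ha.mono x.1 (-x.2) (by rw [inner_neg_right]; linarith)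
      rw [neg_neg] at this
      exact mul_nonpos_of_nonneg_of_nonpos (sub_nonneg.2 this) hx
  have := mul_nonpos_of_nonneg_of_nonpos (hg0 x.1) key
  simp only [inner_neg_right, Pi.zero_apply]
  linarith

/-! ### The dissipation estimate -/

lemma wt_add_eq (p q : Space d) :
    wt (p + q) = wt p + wt q - 1 + 2 * inner ℝ p q := by
  unfold wt
  rw [norm_add_sq_real]; ring

section Dissipation

variable {S : Set (Space d)} {W : ℝ} {σ ε : Space d → ℝ}

/-- The truncated and signed weight. -/
def signedWt (S : Set (Space d)) (ε : Space d → ℝ) : Space d → ℝ :=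
  S.indicator fun p => wt p * ε p

lemma measurable_signedWt (hS : MeasurableSet S) (hε : Measurable ε) :
    Measurable (signedWt S ε) :=
  (measurable_wt.mul hε).indicator hS

lemma abs_signedWt_le (hε : ∀ p, |ε p| ≤ 1) (p : Space d) : |signedWt S ε p| ≤ 1 * wt p := by
  unfold signedWt
  by_cases hp : p ∈ S
  · rw [indicator_of_mem hp, abs_mul, abs_of_nonneg (wt_nonneg p), one_mul]
    exact mul_le_of_le_one_right (wt_nonneg p) (hε p)
  · rw [indicator_of_notMem hp, abs_zero, one_mul]
    exact wt_nonneg p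

/-- What is lost when the sign of `σ` is replaced by `ε`. -/
def signDefect (S : Set (Space d)) (σ ε : Space d → ℝ) : Space d → ℝ :=
  S.indicator fun p => wt p * (|σ p| - ε p * σ p)

lemma signDefect_nonneg (hε : ∀ p, |ε p| ≤ 1) (p : Space d) : 0 ≤ signDefect S σ ε p := by
  refine indicator_nonneg (fun p _ => mul_nonneg (wt_nonneg p) (sub_nonneg.2 ?_)) p
  refine (le_abs_self _).trans ?_
  rw [abs_mul]
  exact mul_le_of_le_one_left (abs_nonneg _) (hε p)

lemma signDefect_le (hσ : ∀ p, |σ p| ≤ 1) (hε : ∀ p, |ε p| ≤ 1) (p : Space d) :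
    signDefect S σ ε p ≤ 2 * wt p := by
  unfold signDefect
  refine indicator_le' (fun p _ => ?_) (fun p _ => mul_nonneg zero_le_two (wt_nonneg p)) p
  have h1 := hσ p
  have h2 : |ε p * σ p| ≤ 1 := by
    rw [abs_mul]; exact mul_le_one₀ (hε p) (abs_nonneg _) (hσ p)
  have h3 := (abs_le.1 h2).1
  nlinarith [wt_pos p]

lemma measurable_signDefect (hS : MeasurableSet S) (hσ : Measurable σ) (hε : Measurable ε) :
    Measurable (signDefect S σ ε) :=
  (measurable_wt.mul (hσ.abs.sub (hε.mul hσ))).indicator hS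

/-- In the ideal case `S = univ`, `ε = sgn σ`, the left side is at most `a |σ(p)| (wt(p+q) + wt(q) -
wt(p))`, and `wt_add_eq` removes `wt(p)` from the bracket, leaving less than `2 wt(q) + 2 ⟨p,q⟩`.
The last two terms on the right are the errors: outside `S` the negative term `-wt(p)` is missing,
and on `S` a wrong sign costs `signDefect`, where one factor `wt(p)` is bounded by `W`. -/
lemma defect_signedWt_mul_le (hσ : ∀ p, |σ p| ≤ 1) (hε : ∀ p, |ε p| ≤ 1)
    (hSW : ∀ p ∈ S, wt p ≤ W) {a : Space d → Space d → ℝ} (ha : IsRate a)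
    (x : Space d × Space d) :
    a x.1 x.2 * defect (signedWt S ε) x * σ x.1 ≤
      4 * (wt x.1 * |σ x.1| * wt x.2 ^ 2) + 2 * (a x.1 x.2 * (|σ x.1| * inner ℝ x.1 x.2)) +
      2 * (Sᶜ.indicator (fun p => wt p ^ 2) x.1 * wt x.2) +
      2 * W * (signDefect S σ ε x.1 * wt x.2) := by
  obtain ⟨p, q⟩ := x
  dsimp only
  have ha0 := ha.nonneg p q
  have ha1 := ha.le_wt p q
  have hwp := one_le_wt p
  have hwq := one_le_wt q
  have hs0 := abs_nonneg (σ p)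
  have hs1 := hσ p
  have h1 : signedWt S ε (p + q) * σ p ≤ wt (p + q) * |σ p| := by
    refine (le_abs_self _).trans ?_
    rw [abs_mul]
    exact mul_le_mul_of_nonneg_right ((abs_signedWt_le hε _).trans (one_mul _).le) hs0
  have h2 : -(signedWt S ε q * σ p) ≤ wt q * |σ p| := by
    refine (neg_le_abs _).trans ?_
    rw [abs_mul]
    exact mul_le_mul_of_nonneg_right ((abs_signedWt_le hε _).trans (one_mul _).le) hs0
  have hd : defect (signedWt S ε) (p, q) * σ p ≤
      |σ p| * (2 * wt q + 2 * inner ℝ p q) +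
        (wt p * |σ p| - signedWt S ε p * σ p) := by
    have : wt (p + q) * |σ p| + wt q * |σ p| - wt p * |σ p| ≤
        |σ p| * (2 * wt q + 2 * inner ℝ p q) := by
      rw [wt_add_eq]; nlinarith
    have e : defect (signedWt S ε) (p, q) * σ p = signedWt S ε (p + q) * σ p
      + -(signedWt S ε q * σ p) - signedWt S ε p * σ p := by
      unfold defect; ring
    rw [e]; linarith
  have hm := mul_le_mul_of_nonneg_left hd ha0
  have hA : a p q * (|σ p| * (2 * wt q)) ≤ 4 * (wt p * |σ p| * wt q ^ 2) := by
    have := mul_le_mul_of_nonneg_right ha1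
      (mul_nonneg hs0 (by linarith : (0 : ℝ) ≤ 2 * wt q))
    refine this.trans (le_of_eq (by ring))
  have hB : a p q * (wt p * |σ p| - signedWt S ε p * σ p) ≤
      2 * (Sᶜ.indicator (fun p => wt p ^ 2) p * wt q) + 2 * W * (signDefect S σ ε p * wt q) := by
    by_cases hp : p ∈ S
    · have hpc : p ∉ Sᶜ := fun h => h hp
      have hδ := signDefect_nonneg (S := S) (σ := σ) hε p
      have e : wt p * |σ p| - signedWt S ε p * σ p = signDefect S σ ε p := by
        unfold signedWt signDefect
        rw [indicator_of_mem hp, indicator_of_mem hp]; ring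
      rw [indicator_of_notMem hpc, e]
      have h3 := mul_le_mul_of_nonneg_right ha1 hδ
      have h4 := mul_le_mul_of_nonneg_right (hSW p hp)
        (mul_nonneg hδ (wt_nonneg q))
      nlinarith
    · have hpc : p ∈ Sᶜ := hp
      have e1 : signedWt S ε p = 0 := indicator_of_notMem hp _
      have e2 : signDefect S σ ε p = 0 := indicator_of_notMem hp _
      rw [indicator_of_mem hpc, e1, e2]
      have h3 : wt p * |σ p| ≤ wt p := mul_le_of_le_one_right (wt_nonneg p) hs1
      have h4 := mul_le_mul ha1 h3 (mul_nonneg (wt_nonneg p) hs0)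
        (by nlinarith : (0 : ℝ) ≤ 2 * wt p * wt q)
      nlinarith
  nlinarith

lemma integral_defect_signedWt_le {D : ℝ} {u : Measure (Space d)}
    (hu : MomentBound D u) (hue : IsEven u) (hσm : Measurable σ) (hεm : Measurable ε)
    (hS : MeasurableSet S) (hσ : ∀ p, |σ p| ≤ 1) (hε : ∀ p, |ε p| ≤ 1) (hW : 0 ≤ W)
    (hSW : ∀ p ∈ S, wt p ≤ W) {a : Space d → Space d → ℝ} (ha : IsRate a) :
    ∫ x, a x.1 x.2 * defect (signedWt S ε) x * σ x.1 ∂(u.prod u) ≤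
      4 * D * ∫ p, wt p * |σ p| ∂u + 2 * D * ∫ p, Sᶜ.indicator (fun p => wt p ^ 2) p ∂u +
      2 * W * D * ∫ p, signDefect S σ ε p ∂u := by
  have := hu.isFiniteMeasure
  have hσi : Integrable (fun p => wt p * |σ p|) u :=
    hu.integrable_of_le (by fun_prop) (C := 1) fun p => by
      rw [abs_mul, abs_abs, abs_of_nonneg (wt_nonneg p), one_mul]
      exact mul_le_of_le_one_right (wt_nonneg p) (hσ p)
  have hSi : Integrable (Sᶜ.indicator fun p => wt p ^ 2) u := hu.integrable.indicator hS.compl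
  have hδi : Integrable (signDefect S σ ε) u :=
    hu.integrable_of_le (measurable_signDefect hS hσm hεm) (C := 2) fun p => by
      rw [abs_of_nonneg (signDefect_nonneg hε p)]
      exact signDefect_le hσ hε p
  have hin := ha.integral_mul_inner_nonpos hu hu hue hσm.abs (fun p => abs_nonneg (σ p)) hσ
  have i1 : Integrable (fun x : Space d × Space d => wt x.1 * |σ x.1| * wt x.2 ^ 2) (u.prod u) :=
    hσi.mul_prod hu.integrable
  have i2 : Integrable (fun x : Space d × Space d =>
      Sᶜ.indicator (fun p => wt p ^ 2) x.1 * wt x.2) (u.prod u) := hSi.mul_prod hu.integrable_wt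
  have i3 : Integrable (fun x : Space d × Space d => signDefect S σ ε x.1 * wt x.2) (u.prod u) :=
    hδi.mul_prod hu.integrable_wt
  have iL : Integrable (fun x : Space d × Space d =>
      a x.1 x.2 * defect (signedWt S ε) x * σ x.1) (u.prod u) :=
    (ha.integrable_mul_defect (measurable_signedWt hS hεm) (abs_signedWt_le hε) hu hu).mul_bdd
      (c := 1) (hσm.comp measurable_fst).aestronglyMeasurable (ae_of_all _ fun x => hσ x.1)
  refine (integral_mono iL
    ((((i1.const_mul 4).add (hin.1.const_mul 2)).add (i2.const_mul 2)).add (i3.const_mul (2 * W)))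
    (defect_signedWt_mul_le hσ hε hSW ha)).trans ?_
  rw [integral_add' (((i1.const_mul 4).add (hin.1.const_mul 2)).add (i2.const_mul 2))
      (i3.const_mul (2 * W)),
    integral_add' ((i1.const_mul 4).add (hin.1.const_mul 2)) (i2.const_mul 2),
    integral_add' (i1.const_mul 4) (hin.1.const_mul 2)]
  simp only [integral_const_mul]
  rw [integral_prod_mul (fun p => wt p * |σ p|) (fun q => wt q ^ 2),
    integral_prod_mul (Sᶜ.indicator fun p => wt p ^ 2) wt,
    integral_prod_mul (signDefect S σ ε) wt]
  have p1 : (0 : ℝ) ≤ ∫ p, wt p * |σ p| ∂u :=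
    integral_nonneg fun p => mul_nonneg (wt_nonneg p) (abs_nonneg _)
  have p2 : (0 : ℝ) ≤ ∫ p, Sᶜ.indicator (fun p => wt p ^ 2) p ∂u :=
    integral_nonneg fun p => indicator_nonneg (fun p _ => by positivity) p
  have p3 : (0 : ℝ) ≤ ∫ p, signDefect S σ ε p ∂u :=
    integral_nonneg fun p => signDefect_nonneg hε p
  have q1 := mul_le_mul_of_nonneg_left hu.le p1
  have q2 := mul_le_mul_of_nonneg_left hu.integral_wt_le p2
  have q3 := mul_le_mul_of_nonneg_left (mul_le_mul_of_nonneg_left hu.integral_wt_le p3) hW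
  have q4 := hin.2
  linarith

lemma IsEven.add {μ ν : Measure (Space d)} (hμ : IsEven μ) (hν : IsEven ν) : IsEven (μ + ν) := by
  unfold IsEven at *
  rw [Measure.map_add _ _ measurable_neg, hμ, hν]

/-- The difference splits into `coll a μ - coll a ν`, which factors through `σ` and `μ + ν`, and the
effect of `a - b` on `ν`, bounded by `|defect| ≤ 4 wt wt`. The measure `μ + ν` has moment bound
`2D`, a doubling offset by the factor `1/2` in `coll`. -/
lemma coll_sub_coll_le {a b : Space d → Space d → ℝ} (ha : IsRate a) (hb : IsRate b) {D : ℝ}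
    {μ ν : Measure (Space d)} (hμ : MomentBound D μ) (hν : MomentBound D ν)
    (hμe : IsEven μ) (hνe : IsEven ν) (hσm : Measurable σ) (hσ : ∀ p, |σ p| ≤ 1)
    (hσi : ∀ ψ : Space d → ℝ, Integrable ψ (μ + ν) →
        ∫ p, ψ p ∂μ - ∫ p, ψ p ∂ν = ∫ p, ψ p * σ p ∂(μ + ν))
    (hεm : Measurable ε) (hε : ∀ p, |ε p| ≤ 1) (hS : MeasurableSet S) (hW : 0 ≤ W)
    (hSW : ∀ p ∈ S, wt p ≤ W) :
    coll a (signedWt S ε) μ - coll b (signedWt S ε) ν ≤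
      4 * D * ∫ p, wt p * |σ p| ∂(μ + ν) +
      2 * D * ∫ p, Sᶜ.indicator (fun p => wt p ^ 2) p ∂(μ + ν) +
      2 * W * D * ∫ p, signDefect S σ ε p ∂(μ + ν) +
      2 * ∫ x, |a x.1 x.2 - b x.1 x.2| * (wt x.1 * wt x.2) ∂(ν.prod ν) := by
  have := hμ.isFiniteMeasure
  have := hν.isFiniteMeasure
  have hψm := measurable_signedWt hS hεm
  have hψ := abs_signedWt_le (S := S) hε
  have hu := hμ.add hν
  have h1 := integral_prod_sub_prod hσm hσ hσi
    (F := fun x => a x.1 x.2 * defect (signedWt S ε) x)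
    (fun x => by simp only [Prod.fst_swap, Prod.snd_swap, defect, ha.symm x.2, add_comm x.2]; ring)
    (ha.integrable_mul_defect hψm hψ hu hu)
  have h2 := integral_defect_signedWt_le hu (hμe.add hνe) hσm hεm hS hσ hε hW hSW ha
  rw [← h1] at h2
  have i1 := ha.integrable_mul_defect hψm hψ hν hν
  have i2 := hb.integrable_mul_defect hψm hψ hν hν
  have i3 : Integrable (fun x : Space d × Space d =>
      |a x.1 x.2 - b x.1 x.2| * (wt x.1 * wt x.2)) (ν.prod ν) := by
    have m1 := ha.meas
    have m2 := hb.meas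
    refine hν.integrable_prod_of_le hν (by fun_prop) (C := 2) fun x => ?_
    rw [abs_mul, abs_abs, abs_of_nonneg (mul_nonneg (wt_nonneg x.1) (wt_nonneg x.2))]
    have h : |a x.1 x.2 - b x.1 x.2| ≤ 2 * wt x.1 * wt x.2 :=
      abs_sub_le_of_nonneg_of_le (ha.nonneg _ _) (ha.le_wt _ _) (hb.nonneg _ _) (hb.le_wt _ _)
    refine (mul_le_mul_of_nonneg_right h (mul_nonneg (wt_nonneg x.1) (wt_nonneg x.2))).trans
      (le_of_eq (by ring))
  have h3 : ∫ x, a x.1 x.2 * defect (signedWt S ε) x ∂(ν.prod ν) -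
      ∫ x, b x.1 x.2 * defect (signedWt S ε) x ∂(ν.prod ν) ≤
      4 * ∫ x, |a x.1 x.2 - b x.1 x.2| * (wt x.1 * wt x.2) ∂(ν.prod ν) := by
    rw [← integral_sub i1 i2, ← integral_const_mul]
    refine integral_mono (i1.sub i2) (i3.const_mul 4) fun x => ?_
    dsimp only
    rw [← sub_mul]
    refine (le_abs_self _).trans ?_
    rw [abs_mul]
    refine (mul_le_mul_of_nonneg_left (abs_defect_le hψ x) (abs_nonneg _)).trans
      (le_of_eq (by ring))
  unfold coll
  linarith

end Dissipation

/-! ### Stability -/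

/-- Stability of strong solutions in the total variation norm with weight `1 + |p|²`, with respect
to the rate and to the initial datum. -/
theorem IsStrongSolution.stability {a b : Space d → Space d → ℝ} (ha : IsRate a) (hb : IsRate b)
    {T D : ℝ} {f g : Kernel ℝ (Space d)} (hD : 0 < D) (hf : IsStrongSolution a T D f)
    (hg : IsStrongSolution b T D g) {e N₀ : ℝ}
    (herr : ∀ t ∈ Icc 0 T,
      ∫ x, |a x.1 x.2 - b x.1 x.2| * (wt x.1 * wt x.2) ∂((g t).prod (g t)) ≤ e)
    (hN₀ : ∀ ψ : Space d → ℝ, Measurable ψ → (∀ p, |ψ p| ≤ wt p) →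
      |∫ p, ψ p ∂(f 0) - ∫ p, ψ p ∂(g 0)| ≤ N₀) {t : ℝ} (ht : t ∈ Icc 0 T)
    {ψ : Space d → ℝ} (hψm : Measurable ψ) (hψ : ∀ p, |ψ p| ≤ wt p) :
    |∫ p, ψ p ∂(f t) - ∫ p, ψ p ∂(g t)| ≤ (N₀ + 2 * e * T) * Real.exp (4 * D * t) := by
  have hT : 0 ≤ T := ht.1.trans ht.2
  have := isFiniteKernel_of_momentBound hf.moment
  have := isFiniteKernel_of_momentBound hg.moment
  have hu : ∀ t, MomentBound (D + D) (f t + g t) := fun t => (hf.moment t).add (hg.moment t)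
  choose σ hσm hσ hσi using fun t => exists_density_sub (f t) (g t)
  set ε : ℝ → Space d → ℝ := fun t p => if 0 ≤ σ t p then 1 else -1 with hεdef
  have hεm : ∀ t, Measurable (ε t) := fun t =>
    Measurable.ite (measurableSet_le measurable_const (hσm t)) measurable_const measurable_const
  have hε : ∀ t p, |ε t p| ≤ 1 := fun t p => by
    simp only [hεdef]; split_ifs <;> simp
  have hεσ : ∀ t p, ε t p * σ t p = |σ t p| := fun t p => by
    simp only [hεdef]
    split_ifs with h
    · rw [one_mul, abs_of_nonneg h]
    · rw [abs_of_neg (not_le.1 h)]; ring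
  -- the difference tested against a function
  set h : ℝ → (Space d → ℝ) → ℝ := fun t ψ => ∫ p, ψ p ∂(f t) - ∫ p, ψ p ∂(g t) with hh
  have hhσ : ∀ t (ψ : Space d → ℝ), Measurable ψ → (∀ p, |ψ p| ≤ 1 * wt p) →
      h t ψ = ∫ p, ψ p * σ t p ∂(f t + g t) := fun t ψ hψm hψ =>
    hσi t ψ ((hu t).integrable_of_le hψm hψ)
  have hlip : ∀ (ψ : Space d → ℝ), Measurable ψ → (∀ p, |ψ p| ≤ 1 * wt p) →
      ∀ s ∈ Icc 0 T, ∀ t ∈ Icc 0 T, h t ψ ≤ h s ψ + 8 * D ^ 2 * |t - s| := by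
    intro ψ hψm hψ s hs t ht
    have h1 := abs_le.1 (hf.abs_integral_sub_le ha hψm zero_le_one hψ hs ht)
    have h2 := abs_le.1 (hg.abs_integral_sub_le hb hψm zero_le_one hψ hs ht)
    simp only [hh]; linarith [h1.2, h2.1]
  set Φ : Set (Space d) → ℝ → ℝ := fun S t => h t (signedWt S (ε t)) with hΦ
  have hw := fun (S : Set (Space d)) (hS : MeasurableSet S) t => measurable_signedWt hS (hεm t)
  have hw1 := fun (S : Set (Space d)) t => abs_signedWt_le (S := S) (hε t)
  -- optimality of the sign
  have hopt : ∀ (S : Set (Space d)), MeasurableSet S → ∀ t (η : Space d → ℝ), Measurable η →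
      (∀ p, |η p| ≤ 1) →
      Φ S t - h t (signedWt S η) = ∫ p, signDefect S (σ t) η p ∂(f t + g t) := by
    intro S hS t η hη hη1
    simp only [hΦ]
    rw [hhσ t _ (hw S hS t) (hw1 S t),
      hhσ t _ (measurable_signedWt hS hη) (abs_signedWt_le hη1), ← integral_sub]
    · congr 1 with p
      unfold signedWt signDefect
      by_cases hp : p ∈ S
      · simp only [indicator_of_mem hp, ← hεσ t p]; ring
      · simp [indicator_of_notMem hp]
    · exact ((hu t).integrable_of_le (hw S hS t) (hw1 S t)).mul_bdd (c := 1)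
        (hσm t).aestronglyMeasurable (ae_of_all _ (hσ t))
    · exact ((hu t).integrable_of_le (measurable_signedWt hS hη) (abs_signedWt_le hη1)).mul_bdd
        (c := 1) (hσm t).aestronglyMeasurable (ae_of_all _ (hσ t))
  have hopt' : ∀ (S : Set (Space d)), MeasurableSet S → ∀ t (η : Space d → ℝ), Measurable η →
      (∀ p, |η p| ≤ 1) → h t (signedWt S η) ≤ Φ S t := by
    intro S hS t η hη hη1
    have h1 := hopt S hS t η hη hη1
    have h2 : 0 ≤ ∫ p, signDefect S (σ t) η p ∂(f t + g t) :=
      integral_nonneg fun p => signDefect_nonneg hη1 p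
    linarith
  -- The sign `ε t`, used at time `s`, does no better than the optimal `ε s`. Hence `Φ S` is
  -- Lipschitz although nothing is known about the dependence of `ε` on time.
  have hΦlip : ∀ (S : Set (Space d)), MeasurableSet S → ∀ s ∈ Icc 0 T, ∀ t ∈ Icc 0 T,
      Φ S t ≤ Φ S s + 8 * D ^ 2 * |t - s| := fun S hS s hs t ht =>
    (hlip _ (hw S hS t) (hw1 S t) s hs t ht).trans
      (add_le_add_left (hopt' S hS s _ (hεm t) (hε t)) _)
  set N : ℝ → ℝ := Φ univ with hN
  have hNσ : ∀ t, ∫ p, wt p * |σ t p| ∂(f t + g t) = N t := fun t => by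
    simp only [hN, hΦ]
    rw [hhσ t _ (hw _ .univ t) (hw1 _ t)]
    congr 1 with p
    rw [signedWt, indicator_univ, ← hεσ t p]; ring
  have hNcont : ContinuousOn N (Icc 0 T) := by
    refine (LipschitzOnWith.of_dist_le_mul (K := Real.toNNReal (8 * D ^ 2)) ?_).continuousOn
    intro s hs t ht
    rw [Real.coe_toNNReal _ (by positivity), Real.dist_eq, Real.dist_eq, abs_le]
    have h1 := hΦlip univ .univ s hs t ht
    have h2 := hΦlip univ .univ t ht s hs
    rw [abs_sub_comm] at h1
    constructor <;> linarith
  have hNge : ∀ t (ψ : Space d → ℝ), Measurable ψ → (∀ p, |ψ p| ≤ wt p) → h t ψ ≤ N t := by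
    intro t ψ hψm hψ
    have : ψ = signedWt univ fun p => ψ p / wt p := by
      funext p
      rw [signedWt, indicator_univ, mul_div_cancel₀ _ (wt_pos p).ne']
    rw [this]
    refine hopt' univ .univ t _ (hψm.div measurable_wt) fun p => ?_
    rw [abs_div, abs_of_nonneg (wt_nonneg p)]
    exact div_le_one_of_le₀ (hψ p) (wt_nonneg p)
  -- the growth of the truncated norm
  set S : ℕ → Set (Space d) := fun n => {p | wt p ≤ n} with hSdef
  have hS : ∀ n, MeasurableSet (S n) := fun n => measurableSet_le measurable_wt measurable_const
  set tail : ℕ → ℝ → ℝ := fun n t =>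
    ∫ p, (S n)ᶜ.indicator (fun p => wt p ^ 2) p ∂(f t + g t) with htail
  have htail0 : ∀ n t, 0 ≤ tail n t := fun n t =>
    integral_nonneg fun p => indicator_nonneg (fun p _ => by positivity) p
  have htail1 : ∀ n t, tail n t ≤ D + D := fun n t =>
    (integral_mono ((hu t).integrable.indicator (hS n).compl) (hu t).integrable
      (indicator_le_self' fun _ _ => by positivity)).trans (hu t).le
  have htailm : ∀ n, Measurable (tail n) := fun n =>
    ((measurable_wt.pow_const 2).indicator (hS n).compl).stronglyMeasurable.integral_kernel
      (κ := f + g) |>.measurable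
  have htaili : ∀ n s t, IntervalIntegrable (tail n) volume s t := fun n s t =>
    (intervalIntegrable_const (c := D + D)).mono_fun' (htailm n).aestronglyMeasurable
      (ae_of_all _ fun τ => (Real.norm_of_nonneg (htail0 n τ)).trans_le (htail1 n τ))
  have hNi : ∀ s ∈ Icc 0 T, ∀ t ∈ Icc 0 T, IntervalIntegrable N volume s t := fun s hs t ht =>
    (hNcont.mono ((ordConnected_Icc.uIcc_subset hs ht))).intervalIntegrable
  -- On `[s, t]` the sign is frozen at its value at `t`. At an intermediate time its defect of
  -- optimality is at most `16 D² (t - s)`, by the Lipschitz bounds, and integration over `[s, t]`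
  -- makes the error quadratic. The factor `n` comes from `wt ≤ n` on `S n`, hence the need for
  -- truncation.
  have hincr : ∀ n : ℕ, ∀ s ∈ Icc 0 T, ∀ t ∈ Icc 0 T, s ≤ t → Φ (S n) t - Φ (S n) s ≤
      (∫ τ in s..t, (4 * D * N τ + 2 * D * tail n τ + 2 * e)) +
        2 * n * D * (16 * D ^ 2) * (t - s) ^ 2 := by
    intro n s hs t ht hst
    have hψm := hw (S n) (hS n) t
    have hψ := hw1 (S n) t
    have h1 := hf.equation_interval ha hψm zero_le_one hψ hs.1 hst ht.2
    have h2 := hg.equation_interval hb hψm zero_le_one hψ hs.1 hst ht.2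
    have i1 := intervalIntegrable_coll ha hψm zero_le_one hψ hf.moment s t
    have i2 := intervalIntegrable_coll hb hψm zero_le_one hψ hg.moment s t
    have h3 : Φ (S n) t - Φ (S n) s ≤ ∫ τ in s..t,
        (coll a (signedWt (S n) (ε t)) (f τ) - coll b (signedWt (S n) (ε t)) (g τ)) := by
      rw [intervalIntegral.integral_sub i1 i2]
      have := hopt' (S n) (hS n) s _ (hεm t) (hε t)
      simp only [hΦ, hh] at this ⊢
      linarith
    have i3 : IntervalIntegrable (fun τ => 4 * D * N τ + 2 * D * tail n τ + 2 * e) volume s t :=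
      (((hNi s hs t ht).const_mul _).add ((htaili n s t).const_mul _)).add intervalIntegrable_const
    refine h3.trans ?_
    have h4 : ∀ τ ∈ Icc s t, coll a (signedWt (S n) (ε t)) (f τ) -
        coll b (signedWt (S n) (ε t)) (g τ) ≤
        (4 * D * N τ + 2 * D * tail n τ + 2 * e) + 2 * n * D * (16 * D ^ 2) * (t - s) := by
      intro τ hτ
      have hτ' : τ ∈ Icc 0 T := ⟨hs.1.trans hτ.1, hτ.2.trans ht.2⟩
      have key := coll_sub_coll_le ha hb (hf.moment τ) (hg.moment τ) (hf.even τ) (hg.even τ)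
        (hσm τ) (hσ τ) (hσi τ) (hεm t) (hε t) (hS n) (Nat.cast_nonneg n) (fun p hp => hp)
      rw [hNσ, ← hopt (S n) (hS n) τ _ (hεm t) (hε t)] at key
      have k1 := hΦlip (S n) (hS n) t ht τ hτ'
      have k2 := hlip _ hψm hψ τ hτ' t ht
      have k3 : |t - τ| ≤ t - s := by
        rw [abs_of_nonneg (by linarith [hτ.2])]; linarith [hτ.1]
      have k4 : Φ (S n) τ - h τ (signedWt (S n) (ε t)) ≤ 16 * D ^ 2 * (t - s) := by
        rw [abs_sub_comm] at k1
        have : h t (signedWt (S n) (ε t)) = Φ (S n) t := rfl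
        nlinarith [mul_le_mul_of_nonneg_left k3 (by positivity : (0 : ℝ) ≤ 8 * D ^ 2)]
      have k5 := mul_le_mul_of_nonneg_left k4 (by positivity : (0 : ℝ) ≤ 2 * n * D)
      have k6 := herr τ hτ'
      simp only [htail]
      linarith
    refine (intervalIntegral.integral_mono_on hst (i1.sub i2)
      (i3.add intervalIntegrable_const) h4).trans ?_
    rw [intervalIntegral.integral_add i3 intervalIntegrable_const,
      intervalIntegral.integral_const, smul_eq_mul]
    exact le_of_eq (by ring)
  have he : 0 ≤ e := (integral_nonneg fun x => mul_nonneg (abs_nonneg _)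
    (mul_nonneg (wt_nonneg _) (wt_nonneg _))).trans (herr 0 ⟨le_rfl, hT⟩)
  have hN0 : N 0 ≤ N₀ := (le_abs_self _).trans
    (hN₀ _ (hw _ .univ 0) fun p => (hw1 _ 0 p).trans (one_mul _).le)
  have hΦn : ∀ n, ∀ t ∈ Icc 0 T, Φ (S n) t ≤
      N₀ + 2 * e * T + 4 * D * (∫ τ in (0 : ℝ)..t, N τ) + 2 * D * ∫ τ in (0 : ℝ)..t, tail n τ := by
    intro n t ht
    have hsub : ∀ s ∈ Icc 0 t, s ∈ Icc 0 T := fun s hs => ⟨hs.1, hs.2.trans ht.2⟩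
    have h0 : (0 : ℝ) ∈ Icc 0 T := ⟨le_rfl, hT⟩
    have hi : ∀ s ∈ Icc 0 T, ∀ s' ∈ Icc 0 T, IntervalIntegrable
        (fun τ => 4 * D * N τ + 2 * D * tail n τ + 2 * e) volume s s' := fun s hs s' hs' =>
      (((hNi s hs s' hs').const_mul _).add ((htaili n s s').const_mul _)).add
        intervalIntegrable_const
    -- The constant of the quadratic error grows with `n`, so the time step tends to zero at fixed
    -- `n`, and only afterwards `n` tends to infinity.
    have key := sub_le_sub_of_le_add_sq (Φ := Φ (S n))
      (J := fun s => ∫ τ in (0 : ℝ)..s, (4 * D * N τ + 2 * D * tail n τ + 2 * e))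
      (K := 2 * n * D * (16 * D ^ 2)) ht.1 (fun s hs s' hs' hss' => by
        have h1 := hincr n s (hsub s hs) s' (hsub s' hs') hss'
        rw [intervalIntegral.integral_interval_sub_left (hi _ h0 _ (hsub s' hs'))
          (hi _ h0 _ (hsub s hs))]
        exact h1)
    rw [intervalIntegral.integral_same, sub_zero,
      intervalIntegral.integral_add (((hNi 0 h0 t ht).const_mul _).add
        ((htaili n 0 t).const_mul _)) intervalIntegrable_const,
      intervalIntegral.integral_add ((hNi 0 h0 t ht).const_mul _) ((htaili n 0 t).const_mul _),
      intervalIntegral.integral_const_mul, intervalIntegral.integral_const_mul,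
      intervalIntegral.integral_const, smul_eq_mul, sub_zero] at key
    have h2 : Φ (S n) 0 ≤ N₀ := (le_abs_self _).trans
      (hN₀ _ (hw _ (hS n) 0) fun p => (hw1 _ 0 p).trans (one_mul _).le)
    have h3 := mul_le_mul_of_nonneg_right ht.2 he
    linarith
  -- removing the truncation
  have hind : ∀ p : Space d, ∀ᶠ n : ℕ in atTop, p ∈ S n := fun p => by
    obtain ⟨n, hn⟩ := exists_nat_ge (wt p)
    filter_upwards [eventually_ge_atTop n] with m hm
    exact hn.trans (by exact_mod_cast hm)
  have htail_lim : ∀ t, Tendsto (fun n => tail n t) atTop (𝓝 0) := fun t => by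
    have := tendsto_integral_of_dominated_convergence (μ := f t + g t)
      (F := fun n => (S n)ᶜ.indicator fun p => wt p ^ 2) (f := fun _ => (0 : ℝ))
      (fun p => wt p ^ 2)
      (fun n => ((measurable_wt.pow_const 2).indicator (hS n).compl).aestronglyMeasurable)
      (hu t).integrable
      (fun n => ae_of_all _ fun p => by
        rw [Real.norm_of_nonneg (indicator_nonneg (fun p _ => by positivity) p)]
        exact indicator_le_self' (fun _ _ => by positivity) p)
      (ae_of_all _ fun p => by
        refine tendsto_const_nhds.congr' ?_
        filter_upwards [hind p] with n hn
        exact (indicator_of_notMem (fun hc : p ∈ (S n)ᶜ => hc hn) _).symm)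
    simpa using this
  have hΦ_lim : ∀ t, Tendsto (fun n => Φ (S n) t) atTop (𝓝 (N t)) := fun t => by
    simp only [hN, hΦ]
    rw [hhσ t _ (hw _ .univ t) (hw1 _ t)]
    simp_rw [fun n => hhσ t _ (hw _ (hS n) t) (hw1 _ t)]
    refine tendsto_integral_of_dominated_convergence wt
      (fun n => ((hw _ (hS n) t).mul (hσm t)).aestronglyMeasurable) (hu t).integrable_wt
      (fun n => ae_of_all _ fun p => ?_) (ae_of_all _ fun p => ?_)
    · rw [norm_mul, Real.norm_eq_abs, Real.norm_eq_abs]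
      refine (mul_le_mul (hw1 (S n) t p) (hσ t p) (abs_nonneg _)
        (by rw [one_mul]; exact wt_nonneg p)).trans ?_
      rw [one_mul, mul_one]
    · refine tendsto_const_nhds.congr' ?_
      filter_upwards [hind p] with n hn
      rw [signedWt, signedWt, indicator_univ, indicator_of_mem hn]
  have hNint : ∀ t ∈ Icc 0 T, N t ≤ (N₀ + 2 * e * T) + 4 * D * ∫ τ in (0 : ℝ)..t, N τ := by
    intro t ht
    have h1 : Tendsto (fun n => ∫ τ in (0 : ℝ)..t, tail n τ) atTop (𝓝 (∫ τ in (0 : ℝ)..t, 0)) :=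
      intervalIntegral.tendsto_integral_filter_of_dominated_convergence (fun _ => D + D)
        (Eventually.of_forall fun n => (htailm n).aestronglyMeasurable)
        (Eventually.of_forall fun n => ae_of_all _ fun τ _ => by
          rw [Real.norm_of_nonneg (htail0 n τ)]; exact htail1 n τ)
        intervalIntegrable_const (ae_of_all _ fun τ _ => htail_lim τ)
    rw [intervalIntegral.integral_zero] at h1
    have h2 := (h1.const_mul (2 * D)).const_add
      (N₀ + 2 * e * T + 4 * D * (∫ τ in (0 : ℝ)..t, N τ))
    rw [mul_zero, add_zero] at h2
    exact le_of_tendsto_of_tendsto' (hΦ_lim t) h2 fun n => hΦn n t ht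
  have hfin := le_mul_exp_of_le_add_integral (by positivity : 0 < 4 * D) hNcont hNint ht
  rw [abs_le]
  constructor
  · have h1 := hNge t (fun p => -ψ p) hψm.neg fun p => by rw [abs_neg]; exact hψ p
    simp only [hh, integral_neg] at h1
    linarith
  · exact (hNge t ψ hψm hψ).trans hfin

/-! ### Propagation of moments -/

/-- Every cross term of the binomial contains the product `A * B`; multiplying by `A + B` carries
this through the induction. -/
lemma exists_add_pow_le (k : ℕ) : ∃ C : ℝ, 0 ≤ C ∧ ∀ A B : ℝ, 0 ≤ A → 0 ≤ B →
    (A + B) ^ (k + 2) ≤ A ^ (k + 2) + B ^ (k + 2) + C * (A * B * (A + B) ^ k) := by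
  induction k with
  | zero => exact ⟨2, by norm_num, fun A B _ _ => le_of_eq (by ring)⟩
  | succ k ih =>
    obtain ⟨C, hC, h⟩ := ih
    refine ⟨C + 2, by linarith, fun A B hA hB => ?_⟩
    have h1 := mul_le_mul_of_nonneg_left (h A B hA hB) (add_nonneg hA hB)
    have h2 : A ^ (k + 1) ≤ (A + B) ^ (k + 1) := pow_le_pow_left₀ hA (by linarith) _
    have h3 : B ^ (k + 1) ≤ (A + B) ^ (k + 1) := pow_le_pow_left₀ hB (by linarith) _
    have h4 := mul_le_mul_of_nonneg_left (add_le_add h2 h3) (mul_nonneg hA hB)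
    calc (A + B) ^ (k + 1 + 2) = (A + B) * (A + B) ^ (k + 2) := by ring
      _ ≤ _ := h1
      _ = A ^ (k + 1 + 2) + B ^ (k + 1 + 2) + C * (A * B * (A + B) ^ (k + 1)) +
          A * B * (A ^ (k + 1) + B ^ (k + 1)) := by ring
      _ ≤ A ^ (k + 1 + 2) + B ^ (k + 1 + 2) + C * (A * B * (A + B) ^ (k + 1)) +
          A * B * ((A + B) ^ (k + 1) + (A + B) ^ (k + 1)) := by linarith
      _ = _ := by ring

/-- The even part in `y` of `(s + y)^n` has no linear term, so the correction starts at `y²`. The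
odd part is estimated only because multiplication by `s ± y` mixes the two in the induction. -/
lemma exists_even_odd_le (k : ℕ) : ∃ C : ℝ, 0 ≤ C ∧ ∀ s y : ℝ, 0 ≤ s → |y| ≤ s →
    (s + y) ^ (k + 2) + (s - y) ^ (k + 2) ≤ 2 * s ^ (k + 2) + C * (y ^ 2 * s ^ k) ∧
    y * ((s + y) ^ (k + 2) - (s - y) ^ (k + 2)) ≤ C * (y ^ 2 * s ^ (k + 1)) := by
  induction k with
  | zero => exact ⟨4, by norm_num, fun s y hs _ => ⟨by norm_num; nlinarith [sq_nonneg y],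
      le_of_eq (by ring)⟩⟩
  | succ k ih =>
    obtain ⟨C, hC, h⟩ := ih
    refine ⟨2 * C + 2, by linarith, fun s y hs hy => ?_⟩
    obtain ⟨h1, h2⟩ := h s y hs hy
    have hy2 : y ^ 2 ≤ s ^ 2 := sq_le_sq' (abs_le.1 hy).1 (abs_le.1 hy).2
    have p1 : 0 ≤ y ^ 2 * s ^ (k + 1) := by positivity
    have p2 : 0 ≤ y ^ 2 * s ^ (k + 2) := by positivity
    have h3 := mul_le_mul_of_nonneg_left h1 hs
    have h4 := mul_le_mul_of_nonneg_left h2 hs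
    have h5 := mul_le_mul_of_nonneg_left h1 (sq_nonneg y)
    constructor
    · calc (s + y) ^ (k + 1 + 2) + (s - y) ^ (k + 1 + 2)
          = s * ((s + y) ^ (k + 2) + (s - y) ^ (k + 2)) +
            y * ((s + y) ^ (k + 2) - (s - y) ^ (k + 2)) := by ring
        _ ≤ s * (2 * s ^ (k + 2) + C * (y ^ 2 * s ^ k)) + C * (y ^ 2 * s ^ (k + 1)) := by
            linarith
        _ = 2 * s ^ (k + 1 + 2) + 2 * C * (y ^ 2 * s ^ (k + 1)) := by ring
        _ ≤ _ := by linarith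
    · have h6 : C * (y ^ 2 * s ^ k) * y ^ 2 ≤ C * (y ^ 2 * s ^ k) * s ^ 2 :=
        mul_le_mul_of_nonneg_left hy2 (by positivity)
      calc y * ((s + y) ^ (k + 1 + 2) - (s - y) ^ (k + 1 + 2))
          = s * (y * ((s + y) ^ (k + 2) - (s - y) ^ (k + 2))) +
            y ^ 2 * ((s + y) ^ (k + 2) + (s - y) ^ (k + 2)) := by ring
        _ ≤ s * (C * (y ^ 2 * s ^ (k + 1))) +
            y ^ 2 * (2 * s ^ (k + 2) + C * (y ^ 2 * s ^ k)) := by linarith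
        _ = C * (y ^ 2 * s ^ (k + 2)) + 2 * (y ^ 2 * s ^ (k + 2)) +
            C * (y ^ 2 * s ^ k) * y ^ 2 := by ring
        _ ≤ C * (y ^ 2 * s ^ (k + 2)) + 2 * (y ^ 2 * s ^ (k + 2)) +
            C * (y ^ 2 * s ^ k) * s ^ 2 := by linarith
        _ = _ := by ring

/-- The weight `1 + |p|^(2k+4)`. -/
def highWt (k : ℕ) (p : Space d) : ℝ := 1 + (‖p‖ ^ 2) ^ (k + 2)

@[fun_prop]
lemma measurable_highWt (k : ℕ) : Measurable (highWt k : Space d → ℝ) := by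
  unfold highWt; fun_prop

lemma highWt_pos (k : ℕ) (p : Space d) : 0 < highWt k p := by unfold highWt; positivity

/-- The symmetrized production of the moment of order `2k + 4`. -/
lemma exists_production_le (k : ℕ) : ∃ C : ℝ, 0 < C ∧ ∀ a : Space d → Space d → ℝ, IsRate a →
    ∀ p q : Space d, a p q * defect (highWt k) (p, q) + a p (-q) * defect (highWt k) (p, -q) ≤
      C * (highWt k p * wt q + wt p * highWt k q) := by
  obtain ⟨C₁, hC₁, h₁⟩ := exists_even_odd_le k
  obtain ⟨C₂, hC₂, h₂⟩ := exists_add_pow_le k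
  refine ⟨(4 * C₁ + 2 * C₂) * 4 * 2 ^ (k + 1) + 1, by positivity, fun a ha p q => ?_⟩
  set A := ‖p‖ ^ 2 with hA
  set B := ‖q‖ ^ 2 with hB
  have hA0 : 0 ≤ A := sq_nonneg _
  have hB0 : 0 ≤ B := sq_nonneg _
  set y := 2 * inner ℝ p q with hy
  have e1 : ‖p + q‖ ^ 2 = A + B + y := by rw [norm_add_sq_real]; ring
  have e2 : ‖p - q‖ ^ 2 = A + B - y := by rw [norm_sub_sq_real]; ring
  have hyy : y ^ 2 ≤ 4 * (A * B) := by
    have := abs_real_inner_le_norm p q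
    have := sq_le_sq' (abs_le.1 this).1 (abs_le.1 this).2
    rw [hy, hA, hB]; nlinarith
  have hys : |y| ≤ A + B := by
    rw [abs_le]
    constructor
    · have := sq_nonneg ‖p + q‖
      linarith
    · have := sq_nonneg ‖p - q‖
      linarith
  set P := (A + B + y) ^ (k + 2) with hP
  set Q := (A + B - y) ^ (k + 2) with hQ
  set M := A ^ (k + 2) + B ^ (k + 2) with hS
  have hP0 : 0 ≤ A + B + y := by rw [← e1]; positivity
  have hQ0 : 0 ≤ A + B - y := by rw [← e2]; positivity
  have d1 : defect (highWt k) (p, q) = P - M - 1 := by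
    unfold defect highWt
    rw [e1]; ring
  have d2 : defect (highWt k) (p, -q) = Q - M - 1 := by
    unfold defect highWt
    rw [← sub_eq_add_neg, e2, norm_neg]; ring
  -- `P` and `Q` are powers of `|p+q|²` and `|p-q|²`, so `P - Q` has the sign of `⟨p,q⟩`, opposite
  -- to that of `a(p,q) - a(p,-q)`.
  have hcorr : (a p q - a p (-q)) * (P - Q) ≤ 0 := by
    rcases le_total 0 y with hy0 | hy0
    · refine mul_nonpos_of_nonpos_of_nonneg (sub_nonpos.2 (ha.mono p q (by linarith))) ?_
      exact sub_nonneg.2 (pow_le_pow_left₀ hQ0 (by linarith) _)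
    · have := ha.mono p (-q) (by rw [inner_neg_right]; linarith)
      rw [neg_neg] at this
      refine mul_nonpos_of_nonneg_of_nonpos (sub_nonneg.2 this) ?_
      exact sub_nonpos.2 (pow_le_pow_left₀ hP0 (by linarith) _)
  have hs0 : 0 ≤ A + B := add_nonneg hA0 hB0
  -- In the sum `P + Q` only `y² ≤ 4AB` survives, so everything beyond `A^(k+2) + B^(k+2)` carries
  -- the factor `AB`.
  have hpoly : P + Q - 2 * M ≤ (4 * C₁ + 2 * C₂) * (A * B * (A + B) ^ k) := by
    have h3 := (h₁ (A + B) y hs0 hys).1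
    have h4 := h₂ A B hA0 hB0
    have h5 : C₁ * (y ^ 2 * (A + B) ^ k) ≤ C₁ * (4 * (A * B) * (A + B) ^ k) :=
      mul_le_mul_of_nonneg_left (mul_le_mul_of_nonneg_right hyy (by positivity)) hC₁
    rw [hP, hQ, hS]
    nlinarith
  have hab0 : 0 ≤ a p q + a p (-q) := add_nonneg (ha.nonneg _ _) (ha.nonneg _ _)
  have hab : a p q + a p (-q) ≤ 4 * (1 + A + B) := by
    have h3 := ha.bound p q
    have h4 := ha.bound p (-q)
    rw [norm_neg] at h4
    linarith
  -- The larger of the two variables takes up all powers but one of the smaller. Thus each product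
  -- on the right pairs one high weight with one `wt`, and the high moment enters linearly.
  have hgeom : ∀ A B : ℝ, 0 ≤ A → 0 ≤ B → B ≤ A →
      (1 + A + B) * (A * B * (A + B) ^ k) ≤ 2 ^ (k + 1) * (2 * ((1 + A ^ (k + 2)) * (1 + B))) := by
    intro A B hA0 hB0 hBA
    have h3 : (A + B) ^ k ≤ (2 * A) ^ k := pow_le_pow_left₀ (by linarith) (by linarith) k
    have h4 : A ^ (k + 1) ≤ 1 + A ^ (k + 2) := by
      rcases le_total A 1 with h | h
      · have := pow_le_one₀ (n := k + 1) hA0 h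
        have : 0 ≤ A ^ (k + 2) := by positivity
        linarith
      · have := pow_le_pow_right₀ h (Nat.le_succ (k + 1))
        have e : (k + 1).succ = k + 2 := rfl
        rw [e] at this
        linarith
    have p2 : 0 ≤ A ^ (k + 2) := by positivity
    have p1 : 0 ≤ A ^ (k + 1) := by positivity
    calc (1 + A + B) * (A * B * (A + B) ^ k) ≤ (2 * (1 + A)) * (A * B * (2 * A) ^ k) := by
          refine mul_le_mul (by linarith) ?_ (by positivity) (by positivity)
          exact mul_le_mul_of_nonneg_left h3 (by positivity)
      _ = 2 ^ (k + 1) * ((A ^ (k + 1) + A ^ (k + 2)) * B) := by rw [mul_pow]; ring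
      _ ≤ 2 ^ (k + 1) * (2 * (1 + A ^ (k + 2)) * (1 + B)) := by
          refine mul_le_mul_of_nonneg_left ?_ (by positivity)
          exact mul_le_mul (by linarith) (by linarith) hB0 (by positivity)
      _ = _ := by ring
  have hg : (1 + A + B) * (A * B * (A + B) ^ k) ≤
      2 ^ (k + 1) * (2 * (highWt k p * wt q + wt p * highWt k q)) := by
    have n1 : 0 ≤ (1 + A ^ (k + 2)) * (1 + B) := by positivity
    have n2 : 0 ≤ (1 + B ^ (k + 2)) * (1 + A) := by positivity
    have e3 : highWt k p * wt q + wt p * highWt k q =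
      (1 + A ^ (k + 2)) * (1 + B) + (1 + B ^ (k + 2)) * (1 + A) := by
      unfold highWt wt; ring
    rw [e3]
    have hk : (0 : ℝ) ≤ 2 ^ (k + 1) := by positivity
    rcases le_total B A with h | h
    · have := hgeom A B hA0 hB0 h
      nlinarith [mul_nonneg hk n2]
    · have := hgeom B A hB0 hA0 h
      have e4 : (1 + B + A) * (B * A * (B + A) ^ k) = (1 + A + B) * (A * B * (A + B) ^ k) := by
        rw [add_comm B A]; ring
      rw [e4] at this
      nlinarith [mul_nonneg hk n1]
  have hcc : 0 ≤ 4 * C₁ + 2 * C₂ := by positivity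
  have hX : 0 ≤ A * B * (A + B) ^ k := by positivity
  have hR : 0 ≤ highWt k p * wt q + wt p * highWt k q :=
    add_nonneg (mul_nonneg (highWt_pos k p).le (wt_nonneg q))
      (mul_nonneg (wt_nonneg p) (highWt_pos k q).le)
  have f1 := mul_le_mul_of_nonneg_left hpoly hab0
  have f2 := mul_le_mul_of_nonneg_right hab (mul_nonneg hcc hX)
  have f3 := mul_le_mul_of_nonneg_left hg hcc
  have e5 : 4 * (1 + A + B) * ((4 * C₁ + 2 * C₂) * (A * B * (A + B) ^ k)) =
      4 * ((4 * C₁ + 2 * C₂) * ((1 + A + B) * (A * B * (A + B) ^ k))) := by ring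
  -- Polarization: `aP + a'Q` is half of `(a + a')(P + Q) + (a - a')(P - Q)`; the first product is
  -- controlled by `hpoly`, the second by `hcorr`.
  have e6 : a p q * (P - M - 1) + a p (-q) * (Q - M - 1) =
      2⁻¹ * ((a p q + a p (-q)) * (P + Q - 2 * M)) + 2⁻¹ * ((a p q - a p (-q)) * (P - Q)) -
      (a p q + a p (-q)) := by ring
  have e7 : ((4 * C₁ + 2 * C₂) * 4 * 2 ^ (k + 1) + 1) * (highWt k p * wt q + wt p * highWt k q) =
      2 * ((4 * C₁ + 2 * C₂) * (2 ^ (k + 1) * (2 * (highWt k p * wt q + wt p * highWt k q)))) +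
      (highWt k p * wt q + wt p * highWt k q) := by ring
  rw [d1, d2, e6, e7]
  rw [e5] at f2
  linarith

section Support

variable {a : Space d → Space d → ℝ}

lemma abs_indicator_highWt_le (k : ℕ) (r : ℝ) (p : Space d) :
    |(Metric.closedBall (0 : Space d) r).indicator (highWt k) p| ≤
      (1 + (r ^ 2) ^ (k + 2)) * wt p := by
  have h1 : (0 : ℝ) ≤ 1 + (r ^ 2) ^ (k + 2) := by positivity
  by_cases hp : p ∈ Metric.closedBall (0 : Space d) r
  · rw [indicator_of_mem hp, abs_of_pos (highWt_pos k p)]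
    refine le_trans ?_ (le_mul_of_one_le_right h1 (one_le_wt p))
    unfold highWt
    have : ‖p‖ ≤ r := by simpa using hp
    gcongr
  · rw [indicator_of_notMem hp, abs_zero]
    exact mul_nonneg h1 (wt_nonneg p)

/-- The function `highWt k` grows faster than `wt` and is not an admissible test function, so it is
cut off outside the ball carrying `μ`. The cutoff changes only the value at `p + q`, which it
lowers, so the estimate for the full weight still applies. -/
lemma coll_indicator_highWt_le {k : ℕ} {C : ℝ} (hC0 : 0 ≤ C) (hC : ∀ p q : Space d,
      a p q * defect (highWt k) (p, q) + a p (-q) * defect (highWt k) (p, -q) ≤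
      C * (highWt k p * wt q + wt p * highWt k q)) (ha : IsRate a) {r : ℝ} (hr : 0 ≤ r) {D : ℝ}
    {μ : Measure (Space d)} (h : MomentBound D μ) (he : IsEven μ)
    (hsupp : μ (Metric.closedBall 0 r)ᶜ = 0) :
    coll a ((Metric.closedBall 0 r).indicator (highWt k)) μ ≤
      C * ((∫ p, wt p ∂μ) * ∫ p, highWt k p ∂μ) := by
  have := h.isFiniteMeasure
  set K := Metric.closedBall (0 : Space d) r with hK
  have hKm : MeasurableSet K := Metric.isClosed_closedBall.measurableSet
  have hae : ∀ᵐ p ∂μ, p ∈ K := by rw [ae_iff]; exact hsupp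
  have hae2 : ∀ᵐ x ∂(μ.prod μ), x.1 ∈ K ∧ x.2 ∈ K :=
    (Measure.quasiMeasurePreserving_fst.ae hae).and (Measure.quasiMeasurePreserving_snd.ae hae)
  have hVi : Integrable (highWt k) μ := by
    refine (h.integrable_of_le ((measurable_highWt k).indicator hKm)
      (abs_indicator_highWt_le k r)).congr ?_
    filter_upwards [hae] with p hp
    exact indicator_of_mem hp _
  have hnorm : ∀ p ∈ K, ‖p‖ ≤ r := fun p hp => by simpa [hK] using hp
  -- the untruncated production is integrable
  have hFi : Integrable (fun x : Space d × Space d => a x.1 x.2 * defect (highWt k) x)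
      (μ.prod μ) := by
    -- The sum of two points of the ball of radius `r` lies in the ball of radius `2r`, where the
    -- cutoff is invisible.
    set R := 2 * r with hR
    have hKR : Measurable ((Metric.closedBall (0 : Space d) R).indicator (highWt k)) :=
      (measurable_highWt k).indicator Metric.isClosed_closedBall.measurableSet
    refine (ha.integrable_mul_defect hKR (abs_indicator_highWt_le k R) h h).congr ?_
    filter_upwards [hae2] with x hx
    have h1 := hnorm _ hx.1
    have h2 := hnorm _ hx.2
    have m1 : x.1 ∈ Metric.closedBall (0 : Space d) R := by
      rw [mem_closedBall_zero_iff]; linarith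
    have m2 : x.2 ∈ Metric.closedBall (0 : Space d) R := by
      rw [mem_closedBall_zero_iff]; linarith
    have m3 : x.1 + x.2 ∈ Metric.closedBall (0 : Space d) R := by
      rw [mem_closedBall_zero_iff]; linarith [norm_add_le x.1 x.2]
    rw [defect, defect, indicator_of_mem m1, indicator_of_mem m2, indicator_of_mem m3]
  have h1 : ∫ x, a x.1 x.2 * defect (K.indicator (highWt k)) x ∂(μ.prod μ) ≤
      ∫ x, a x.1 x.2 * defect (highWt k) x ∂(μ.prod μ) := by
    refine integral_mono_ae (ha.integrable_mul_defect ((measurable_highWt k).indicator hKm)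
      (abs_indicator_highWt_le k r) h h) hFi ?_
    filter_upwards [hae2] with x hx
    refine mul_le_mul_of_nonneg_left ?_ (ha.nonneg _ _)
    rw [defect, defect, indicator_of_mem hx.1, indicator_of_mem hx.2]
    have : K.indicator (highWt k) (x.1 + x.2) ≤ highWt k (x.1 + x.2) :=
      indicator_le_self' (fun _ _ => (highWt_pos k _).le) _
    linarith
  obtain ⟨hFi', hsym⟩ := he.integral_prod_symmetrize hFi
  have i1 : Integrable (fun x : Space d × Space d => highWt k x.1 * wt x.2) (μ.prod μ) :=
    hVi.mul_prod h.integrable_wt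
  have i2 : Integrable (fun x : Space d × Space d => wt x.1 * highWt k x.2) (μ.prod μ) :=
    h.integrable_wt.mul_prod hVi
  have h2 : ∫ x, a x.1 x.2 * defect (highWt k) x ∂(μ.prod μ) ≤
      ∫ x, 2⁻¹ * (C * (highWt k x.1 * wt x.2 + wt x.1 * highWt k x.2)) ∂(μ.prod μ) := by
    rw [hsym]
    refine integral_mono ((hFi.add hFi').const_mul 2⁻¹)
      (((i1.add i2).const_mul C).const_mul 2⁻¹) fun x => ?_
    exact mul_le_mul_of_nonneg_left (hC x.1 x.2) (by norm_num)
  rw [integral_const_mul, integral_const_mul, integral_add i1 i2,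
    integral_prod_mul (highWt k) wt, integral_prod_mul wt (highWt k)] at h2
  have h3 := h1.trans h2
  have h4 : 0 ≤ C * ((∫ p, wt p ∂μ) * ∫ p, highWt k p ∂μ) := by
    have p1 : 0 ≤ ∫ p, wt p ∂μ := integral_nonneg fun p => wt_nonneg p
    have p2 : 0 ≤ ∫ p, highWt k p ∂μ := integral_nonneg fun p => (highWt_pos k p).le
    positivity
  unfold coll
  nlinarith

/-- The mass and the moment of order two do not increase. -/
lemma coll_wt_nonpos (ha : IsRate a) {D : ℝ} {μ : Measure (Space d)} (h : MomentBound D μ)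
    (he : IsEven μ) : coll a wt μ ≤ 0 := by
  obtain ⟨hi, hle⟩ := ha.integral_mul_inner_nonpos h h he (g := fun _ => 1) measurable_const
    (fun _ => zero_le_one) (fun _ => le_rfl)
  have h1 : ∫ x, a x.1 x.2 * defect wt x ∂(μ.prod μ) ≤
      ∫ x, 2 * (a x.1 x.2 * (1 * inner ℝ x.1 x.2)) ∂(μ.prod μ) := by
    refine integral_mono (ha.integrable_mul_defect measurable_wt (C := 1)
      (fun p => by rw [one_mul, abs_of_pos (wt_pos p)]) h h) (hi.const_mul 2) fun x => ?_
    have := ha.nonneg x.1 x.2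
    simp only [defect, wt_add_eq]
    nlinarith
  rw [integral_const_mul] at h1
  unfold coll
  linarith

lemma IsStrongSolution.integral_wt_le (ha : IsRate a) {T D : ℝ} {f : Kernel ℝ (Space d)}
    (hf : IsStrongSolution a T D f) {t : ℝ} (ht : t ∈ Icc 0 T) :
    ∫ p, wt p ∂(f t) ≤ ∫ p, wt p ∂(f 0) := by
  rw [hf.equation wt measurable_wt ⟨1, fun p => by rw [one_mul, abs_of_pos (wt_pos p)]⟩ t ht]
  have := intervalIntegral.integral_nonneg (f := fun s => -coll a wt (f s)) (μ := volume) ht.1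
    fun s _ => neg_nonneg.2 (coll_wt_nonpos ha (hf.moment s) (hf.even s))
  rw [intervalIntegral.integral_neg] at this
  linarith

/-- Propagation of the moments of high order, for solutions with compact support. -/
theorem exists_integral_highWt_le (k : ℕ) : ∃ C : ℝ, 0 < C ∧
    ∀ a : Space d → Space d → ℝ, IsRate a → ∀ (T D r m : ℝ) (f : Kernel ℝ (Space d)),
      IsStrongSolution a T D f → 0 ≤ r → (∀ t, f t (Metric.closedBall 0 r)ᶜ = 0) → 0 < m →
      ∫ p, wt p ∂(f 0) ≤ m → ∀ t ∈ Icc 0 T,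
        ∫ p, highWt k p ∂(f t) ≤ (∫ p, highWt k p ∂(f 0)) * Real.exp (C * m * t) := by
  obtain ⟨C, hC, hprod⟩ := exists_production_le (d := d) k
  refine ⟨C, hC, fun a ha T D r m f hf hr hsupp hm hm0 => ?_⟩
  set φ := (Metric.closedBall (0 : Space d) r).indicator (highWt k) with hφ
  have hφm : Measurable φ :=
    (measurable_highWt k).indicator Metric.isClosed_closedBall.measurableSet
  have hφb := abs_indicator_highWt_le (d := d) k r
  have hb0 : (0 : ℝ) ≤ 1 + (r ^ 2) ^ (k + 2) := by positivity
  have heq : ∀ t, ∫ p, φ p ∂(f t) = ∫ p, highWt k p ∂(f t) := fun t => by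
    refine integral_congr_ae ?_
    have hae : ∀ᵐ p ∂(f t), p ∈ Metric.closedBall (0 : Space d) r := by
      rw [ae_iff]; exact hsupp t
    filter_upwards [hae] with p hp
    exact indicator_of_mem hp _
  have hcont : ContinuousOn (fun t => ∫ p, highWt k p ∂(f t)) (Icc 0 T) := by
    refine (LipschitzOnWith.of_dist_le_mul
      (K := Real.toNNReal (4 * (1 + (r ^ 2) ^ (k + 2)) * D ^ 2)) ?_).continuousOn
    intro s hs t ht
    rw [Real.coe_toNNReal _ (by positivity), Real.dist_eq, Real.dist_eq, ← heq, ← heq]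
    exact hf.abs_integral_sub_le ha hφm hb0 hφb ht hs
  intro t ht
  refine le_mul_exp_of_le_add_integral (mul_pos hC hm) hcont (fun s hs => ?_) ht
  have h1 := hf.equation φ hφm ⟨_, hφb⟩ s hs
  rw [heq, heq] at h1
  rw [h1, ← intervalIntegral.integral_const_mul]
  have hsub : uIcc 0 s ⊆ Icc 0 T := by
    rw [uIcc_of_le hs.1]; exact Icc_subset_Icc_right hs.2
  refine add_le_add_right (intervalIntegral.integral_mono_on hs.1
    (intervalIntegrable_coll ha hφm hb0 hφb hf.moment 0 s)
    ((hcont.mono hsub).intervalIntegrable.const_mul _) fun τ hτ => ?_) _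
  -- The moment of `wt` stays below its initial bound `m`, so the inequality is linear and the
  -- growth rate `C * m` does not depend on `D` or `r`.
  refine (coll_indicator_highWt_le hC.le (hprod a ha) ha hr (hf.moment τ) (hf.even τ)
    (hsupp τ)).trans ?_
  rw [mul_assoc]
  refine mul_le_mul_of_nonneg_left (mul_le_mul_of_nonneg_right
    ((hf.integral_wt_le ha ⟨hτ.1, hτ.2.trans hs.2⟩).trans hm0)
    (integral_nonneg fun p => (highWt_pos k p).le)) hC.le

end Support

/-! ### Wild sums for truncated rates -/

/-- One aggregation event, or one fictitious event, between particles distributed according to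
`μ` and `ν`. -/
def wildStep (a : Space d → Space d → ℝ) (l : ℝ) (μ ν : Measure (Space d)) : Measure (Space d) :=
  ((μ.prod ν).withDensity fun x => ENNReal.ofReal (a x.1 x.2 / (2 * l))).map (fun x => x.1 + x.2) +
    μ.withDensity fun p => ENNReal.ofReal (1 - l⁻¹ * ∫ q, a p q ∂ν)

/-- The coefficients of the Wild sum. -/
def wild (a : Space d → Space d → ℝ) (l : ℝ) (μ₀ : Measure (Space d)) : ℕ → Measure (Space d)
  | 0 => μ₀
  | k + 1 => ENNReal.ofReal ((k : ℝ) + 1)⁻¹ •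
      ∑ j : Fin (k + 1), wildStep a l (wild a l μ₀ j) (wild a l μ₀ (k - j))

/-- Even measures of mass at most `M` carried by the ball of radius `r`. -/
structure IsEvenCompact (M r : ℝ) (μ : Measure (Space d)) : Prop where
  finite : IsFiniteMeasure μ
  mass : μ.real univ ≤ M
  even : IsEven μ
  support : μ (Metric.closedBall 0 r)ᶜ = 0

lemma isEven_of_integral {μ : Measure (Space d)} [IsFiniteMeasure μ]
    (h : ∀ φ : Space d → ℝ, Measurable φ → (∀ p, |φ p| ≤ 1) → ∫ p, φ (-p) ∂μ = ∫ p, φ p ∂μ) :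
    IsEven μ := by
  ext S hS
  have h1 := h (S.indicator 1) (measurable_one.indicator hS) fun p => by
    by_cases hp : p ∈ S <;> simp [hp]
  have h2 : (fun p => S.indicator (1 : Space d → ℝ) (-p)) =
      ((fun p => -p) ⁻¹' S).indicator 1 := by
    ext p; simp only [indicator, mem_preimage]; rfl
  rw [h2, integral_indicator_one hS, integral_indicator_one (measurable_neg hS)] at h1
  rw [Measure.map_apply measurable_neg hS]
  exact (measureReal_eq_measureReal_iff).1 h1

/-- Truncated rates. -/
structure IsTruncatedRate (a : Space d → Space d → ℝ) (K r : ℝ) : Prop extends IsRate a where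
  le : ∀ p q, a p q ≤ K
  vanish : ∀ p q, r < ‖p + q‖ → a p q = 0

section Wild

variable {a : Space d → Space d → ℝ} {K r M l : ℝ} {μ ν : Measure (Space d)}

lemma IsTruncatedRate.nonneg_bound (ha : IsTruncatedRate a K r) : 0 ≤ K :=
  (ha.nonneg 0 0).trans (ha.le 0 0)

lemma IsTruncatedRate.abs_mul_le_of_bounded (ha : IsTruncatedRate a K r) {φ : Space d → ℝ}
    {C : ℝ} (hφ : ∀ p, |φ p| ≤ C) (x : Space d × Space d) :
    |a x.1 x.2 * (2⁻¹ * φ (x.1 + x.2) - φ x.1)| ≤ 2 * K * C := by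
  rw [abs_mul, abs_of_nonneg (ha.nonneg _ _)]
  have hC : 0 ≤ C := (abs_nonneg _).trans (hφ 0)
  have h1 := abs_le.1 (hφ (x.1 + x.2))
  have h2 := abs_le.1 (hφ x.1)
  have h3 : |2⁻¹ * φ (x.1 + x.2) - φ x.1| ≤ 2 * C := by
    rw [abs_le]; constructor <;> linarith
  calc a x.1 x.2 * |2⁻¹ * φ (x.1 + x.2) - φ x.1| ≤ K * (2 * C) :=
        mul_le_mul (ha.le _ _) h3 (abs_nonneg _) ha.nonneg_bound
    _ = _ := by ring

/-- The bilinear form whose diagonal is the weak collision operator. -/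
def collBilin (a : Space d → Space d → ℝ) (φ : Space d → ℝ) (μ ν : Measure (Space d)) : ℝ :=
  ∫ x, a x.1 x.2 * (2⁻¹ * φ (x.1 + x.2) - φ x.1) ∂(μ.prod ν)

lemma IsTruncatedRate.measurable_collBilin (ha : IsTruncatedRate a K r) {φ : Space d → ℝ}
    (hφm : Measurable φ) :
    Measurable fun x : Space d × Space d => a x.1 x.2 * (2⁻¹ * φ (x.1 + x.2) - φ x.1) :=
  ha.meas.mul (by fun_prop)

lemma IsTruncatedRate.integrable_collBilin (ha : IsTruncatedRate a K r) {φ : Space d → ℝ}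
    (hφm : Measurable φ) {C : ℝ} (hφ : ∀ p, |φ p| ≤ C) [IsFiniteMeasure μ] [IsFiniteMeasure ν] :
    Integrable (fun x : Space d × Space d => a x.1 x.2 * (2⁻¹ * φ (x.1 + x.2) - φ x.1))
      (μ.prod ν) :=
  (integrable_const (2 * K * C)).mono' (ha.measurable_collBilin hφm).aestronglyMeasurable
    (ae_of_all _ (ha.abs_mul_le_of_bounded hφ))

/-- With `K * M ≤ l` the loss frequency never exceeds `l`. Hence the density `1 - l⁻¹ ∫ a` in
`wildStep` is nonnegative and `ENNReal.ofReal` does not alter it. -/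
lemma IsTruncatedRate.integral_le (ha : IsTruncatedRate a K r) (hν : IsEvenCompact M r ν)
    (hl : 0 < l) (hKM : K * M ≤ l) (p : Space d) :
    0 ≤ l⁻¹ * ∫ q, a p q ∂ν ∧ l⁻¹ * ∫ q, a p q ∂ν ≤ 1 := by
  have := hν.finite
  have h0 : 0 ≤ ∫ q, a p q ∂ν := integral_nonneg fun q => ha.nonneg p q
  have h1 : ∫ q, a p q ∂ν ≤ K * M := by
    have hi : Integrable (fun q => a p q) ν :=
      (integrable_const K).mono' (ha.meas.comp measurable_prodMk_left).aestronglyMeasurable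
        (ae_of_all _ fun q => by rw [Real.norm_of_nonneg (ha.nonneg p q)]; exact ha.le p q)
    refine (integral_mono hi (integrable_const K) (ha.le p)).trans ?_
    rw [integral_const, smul_eq_mul, mul_comm]
    exact mul_le_mul_of_nonneg_left hν.mass ha.nonneg_bound
  refine ⟨mul_nonneg (inv_nonneg.2 hl.le) h0, ?_⟩
  rw [inv_mul_le_iff₀ hl]; linarith

lemma IsTruncatedRate.isFiniteMeasure_wildStep (ha : IsTruncatedRate a K r)
    (hμ : IsEvenCompact M r μ) (hν : IsEvenCompact M r ν) (hl : 0 < l) (hKM : K * M ≤ l) :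
    IsFiniteMeasure (((μ.prod ν).withDensity fun x => ENNReal.ofReal (a x.1 x.2 / (2 * l))).map
      (fun x => x.1 + x.2)) ∧
    IsFiniteMeasure (μ.withDensity fun p => ENNReal.ofReal (1 - l⁻¹ * ∫ q, a p q ∂ν)) := by
  have := hμ.finite
  have := hν.finite
  have h1 : IsFiniteMeasure
      ((μ.prod ν).withDensity fun x => ENNReal.ofReal (a x.1 x.2 / (2 * l))) := by
    refine isFiniteMeasure_withDensity_ofReal (Integrable.hasFiniteIntegral ?_)
    refine (integrable_const (K / (2 * l))).mono' (ha.meas.div_const _).aestronglyMeasurable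
      (ae_of_all _ fun x => ?_)
    rw [Real.norm_of_nonneg (div_nonneg (ha.nonneg _ _) (by positivity))]
    exact div_le_div_of_nonneg_right (ha.le _ _) (by positivity)
  refine ⟨inferInstance, isFiniteMeasure_withDensity_ofReal (Integrable.hasFiniteIntegral ?_)⟩
  refine (integrable_const (1 : ℝ)).mono' ?_ (ae_of_all _ fun p => ?_)
  · exact (measurable_const.sub (ha.meas.stronglyMeasurable.integral_prod_right'.measurable.const_mul
      l⁻¹)).aestronglyMeasurable
  · have := ha.integral_le hν hl hKM p
    rw [Real.norm_of_nonneg (by linarith)]; linarith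

/-- The complement to `l` of the loss frequency is a fictitious event which leaves the particle
unchanged. A step is thus the identity on `μ` plus `l⁻¹` times the collision form, yet it is a
nonnegative measure. -/
lemma IsTruncatedRate.integral_wildStep (ha : IsTruncatedRate a K r)
    (hμ : IsEvenCompact M r μ) (hν : IsEvenCompact M r ν) (hl : 0 < l) (hKM : K * M ≤ l)
    {φ : Space d → ℝ} (hφm : Measurable φ) {C : ℝ} (hφ : ∀ p, |φ p| ≤ C) :
    ∫ p, φ p ∂(wildStep a l μ ν) = ∫ p, φ p ∂μ + l⁻¹ * collBilin a φ μ ν := by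
  have := hμ.finite
  have := hν.finite
  obtain ⟨f1, f2⟩ := ha.isFiniteMeasure_wildStep hμ hν hl hKM
  have hb : ∀ (ρ : Measure (Space d)) [IsFiniteMeasure ρ], Integrable φ ρ := fun ρ _ =>
    (integrable_const C).mono' hφm.aestronglyMeasurable (ae_of_all _ hφ)
  have hC : 0 ≤ C := (abs_nonneg _).trans (hφ 0)
  have hLm : Measurable fun p => ∫ q, a p q ∂ν :=
    ha.meas.stronglyMeasurable.integral_prod_right'.measurable
  have g1 : Integrable (fun x : Space d × Space d => a x.1 x.2 * φ (x.1 + x.2)) (μ.prod ν) := by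
    refine (integrable_const (K * C)).mono' (ha.meas.mul (by fun_prop)).aestronglyMeasurable
      (ae_of_all _ fun x => ?_)
    rw [norm_mul, Real.norm_of_nonneg (ha.nonneg _ _)]
    exact mul_le_mul (ha.le _ _) (hφ _) (norm_nonneg _) ha.nonneg_bound
  have g2 : Integrable (fun x : Space d × Space d => a x.1 x.2 * φ x.1) (μ.prod ν) := by
    refine (integrable_const (K * C)).mono' (ha.meas.mul (by fun_prop)).aestronglyMeasurable
      (ae_of_all _ fun x => ?_)
    rw [norm_mul, Real.norm_of_nonneg (ha.nonneg _ _)]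
    exact mul_le_mul (ha.le _ _) (hφ _) (norm_nonneg _) ha.nonneg_bound
  have e1 : ∫ p, φ p ∂(((μ.prod ν).withDensity fun x => ENNReal.ofReal (a x.1 x.2 / (2 * l))).map
      (fun x => x.1 + x.2)) = (2 * l)⁻¹ * ∫ x, a x.1 x.2 * φ (x.1 + x.2) ∂(μ.prod ν) := by
    rw [integral_map (by fun_prop) hφm.aestronglyMeasurable,
      integral_withDensity_eq_integral_toReal_smul
        (ha.meas.div_const _).ennreal_ofReal (ae_of_all _ fun _ => ENNReal.ofReal_lt_top),
      ← integral_const_mul]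
    congr 1 with x
    rw [ENNReal.toReal_ofReal (div_nonneg (ha.nonneg _ _) (by positivity)), smul_eq_mul]
    ring
  have e2 : ∫ p, φ p ∂(μ.withDensity fun p => ENNReal.ofReal (1 - l⁻¹ * ∫ q, a p q ∂ν)) =
      ∫ p, φ p ∂μ - l⁻¹ * ∫ x, a x.1 x.2 * φ x.1 ∂(μ.prod ν) := by
    have hm : Measurable fun p => ENNReal.ofReal (1 - l⁻¹ * ∫ q, a p q ∂ν) :=
      (measurable_const.sub (hLm.const_mul _)).ennreal_ofReal
    rw [integral_withDensity_eq_integral_toReal_smul hm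
      (ae_of_all _ fun _ => ENNReal.ofReal_lt_top), integral_prod _ g2, ← integral_const_mul,
      ← integral_sub (hb μ) (g2.integral_prod_left.const_mul _)]
    congr 1 with p
    dsimp only
    rw [ENNReal.toReal_ofReal (by linarith [ha.integral_le hν hl hKM p]), smul_eq_mul,
      integral_mul_const]
    ring
  rw [wildStep, integral_add_measure (hb _) (hb _), e1, e2, collBilin]
  have e3 : ∫ x, a x.1 x.2 * (2⁻¹ * φ (x.1 + x.2) - φ x.1) ∂(μ.prod ν) =
      2⁻¹ * ∫ x, a x.1 x.2 * φ (x.1 + x.2) ∂(μ.prod ν) - ∫ x, a x.1 x.2 * φ x.1 ∂(μ.prod ν) := by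
    rw [← integral_const_mul, ← integral_sub (g1.const_mul _) g2]
    congr 1 with x
    ring
  rw [e3, mul_inv]
  ring

/-- All properties are read off from `integral_wildStep`. Mass decreases because `1/2 - 1 < 0`;
evenness follows from the invariance of `a` under a common sign change; the support stays in the
ball because `a` vanishes when `p + q` leaves it. -/
lemma IsTruncatedRate.isEvenCompact_wildStep (ha : IsTruncatedRate a K r)
    (hμ : IsEvenCompact M r μ) (hν : IsEvenCompact M r ν) (hl : 0 < l) (hKM : K * M ≤ l) :
    IsEvenCompact M r (wildStep a l μ ν) := by
  have := hμ.finite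
  have := hν.finite
  obtain ⟨f1, f2⟩ := ha.isFiniteMeasure_wildStep hμ hν hl hKM
  have hfin : IsFiniteMeasure (wildStep a l μ ν) := by unfold wildStep; infer_instance
  have key := fun (φ : Space d → ℝ) (hφm : Measurable φ) (hφ : ∀ p, |φ p| ≤ 1) =>
    ha.integral_wildStep hμ hν hl hKM hφm hφ
  refine ⟨hfin, ?_, ?_, ?_⟩
  · have h1 := key (fun _ => 1) measurable_const fun _ => by simp
    have h2 : collBilin a (fun _ => 1) μ ν ≤ 0 :=
      integral_nonpos fun x => mul_nonpos_of_nonneg_of_nonpos (ha.nonneg _ _) (by norm_num)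
    have h3 := mul_nonpos_of_nonneg_of_nonpos (inv_nonneg.2 hl.le) h2
    simp only [integral_const, smul_eq_mul, mul_one] at h1
    linarith [hμ.mass]
  · refine isEven_of_integral fun φ hφm hφ => ?_
    have hmp : MeasurePreserving ((MeasurableEquiv.neg (Space d)).prodCongr
        (MeasurableEquiv.neg (Space d))) (μ.prod ν) (μ.prod ν) := by
      have h1 : MeasurePreserving (fun q : Space d => -q) μ μ := ⟨measurable_neg, hμ.even⟩
      have h2 : MeasurePreserving (fun q : Space d => -q) ν ν := ⟨measurable_neg, hν.even⟩
      exact h1.prod h2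
    rw [key φ hφm hφ, key (fun p => φ (-p)) (hφm.comp measurable_neg) fun p => hφ _,
      hμ.even.integral_comp_neg]
    congr 2
    unfold collBilin
    conv_rhs => rw [← hmp.integral_comp']
    congr 1 with x
    change _ = a (-x.1) (-x.2) * (2⁻¹ * φ (-x.1 + -x.2) - φ (-x.1))
    dsimp only
    rw [ha.neg, neg_add]
  · have hKm : MeasurableSet (Metric.closedBall (0 : Space d) r)ᶜ :=
      Metric.isClosed_closedBall.measurableSet.compl
    have h1 := key _ (measurable_one.indicator hKm) fun p => by
      by_cases hp : p ∈ (Metric.closedBall (0 : Space d) r)ᶜ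
      · rw [indicator_of_mem hp]; simp
      · rw [indicator_of_notMem hp]; simp
    have h2 : collBilin a ((Metric.closedBall (0 : Space d) r)ᶜ.indicator 1) μ ν ≤ 0 := by
      refine integral_nonpos fun x => ?_
      have h0 : (0 : ℝ) ≤ (Metric.closedBall (0 : Space d) r)ᶜ.indicator 1 x.1 :=
        indicator_nonneg (fun _ _ => zero_le_one) _
      by_cases hx : x.1 + x.2 ∈ (Metric.closedBall (0 : Space d) r)ᶜ
      · have : r < ‖x.1 + x.2‖ := by simpa using hx
        simp [ha.vanish _ _ this]
      · rw [indicator_of_notMem hx]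
        exact mul_nonpos_of_nonneg_of_nonpos (ha.nonneg _ _) (by linarith)
    rw [integral_indicator_one hKm, integral_indicator_one hKm,
      (measureReal_eq_zero_iff).2 hμ.support, zero_add] at h1
    have h3 := mul_nonpos_of_nonneg_of_nonpos (inv_nonneg.2 hl.le) h2
    rw [← measureReal_eq_zero_iff]
    exact le_antisymm (by linarith) measureReal_nonneg

lemma IsTruncatedRate.isEvenCompact_wild (ha : IsTruncatedRate a K r)
    (hμ : IsEvenCompact M r μ) (hl : 0 < l) (hKM : K * M ≤ l) (k : ℕ) :
    IsEvenCompact M r (wild a l μ k) := by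
  induction k using Nat.strong_induction_on with
  | _ k ih =>
    cases k with
    | zero => rw [wild]; exact hμ
    | succ k =>
      have hstep : ∀ j : Fin (k + 1), IsEvenCompact M r
          (wildStep a l (wild a l μ j) (wild a l μ (k - j))) := fun j =>
        ha.isEvenCompact_wildStep (ih _ (by omega)) (ih _ (by omega)) hl hKM
      have := fun j => (hstep j).finite
      have hk : (0 : ℝ) < (k : ℝ) + 1 := by positivity
      rw [wild]
      refine ⟨Measure.smul_finite _ ENNReal.ofReal_ne_top, ?_, ?_, ?_⟩
      · rw [measureReal_ennreal_smul_apply, ENNReal.toReal_ofReal (by positivity),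
          Measure.real, Measure.finsetSum_apply, ENNReal.toReal_sum fun _ _ => measure_ne_top _ _,
          inv_mul_le_iff₀ hk]
        refine (Finset.sum_le_sum fun j _ => (hstep j).mass).trans ?_
        simp
      · ext S hS
        rw [Measure.map_apply measurable_neg hS]
        simp only [Measure.smul_apply, Measure.finsetSum_apply]
        congr 1
        refine Finset.sum_congr rfl fun j _ => ?_
        conv_rhs => rw [← (hstep j).even, Measure.map_apply measurable_neg hS]
      · simp [Measure.finsetSum_apply, (hstep _).support]

/-- This is the recursion of coefficients for `g' = (1 - z)⁻¹ g + l⁻¹ C(g, g)`, where `g` is the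
generating measure and `C` the bilinear collision form. -/
lemma IsTruncatedRate.succ_mul_integral_wild (ha : IsTruncatedRate a K r)
    (hμ : IsEvenCompact M r μ) (hl : 0 < l) (hKM : K * M ≤ l) {φ : Space d → ℝ}
    (hφm : Measurable φ) {C : ℝ} (hφ : ∀ p, |φ p| ≤ C) (k : ℕ) :
    ((k : ℝ) + 1) * ∫ p, φ p ∂(wild a l μ (k + 1)) =
      ∑ x ∈ Finset.HasAntidiagonal.antidiagonal k, (∫ p, φ p ∂(wild a l μ x.1) +
        l⁻¹ * collBilin a φ (wild a l μ x.1) (wild a l μ x.2)) := by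
  have hw := ha.isEvenCompact_wild hμ hl hKM
  have := fun i j => (ha.isEvenCompact_wildStep (hw i) (hw j) hl hKM).finite
  rw [wild, integral_smul_measure, ENNReal.toReal_ofReal (by positivity), smul_eq_mul,
    mul_inv_cancel_left₀ (by positivity), integral_finsetSum_measure
      (fun j _ => (integrable_const C).mono' hφm.aestronglyMeasurable (ae_of_all _ hφ)),
    Finset.Nat.sum_antidiagonal_eq_sum_range_succ_mk, Finset.sum_range]
  exact Finset.sum_congr rfl fun j _ => ha.integral_wildStep (hw _) (hw _) hl hKM hφm hφ

end Wild

/-- Termwise differentiation of a power series with bounded coefficients. -/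
lemma hasDerivAt_tsum_mul_pow {c : ℕ → ℝ} {A : ℝ} (hc : ∀ k, |c k| ≤ A) {z : ℝ} (hz : |z| < 1) :
    HasDerivAt (fun y => ∑' k, c k * y ^ k) (∑' k : ℕ, ((k : ℝ) + 1) * c (k + 1) * z ^ k) z := by
  obtain ⟨ρ, hzρ, hρ⟩ := exists_between hz
  have hρ0 : 0 ≤ ρ := (abs_nonneg z).trans hzρ.le
  have hA : 0 ≤ A := (abs_nonneg _).trans (hc 0)
  have hsum1 : Summable fun k : ℕ => A * (((k : ℝ) + 1) * ρ ^ k) := by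
    refine Summable.mul_left _ ?_
    have h1 := summable_pow_mul_geometric_of_norm_lt_one (R := ℝ) 1
      (r := ρ) (by rwa [Real.norm_of_nonneg hρ0])
    have h2 := summable_geometric_of_lt_one hρ0 hρ
    refine (h1.add h2).congr fun k => ?_
    ring
  have hu : Summable fun k : ℕ => A * ((k : ℝ) * ρ ^ (k - 1)) := by
    rw [← summable_nat_add_iff 1]
    refine hsum1.congr fun k => ?_
    simp
  have hbound : ∀ k (y : ℝ), y ∈ Metric.ball (0 : ℝ) ρ →
      ‖c k * ((k : ℝ) * y ^ (k - 1))‖ ≤ A * ((k : ℝ) * ρ ^ (k - 1)) := by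
    intro k y hy
    have hy' : |y| ≤ ρ := by simpa using (mem_ball_zero_iff.1 hy).le
    rw [norm_mul, norm_mul, norm_pow, Real.norm_eq_abs, Real.norm_eq_abs, Real.norm_eq_abs,
      Nat.abs_cast]
    gcongr
    exact hc k
  have hzmem : z ∈ Metric.ball (0 : ℝ) ρ := by simpa using hzρ
  have key := hasDerivAt_tsum_of_isPreconnected hu Metric.isOpen_ball
    (convex_ball (0 : ℝ) ρ).isPreconnected
    (g := fun k y => c k * y ^ k) (g' := fun k y => c k * ((k : ℝ) * y ^ (k - 1)))
    (fun k y _ => (hasDerivAt_pow k y).const_mul (c k)) hbound hzmem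
    (by
      refine Summable.of_norm_bounded ((summable_geometric_of_lt_one hρ0 hρ).mul_left A)
        fun k => ?_
      rw [norm_mul, norm_pow, Real.norm_eq_abs, Real.norm_eq_abs]
      exact mul_le_mul (hc k) (pow_le_pow_left₀ (abs_nonneg z) hzρ.le k) (by positivity) hA)
    hzmem
  have hs : Summable fun k : ℕ => c k * ((k : ℝ) * z ^ (k - 1)) :=
    Summable.of_norm_bounded hu fun k => hbound k z hzmem
  have he : ∑' k : ℕ, ((k : ℝ) + 1) * c (k + 1) * z ^ k =
      ∑' k : ℕ, c k * ((k : ℝ) * z ^ (k - 1)) := by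
    rw [hs.tsum_eq_zero_add]
    simp only [CharP.cast_eq_zero, zero_mul, mul_zero, zero_add, add_tsub_cancel_right]
    refine tsum_congr fun k => ?_
    push_cast
    ring
  rw [he]
  exact key

section WildSum

variable {a : Space d → Space d → ℝ} {K r M l : ℝ} {μ : Measure (Space d)}

/-- The generating measure of the Wild coefficients. -/
def wildGen (a : Space d → Space d → ℝ) (l : ℝ) (μ : Measure (Space d)) (z : ℝ) :
    Measure (Space d) :=
  Measure.sum fun k => ENNReal.ofReal (z ^ k) • wild a l μ k

variable {z : ℝ}

lemma IsTruncatedRate.wildGen_univ_le (ha : IsTruncatedRate a K r) (hμ : IsEvenCompact M r μ)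
    (hl : 0 < l) (hKM : K * M ≤ l) (hz0 : 0 ≤ z) (hz1 : z < 1) :
    wildGen a l μ z univ ≤ ENNReal.ofReal (M * (1 - z)⁻¹) := by
  have hw := ha.isEvenCompact_wild hμ hl hKM
  have hM : 0 ≤ M := measureReal_nonneg.trans hμ.mass
  rw [wildGen, Measure.sum_apply _ .univ, ← tsum_geometric_of_lt_one hz0 hz1,
    ← tsum_mul_left, ENNReal.ofReal_tsum_of_nonneg (fun k => by positivity)
      ((summable_geometric_of_lt_one hz0 hz1).mul_left M)]
  refine ENNReal.tsum_le_tsum fun k => ?_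
  have := (hw k).finite
  rw [Measure.smul_apply, smul_eq_mul, mul_comm M, ENNReal.ofReal_mul (by positivity)]
  gcongr
  rw [← ofReal_measureReal]
  exact ENNReal.ofReal_le_ofReal (hw k).mass

lemma IsTruncatedRate.isFiniteMeasure_wildGen (ha : IsTruncatedRate a K r)
    (hμ : IsEvenCompact M r μ) (hl : 0 < l) (hKM : K * M ≤ l) (hz0 : 0 ≤ z) (hz1 : z < 1) :
    IsFiniteMeasure (wildGen a l μ z) :=
  ⟨(ha.wildGen_univ_le hμ hl hKM hz0 hz1).trans_lt ENNReal.ofReal_lt_top⟩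

lemma IsTruncatedRate.hasSum_integral_wildGen (ha : IsTruncatedRate a K r)
    (hμ : IsEvenCompact M r μ) (hl : 0 < l) (hKM : K * M ≤ l) (hz0 : 0 ≤ z) (hz1 : z < 1)
    {φ : Space d → ℝ} (hφm : Measurable φ) {C : ℝ} (hφ : ∀ p, |φ p| ≤ C) :
    HasSum (fun k => (∫ p, φ p ∂(wild a l μ k)) * z ^ k) (∫ p, φ p ∂(wildGen a l μ z)) := by
  have := ha.isFiniteMeasure_wildGen hμ hl hKM hz0 hz1
  have hi : Integrable φ (wildGen a l μ z) :=
    (integrable_const C).mono' hφm.aestronglyMeasurable (ae_of_all _ hφ)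
  refine (hasSum_integral_measure hi).congr_fun fun k => ?_
  rw [integral_smul_measure, ENNReal.toReal_ofReal (by positivity), smul_eq_mul, mul_comm]

lemma IsTruncatedRate.hasSum_collBilin_wildGen (ha : IsTruncatedRate a K r)
    (hμ : IsEvenCompact M r μ) (hl : 0 < l) (hKM : K * M ≤ l) (hz0 : 0 ≤ z) (hz1 : z < 1)
    {φ : Space d → ℝ} (hφm : Measurable φ) {C : ℝ} (hφ : ∀ p, |φ p| ≤ C) :
    HasSum (fun x : ℕ × ℕ => collBilin a φ (wild a l μ x.1) (wild a l μ x.2) * z ^ (x.1 + x.2))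
      (collBilin a φ (wildGen a l μ z) (wildGen a l μ z)) := by
  have := ha.isFiniteMeasure_wildGen hμ hl hKM hz0 hz1
  have := fun k => (ha.isEvenCompact_wild hμ hl hKM k).finite
  have hi := ha.integrable_collBilin hφm hφ (μ := wildGen a l μ z) (ν := wildGen a l μ z)
  have hfin : ∀ k, IsFiniteMeasure (ENNReal.ofReal (z ^ k) • wild a l μ k) := fun k =>
    Measure.smul_finite _ ENNReal.ofReal_ne_top
  have hp : (wildGen a l μ z).prod (wildGen a l μ z) = Measure.sum fun x : ℕ × ℕ =>
      (ENNReal.ofReal (z ^ x.1) • wild a l μ x.1).prod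
        (ENNReal.ofReal (z ^ x.2) • wild a l μ x.2) := Measure.prod_sum _ _
  unfold collBilin
  rw [hp] at hi ⊢
  refine (hasSum_integral_measure hi).congr_fun fun x => ?_
  rw [Measure.prod_smul_left, Measure.prod_smul_right, integral_smul_measure,
    integral_smul_measure, ENNReal.toReal_ofReal (by positivity),
    ENNReal.toReal_ofReal (by positivity), smul_eq_mul, smul_eq_mul, pow_add]
  ring

/-- The differential equation satisfied by the generating measure, in weak form. -/
lemma IsTruncatedRate.tsum_succ_mul_wild (ha : IsTruncatedRate a K r)
    (hμ : IsEvenCompact M r μ) (hl : 0 < l) (hKM : K * M ≤ l) (hz0 : 0 ≤ z) (hz1 : z < 1)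
    {φ : Space d → ℝ} (hφm : Measurable φ) {C : ℝ} (hφ : ∀ p, |φ p| ≤ C) :
    ∑' k : ℕ, ((k : ℝ) + 1) * (∫ p, φ p ∂(wild a l μ (k + 1))) * z ^ k =
      (∫ p, φ p ∂(wildGen a l μ z)) * (1 - z)⁻¹ +
        l⁻¹ * collBilin a φ (wildGen a l μ z) (wildGen a l μ z) := by
  have h1 := ha.hasSum_integral_wildGen hμ hl hKM hz0 hz1 hφm hφ
  have h2 := ha.hasSum_collBilin_wildGen hμ hl hKM hz0 hz1 hφm hφ
  -- The identity part of a step does not involve its second argument, so the sum over the second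
  -- index is a bare geometric series.
  have h3 := hasSum_geometric_of_lt_one hz0 hz1
  have hs : Summable fun x : ℕ × ℕ => ((∫ p, φ p ∂(wild a l μ x.1)) * z ^ x.1) * z ^ x.2 :=
    summable_mul_of_summable_norm h1.summable.norm h3.summable.norm
  have h4 := (h1.mul h3 hs).add (h2.mul_left l⁻¹)
  have h5 := ((Finset.HasAntidiagonal.sigmaAntidiagonalEquivProd (A := ℕ)).hasSum_iff.2 h4).sigma
    fun k => hasSum_fintype _
  refine HasSum.tsum_eq (h5.congr_fun fun k => ?_)
  rw [ha.succ_mul_integral_wild hμ hl hKM hφm hφ, Finset.sum_mul]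
  have e := Finset.sum_coe_sort (Finset.HasAntidiagonal.antidiagonal k) fun x : ℕ × ℕ =>
    (∫ p, φ p ∂(wild a l μ x.1)) * z ^ x.1 * z ^ x.2 +
      l⁻¹ * (collBilin a φ (wild a l μ x.1) (wild a l μ x.2) * z ^ (x.1 + x.2))
  refine Eq.trans (Finset.sum_congr rfl fun x hx => ?_) e.symm
  rw [← Finset.HasAntidiagonal.mem_antidiagonal.1 hx, pow_add]
  ring

/-- The parameter `1 - exp (-l t)` of the Wild sum, for `t ≥ 0`. -/
def wildTime (l t : ℝ) : ℝ := 1 - Real.exp (-(l * max t 0))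

lemma wildTime_nonneg (hl : 0 < l) (t : ℝ) : 0 ≤ wildTime l t := by
  have : 0 ≤ l * max t 0 := mul_nonneg hl.le (le_max_right _ _)
  have := Real.exp_le_one_iff.2 (neg_nonpos.2 this)
  unfold wildTime; linarith

lemma wildTime_lt_one (l t : ℝ) : wildTime l t < 1 := by
  have := Real.exp_pos (-(l * max t 0))
  unfold wildTime; linarith

@[fun_prop]
lemma measurable_wildTime (l : ℝ) : Measurable (wildTime l) := by
  unfold wildTime; fun_prop

/-- The Wild sum as a kernel in the time variable. -/
def wildFlow (a : Space d → Space d → ℝ) (l : ℝ) (μ : Measure (Space d)) :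
    Kernel ℝ (Space d) where
  toFun t := ENNReal.ofReal (1 - wildTime l t) • wildGen a l μ (wildTime l t)
  measurable' := by
    refine Measure.measurable_of_measurable_coe _ fun S hS => ?_
    simp only [wildGen, Measure.smul_apply, Measure.sum_apply _ hS, smul_eq_mul]
    fun_prop

lemma wildFlow_apply (a : Space d → Space d → ℝ) (l : ℝ) (μ : Measure (Space d)) (t : ℝ) :
    wildFlow a l μ t = ENNReal.ofReal (1 - wildTime l t) • wildGen a l μ (wildTime l t) := rfl

lemma IsTruncatedRate.isEvenCompact_wildFlow (ha : IsTruncatedRate a K r)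
    (hμ : IsEvenCompact M r μ) (hl : 0 < l) (hKM : K * M ≤ l) (t : ℝ) :
    IsEvenCompact M r (wildFlow a l μ t) := by
  have hz0 := wildTime_nonneg hl t
  have hz1 := wildTime_lt_one l t
  have hw := ha.isEvenCompact_wild hμ hl hKM
  have hM : 0 ≤ M := measureReal_nonneg.trans hμ.mass
  have := ha.isFiniteMeasure_wildGen hμ hl hKM hz0 hz1
  rw [wildFlow_apply]
  refine ⟨Measure.smul_finite _ ENNReal.ofReal_ne_top, ?_, ?_, ?_⟩
  · rw [measureReal_ennreal_smul_apply, ENNReal.toReal_ofReal (by linarith)]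
    have h1 : (wildGen a l μ (wildTime l t)).real univ ≤ M * (1 - wildTime l t)⁻¹ :=
      ENNReal.toReal_le_of_le_ofReal (mul_nonneg hM (inv_nonneg.2 (by linarith)))
        (ha.wildGen_univ_le hμ hl hKM hz0 hz1)
    refine (mul_le_mul_of_nonneg_left h1 (by linarith)).trans (le_of_eq ?_)
    have : 1 - wildTime l t ≠ 0 := by linarith
    field_simp
  · ext S hS
    rw [Measure.map_apply measurable_neg hS, wildGen]
    simp only [Measure.smul_apply, Measure.sum_apply _ hS,
      Measure.sum_apply _ (measurable_neg hS)]
    congr 2 with k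
    conv_rhs => rw [← (hw k).even, Measure.map_apply measurable_neg hS]
  · rw [wildGen, Measure.smul_apply,
      Measure.sum_apply _ Metric.isClosed_closedBall.measurableSet.compl]
    simp [(hw _).support]

lemma IsTruncatedRate.wildFlow_zero : wildFlow a l μ 0 = μ := by
  have hz : wildTime l 0 = 0 := by simp [wildTime]
  ext S hS
  rw [wildFlow_apply, hz, wildGen, Measure.smul_apply, Measure.sum_apply _ hS,
    tsum_eq_single 0]
  · simp [wild]
  · intro k hk
    simp [hk]

/-- The integrand `a · defect φ` is the sum of the integrand of `collBilin` and of its image under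
the swap, since `a` is symmetric. -/
lemma IsTruncatedRate.coll_eq_collBilin (ha : IsTruncatedRate a K r) {φ : Space d → ℝ}
    (hφm : Measurable φ) {C : ℝ} (hφ : ∀ p, |φ p| ≤ C) (ν : Measure (Space d))
    [IsFiniteMeasure ν] : coll a φ ν = collBilin a φ ν ν := by
  have h1 := ha.integrable_collBilin hφm hφ (μ := ν) (ν := ν)
  have h2 : Integrable (fun x : Space d × Space d =>
      a x.1 x.2 * (2⁻¹ * φ (x.1 + x.2) - φ x.2)) (ν.prod ν) := by
    refine (integrable_swap_iff.2 h1).congr (ae_of_all _ fun x => ?_)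
    simp only [Function.comp, Prod.fst_swap, Prod.snd_swap]
    rw [ha.symm, add_comm]
  have h3 : collBilin a φ ν ν =
      ∫ x, a x.1 x.2 * (2⁻¹ * φ (x.1 + x.2) - φ x.2) ∂(ν.prod ν) := by
    unfold collBilin
    rw [← integral_prod_swap]
    congr 1 with x
    simp only [Prod.fst_swap, Prod.snd_swap]
    rw [ha.symm, add_comm]
  have h4 : ∫ x, a x.1 x.2 * defect φ x ∂(ν.prod ν) = collBilin a φ ν ν + collBilin a φ ν ν := by
    conv_rhs => rw [h3]
    conv_rhs => enter [1]; rw [← h3, collBilin]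
    rw [← integral_add h1 h2]
    congr 1 with x
    unfold defect
    ring
  rw [coll, h4]
  ring

/-- The Wild sum solves the equation with a truncated rate. -/
theorem IsTruncatedRate.isStrongSolution_wildFlow (ha : IsTruncatedRate a K r)
    (hμ : IsEvenCompact M r μ) (hl : 0 < l) (hKM : K * M ≤ l) (T : ℝ) :
    IsStrongSolution a T ((1 + r ^ 2) ^ 2 * M) (wildFlow a l μ) := by
  have hc := ha.isEvenCompact_wildFlow hμ hl hKM
  have hmom : ∀ t, MomentBound ((1 + r ^ 2) ^ 2 * M) (wildFlow a l μ t) := by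
    intro t
    have := (hc t).finite
    have hae : ∀ᵐ p ∂(wildFlow a l μ t), wt p ^ 2 ≤ (1 + r ^ 2) ^ 2 := by
      have : ∀ᵐ p ∂(wildFlow a l μ t), p ∈ Metric.closedBall (0 : Space d) r := by
        rw [ae_iff]; exact (hc t).support
      filter_upwards [this] with p hp
      have : ‖p‖ ≤ r := by simpa using hp
      unfold wt
      gcongr
    have hi : Integrable (fun p => wt p ^ 2) (wildFlow a l μ t) :=
      (integrable_const ((1 + r ^ 2) ^ 2)).mono' (measurable_wt.pow_const 2).aestronglyMeasurable
        (by filter_upwards [hae] with p hp; rwa [Real.norm_of_nonneg (by positivity)])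
    refine ⟨hi, (integral_mono_ae hi (integrable_const _) hae).trans ?_⟩
    rw [integral_const, smul_eq_mul, mul_comm]
    exact mul_le_mul_of_nonneg_left (hc t).mass (by positivity)
  refine IsStrongSolution.of_bounded ha.toIsRate (fun t => (hc t).even) hmom ?_
  rintro φ hφm ⟨C, hφ⟩ t ht
  have hC : 0 ≤ C := (abs_nonneg _).trans (hφ 0)
  have hM : 0 ≤ M := measureReal_nonneg.trans hμ.mass
  have hw := ha.isEvenCompact_wild hμ hl hKM
  set c : ℕ → ℝ := fun k => ∫ p, φ p ∂(wild a l μ k) with hcdef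
  have hcb : ∀ k, |c k| ≤ C * M := fun k => by
    have := (hw k).finite
    refine (norm_integral_le_of_norm_le_const (f := φ) (ae_of_all _ hφ)).trans ?_
    exact mul_le_mul_of_nonneg_left (hw k).mass hC
  set G : ℝ → ℝ := fun s => Real.exp (-(l * s)) * ∑' k, c k * (1 - Real.exp (-(l * s))) ^ k with hG
  have hGint : ∀ s, 0 ≤ s → ∫ p, φ p ∂(wildFlow a l μ s) = G s := fun s hs => by
    have hz0 := wildTime_nonneg hl s
    have hz1 := wildTime_lt_one l s
    have e : wildTime l s = 1 - Real.exp (-(l * s)) := by rw [wildTime, max_eq_left hs]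
    rw [wildFlow_apply, integral_smul_measure, ENNReal.toReal_ofReal (by linarith), smul_eq_mul,
      ← (ha.hasSum_integral_wildGen hμ hl hKM hz0 hz1 hφm hφ).tsum_eq, e]
    simp only [hG, hcdef, sub_sub_cancel]
  have hder : ∀ s, 0 ≤ s → HasDerivAt G (coll a φ (wildFlow a l μ s)) s := fun s hs => by
    have := (hc s).finite
    have hz0 := wildTime_nonneg hl s
    have hz1 := wildTime_lt_one l s
    have e : wildTime l s = 1 - Real.exp (-(l * s)) := by rw [wildTime, max_eq_left hs]
    have hgf := ha.isFiniteMeasure_wildGen hμ hl hKM hz0 hz1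
    set E := Real.exp (-(l * s)) with hE
    have hE0 : 0 < E := Real.exp_pos _
    have hexp : HasDerivAt (fun s => Real.exp (-(l * s))) (-(l * E)) s := by
      have h1 : HasDerivAt (fun s : ℝ => -(l * s)) (-(l * 1)) s :=
        ((hasDerivAt_id s).const_mul l).neg
      have h2 := h1.exp
      convert h2 using 1
      rw [hE]; ring
    have hz : HasDerivAt (fun s => 1 - Real.exp (-(l * s))) (l * E) s := by
      have := hexp.const_sub 1
      rwa [neg_neg] at this
    have hzabs : |1 - E| < 1 := by rw [← e, abs_of_nonneg hz0]; exact hz1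
    have hP := (hasDerivAt_tsum_mul_pow hcb hzabs).comp s hz
    have hGd := hexp.mul hP
    rw [e] at hz0 hz1 hgf
    have hcoll : coll a φ (wildFlow a l μ s) =
        E ^ 2 * collBilin a φ (wildGen a l μ (1 - E)) (wildGen a l μ (1 - E)) := by
      rw [ha.coll_eq_collBilin hφm hφ, collBilin, collBilin, wildFlow_apply, e,
        Measure.prod_smul_left, Measure.prod_smul_right, integral_smul_measure,
        integral_smul_measure, sub_sub_cancel, ENNReal.toReal_ofReal hE0.le, smul_eq_mul,
        smul_eq_mul]
      ring
    have hsum := (ha.hasSum_integral_wildGen hμ hl hKM hz0 hz1 hφm hφ).tsum_eq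
    have hsum2 := ha.tsum_succ_mul_wild hμ hl hKM hz0 hz1 hφm hφ
    -- With `z = 1 - E` and `dz/ds = l E`, the term `(1 - z)⁻¹ g` contributes `l E g`, which cancels
    -- the derivative of the prefactor `E`. There remains `E² C(g, g)`, the collision form of `E g`.
    refine hGd.congr_deriv ?_
    simp only [Function.comp]
    rw [hcoll, ← hE]
    simp only [hcdef]
    rw [hsum, hsum2, sub_sub_cancel]
    field_simp
    ring
  rw [hGint t ht.1, hGint 0 le_rfl]
  have hint := intervalIntegral.integral_eq_sub_of_hasDerivAt (f := G)
    (f' := fun s => coll a φ (wildFlow a l μ s)) (a := 0) (b := t)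
    (fun s hs => hder s (by rw [uIcc_of_le ht.1] at hs; exact hs.1))
    (intervalIntegrable_coll ha.toIsRate hφm hC
      (fun p => (hφ p).trans (le_mul_of_one_le_right hC (one_le_wt p))) hmom 0 t)
  rw [hint]
  ring

end WildSum

/-! ### Completeness in total variation -/

/-- A sequence of finite measures that is Cauchy in total variation converges. -/
lemma exists_measure_of_cauchy {X : Type*} [MeasurableSpace X] (ν : ℕ → Measure X)
    [∀ n, IsFiniteMeasure (ν n)] {e : ℕ → ℝ} (he : Tendsto e atTop (𝓝 0))
    (h : ∀ n m, n ≤ m → ∀ ψ : X → ℝ, Measurable ψ → (∀ x, |ψ x| ≤ 1) →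
      |∫ x, ψ x ∂(ν m) - ∫ x, ψ x ∂(ν n)| ≤ e n) :
    ∃ ν' : Measure X, IsFiniteMeasure ν' ∧ ∀ n, ∀ ψ : X → ℝ, Measurable ψ → (∀ x, |ψ x| ≤ 1) →
      |∫ x, ψ x ∂(ν n) - ∫ x, ψ x ∂ν'| ≤ e n := by
  -- One finite measure dominating all `ν n` turns total variation into the `L¹` distance of
  -- densities, and completeness of `L¹` applies.
  obtain ⟨l, hl, hac, -⟩ := exists_isFiniteMeasure_absolutelyContinuous (Measure.sum ν)
  have hνl : ∀ n, ν n ≪ l := fun n =>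
    (Measure.absolutelyContinuous_of_le (Measure.le_sum ν n)).trans hac
  set ρ : ℕ → X → ℝ := fun n x => ((ν n).rnDeriv l x).toReal with hρ
  have hρm : ∀ n, Measurable (ρ n) := fun n => (Measure.measurable_rnDeriv _ _).ennreal_toReal
  have hρi : ∀ n, Integrable (ρ n) l := fun n => Measure.integrable_toReal_rnDeriv
  have hρ0 : ∀ n x, 0 ≤ ρ n x := fun n x => ENNReal.toReal_nonneg
  have hint : ∀ n (ψ : X → ℝ), ∫ x, ψ x ∂(ν n) = ∫ x, ρ n x * ψ x ∂l := fun n ψ =>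
    (integral_rnDeriv_smul (hνl n)).symm
  have hbd : ∀ {ψ : X → ℝ} {g : X → ℝ}, Measurable ψ → (∀ x, |ψ x| ≤ 1) → Integrable g l →
      Integrable (fun x => g x * ψ x) l := fun hψ hψ1 hg =>
    hg.mul_bdd (c := 1) hψ.aestronglyMeasurable (ae_of_all _ hψ1)
  have hdist : ∀ n m, n ≤ m → ∫ x, |ρ m x - ρ n x| ∂l ≤ e n := by
    intro n m hnm
    -- The sign of `ρ m - ρ n` is the extremal test function: it converts the hypothesis into a
    -- bound on the `L¹` norm.
    set ψ : X → ℝ := fun x => if ρ n x ≤ ρ m x then 1 else -1 with hψ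
    have hψm : Measurable ψ :=
      Measurable.ite (measurableSet_le (hρm n) (hρm m)) measurable_const measurable_const
    have hψ1 : ∀ x, |ψ x| ≤ 1 := fun x => by simp only [hψ]; split_ifs <;> simp
    have h1 := (le_abs_self _).trans (h n m hnm ψ hψm hψ1)
    rw [hint, hint, ← integral_sub (hbd hψm hψ1 (hρi m)) (hbd hψm hψ1 (hρi n))] at h1
    refine (le_of_eq (integral_congr_ae (ae_of_all _ fun x => ?_))).trans h1
    simp only [hψ]
    split_ifs with hx
    · rw [abs_of_nonneg (sub_nonneg.2 hx)]; ring
    · rw [abs_of_neg (sub_neg.2 (not_le.1 hx))]; ring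
  have hnorm : ∀ n m, dist ((hρi n).toL1 (ρ n)) ((hρi m).toL1 (ρ m)) =
      ∫ x, |ρ m x - ρ n x| ∂l := by
    intro n m
    rw [dist_comm, dist_eq_norm, ← Integrable.toL1_sub, L1.norm_of_fun_eq_integral_norm]
    rfl
  have hcau : CauchySeq fun n => (hρi n).toL1 (ρ n) := by
    refine cauchySeq_of_le_tendsto_0' e (fun n m hnm => ?_) he
    rw [hnorm]
    exact hdist n m hnm
  obtain ⟨g, hg⟩ := cauchySeq_tendsto_of_complete hcau
  have hgi : Integrable (fun x => |g x|) l := (L1.integrable_coeFn g).abs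
  have hgm : AEMeasurable (fun x => |g x|) l := hgi.aestronglyMeasurable.aemeasurable
  -- Taking `|g|` makes the density nonnegative at once; since `ρ m ≥ 0`, this does not increase the
  -- distance from `ρ m`.
  set ν' : Measure X := l.withDensity fun x => ENNReal.ofReal |g x| with hν'
  have hfin : IsFiniteMeasure ν' := isFiniteMeasure_withDensity_ofReal hgi.hasFiniteIntegral
  refine ⟨ν', hfin, fun n ψ hψm hψ1 => ?_⟩
  have hint' : ∫ x, ψ x ∂ν' = ∫ x, |g x| * ψ x ∂l := by
    rw [hν', integral_withDensity_eq_integral_toReal_smul₀ hgm.ennreal_ofReal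
      (ae_of_all _ fun _ => ENNReal.ofReal_lt_top)]
    congr 1 with x
    rw [ENNReal.toReal_ofReal (abs_nonneg _), smul_eq_mul]
  have hlim : Tendsto (fun m => ∫ x, ψ x ∂(ν m)) atTop (𝓝 (∫ x, ψ x ∂ν')) := by
    rw [tendsto_iff_dist_tendsto_zero]
    refine squeeze_zero (fun _ => dist_nonneg) (fun m => ?_) (tendsto_iff_dist_tendsto_zero.1 hg)
    rw [hint', hint, Real.dist_eq, ← integral_sub (hbd hψm hψ1 (hρi m)) (hbd hψm hψ1 hgi),
      dist_eq_norm, L1.norm_eq_integral_norm]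
    refine norm_integral_le_of_norm_le (f := fun x => ρ m x * ψ x - |g x| * ψ x)
      (L1.integrable_coeFn _).norm ?_
    filter_upwards [Lp.coeFn_sub ((hρi m).toL1 (ρ m)) g, (hρi m).coeFn_toL1] with x h1 h2
    rw [h1, Pi.sub_apply, h2, ← sub_mul, norm_mul, Real.norm_eq_abs, Real.norm_eq_abs,
      Real.norm_eq_abs]
    refine (mul_le_of_le_one_right (abs_nonneg _) (hψ1 x)).trans ?_
    have := abs_abs_sub_abs_le (ρ m x) (g x)
    rwa [abs_of_nonneg (hρ0 m x)] at this
  have h2 : Tendsto (fun m => |∫ x, ψ x ∂(ν n) - ∫ x, ψ x ∂(ν m)|) atTop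
      (𝓝 |∫ x, ψ x ∂(ν n) - ∫ x, ψ x ∂ν'|) := (hlim.const_sub _).abs
  refine le_of_tendsto h2 ?_
  filter_upwards [eventually_ge_atTop n] with m hm
  rw [abs_sub_comm]
  exact h n m hm ψ hψm hψ1

/-- A weighted version of `exists_measure_of_cauchy`. -/
lemma exists_measure_of_cauchy_wt (μ : ℕ → Measure (Space d)) (hμ : ∀ n, Integrable wt (μ n))
    {e : ℕ → ℝ} (he : Tendsto e atTop (𝓝 0))
    (h : ∀ n m, n ≤ m → ∀ ψ : Space d → ℝ, Measurable ψ → (∀ p, |ψ p| ≤ wt p) →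
      |∫ p, ψ p ∂(μ m) - ∫ p, ψ p ∂(μ n)| ≤ e n) :
    ∃ μ' : Measure (Space d), IsFiniteMeasure μ' ∧ ∀ n, ∀ ψ : Space d → ℝ, Measurable ψ →
      (∀ p, |ψ p| ≤ wt p) → |∫ p, ψ p ∂(μ n) - ∫ p, ψ p ∂μ'| ≤ e n := by
  have hfin : ∀ n, IsFiniteMeasure ((μ n).withDensity fun p => ENNReal.ofReal (wt p)) := fun n =>
    isFiniteMeasure_withDensity_ofReal (hμ n).hasFiniteIntegral
  have hint : ∀ n (ψ : Space d → ℝ),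
      ∫ p, ψ p ∂((μ n).withDensity fun p => ENNReal.ofReal (wt p)) = ∫ p, wt p * ψ p ∂(μ n) :=
    fun n ψ => by
      rw [integral_withDensity_eq_integral_toReal_smul measurable_wt.ennreal_ofReal
        (ae_of_all _ fun _ => ENNReal.ofReal_lt_top)]
      congr 1 with p
      rw [ENNReal.toReal_ofReal (wt_nonneg p), smul_eq_mul]
  obtain ⟨ν, hν, hlim⟩ := exists_measure_of_cauchy
    (fun n => (μ n).withDensity fun p => ENNReal.ofReal (wt p)) he (fun n m hnm ψ hψm hψ => by
      rw [hint, hint]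
      refine h n m hnm _ (measurable_wt.mul hψm) fun p => ?_
      rw [abs_mul, abs_of_nonneg (wt_nonneg p)]
      exact mul_le_of_le_one_right (wt_nonneg p) (hψ p))
  have hinv1 : ∀ p : Space d, (wt p)⁻¹ ≤ 1 := fun p => inv_le_one_of_one_le₀ (one_le_wt p)
  have hinv0 : ∀ p : Space d, 0 ≤ (wt p)⁻¹ := fun p => inv_nonneg.2 (wt_nonneg p)
  refine ⟨ν.withDensity fun p => ENNReal.ofReal (wt p)⁻¹, isFiniteMeasure_withDensity_ofReal
    (Integrable.hasFiniteIntegral ?_), fun n ψ hψm hψ => ?_⟩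
  · exact (integrable_const (1 : ℝ)).mono' measurable_wt.inv.aestronglyMeasurable
      (ae_of_all _ fun p => by rw [Real.norm_of_nonneg (hinv0 p)]; exact hinv1 p)
  · have key := hlim n (fun p => (wt p)⁻¹ * ψ p) (measurable_wt.inv.mul hψm) fun p => by
      rw [abs_mul, abs_of_nonneg (hinv0 p), inv_mul_le_iff₀ (wt_pos p), mul_one]
      exact hψ p
    have e1 : ∫ p, ψ p ∂(ν.withDensity fun p => ENNReal.ofReal (wt p)⁻¹) =
        ∫ p, (wt p)⁻¹ * ψ p ∂ν := by
      have hm : Measurable fun p : Space d => ENNReal.ofReal (wt p)⁻¹ :=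
        measurable_wt.inv.ennreal_ofReal
      rw [integral_withDensity_eq_integral_toReal_smul hm
        (ae_of_all _ fun _ => ENNReal.ofReal_lt_top)]
      congr 1 with p
      rw [ENNReal.toReal_ofReal (hinv0 p), smul_eq_mul]
    rw [hint] at key
    rw [e1]
    convert key using 5 with p
    rw [mul_inv_cancel_left₀ (wt_pos p).ne']

/-- Fatou's lemma. It transfers high moments to limits, where convergence is known only against
functions dominated by `wt` or bounded. -/
lemma integrable_of_integral_min_le {μ : Measure (Space d)} [IsFiniteMeasure μ]
    {φ : Space d → ℝ} (hφm : Measurable φ) (hφ : ∀ p, 0 ≤ φ p) {C : ℝ}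
    (h : ∀ n : ℕ, ∫ p, min (φ p) n ∂μ ≤ C) : Integrable φ μ ∧ ∫ p, φ p ∂μ ≤ C := by
  have hmin0 : ∀ n : ℕ, ∀ p, 0 ≤ min (φ p) n := fun n p => le_min (hφ p) (Nat.cast_nonneg n)
  have hi : ∀ n : ℕ, Integrable (fun p => min (φ p) n) μ := fun n =>
    (integrable_const (n : ℝ)).mono' (hφm.min measurable_const).aestronglyMeasurable
      (ae_of_all _ fun p => by rw [Real.norm_of_nonneg (hmin0 n p)]; exact min_le_right _ _)
  have hC : 0 ≤ C := (integral_nonneg (hmin0 0)).trans (h 0)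
  have hlim : ∀ p, Tendsto (fun n : ℕ => min (φ p) n) atTop (𝓝 (φ p)) := fun p => by
    obtain ⟨n, hn⟩ := exists_nat_ge (φ p)
    refine tendsto_const_nhds.congr' ?_
    filter_upwards [eventually_ge_atTop n] with m hm
    rw [min_eq_left (hn.trans (by exact_mod_cast hm))]
  have hl : ∫⁻ p, ENNReal.ofReal (φ p) ∂μ ≤ ENNReal.ofReal C := by
    calc ∫⁻ p, ENNReal.ofReal (φ p) ∂μ
        = ∫⁻ p, liminf (fun n : ℕ => ENNReal.ofReal (min (φ p) n)) atTop ∂μ := by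
          congr 1 with p
          exact (((ENNReal.continuous_ofReal.tendsto _).comp (hlim p)).liminf_eq).symm
      _ ≤ liminf (fun n : ℕ => ∫⁻ p, ENNReal.ofReal (min (φ p) n) ∂μ) atTop :=
          lintegral_liminf_le fun n => (hφm.min measurable_const).ennreal_ofReal
      _ ≤ liminf (fun _ : ℕ => ENNReal.ofReal C) atTop := by
          refine liminf_le_liminf (Eventually.of_forall fun n => ?_)
          rw [← ofReal_integral_eq_lintegral_ofReal (hi n) (ae_of_all _ (hmin0 n))]
          exact ENNReal.ofReal_le_ofReal (h n)
      _ = ENNReal.ofReal C := by simp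
  have hint : Integrable φ μ := ⟨hφm.aestronglyMeasurable, by
    rw [hasFiniteIntegral_iff_ofReal (ae_of_all _ hφ)]
    exact hl.trans_lt ENNReal.ofReal_lt_top⟩
  refine ⟨hint, ?_⟩
  rw [← ofReal_integral_eq_lintegral_ofReal hint (ae_of_all _ hφ)] at hl
  exact (ENNReal.ofReal_le_ofReal_iff hC).1 hl

/-! ### Truncated rates -/

/-- The rate `a` restricted to the ball of radius `ρ`. -/
def trunc (a : Space d → Space d → ℝ) (ρ : ℝ) (p q : Space d) : ℝ :=
  if ‖p‖ ≤ ρ ∧ ‖q‖ ≤ ρ then a p q else 0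

/-- The cutoff depends on `‖p‖` and `‖q‖` separately, so it is blind to `q ↦ -q` and preserves
`mono`; a cutoff in `‖p - q‖` would not. -/
lemma IsRate.isTruncatedRate_trunc {a : Space d → Space d → ℝ} (ha : IsRate a) (ρ : ℝ) :
    IsTruncatedRate (trunc a ρ) (2 * (1 + ρ ^ 2 + ρ ^ 2)) (2 * ρ) := by
  have hle : ∀ p q, trunc a ρ p q ≤ a p q := fun p q => by
    unfold trunc; split_ifs
    · exact le_rfl
    · exact ha.nonneg p q
  refine ⟨⟨?_, ?_, ?_, ?_, ?_, ?_⟩, ?_, ?_⟩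
  · unfold trunc
    refine Measurable.ite ?_ ha.meas measurable_const
    exact (measurableSet_le measurable_fst.norm measurable_const).inter
      (measurableSet_le measurable_snd.norm measurable_const)
  · intro p q
    unfold trunc; split_ifs
    · exact ha.nonneg p q
    · exact le_rfl
  · intro p q
    unfold trunc
    rw [ha.symm p q]
    exact if_congr and_comm rfl rfl
  · intro p q
    unfold trunc
    rw [ha.neg, norm_neg, norm_neg]
  · intro p q h
    unfold trunc
    rw [norm_neg]
    split_ifs
    · exact ha.mono p q h
    · exact le_rfl
  · exact fun p q => (hle p q).trans (ha.bound p q)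
  · intro p q
    unfold trunc; split_ifs with h
    · refine (ha.bound p q).trans ?_
      have := pow_le_pow_left₀ (norm_nonneg p) h.1 2
      have := pow_le_pow_left₀ (norm_nonneg q) h.2 2
      linarith
    · positivity
  · intro p q h
    unfold trunc
    rw [if_neg]
    rintro ⟨h1, h2⟩
    linarith [norm_add_le p q]

/-- Where the rates differ, one of the momenta exceeds `ρ`, so `ρ² ≤ wt p + wt q`. The gain `ρ⁻²` is
paid for by one additional weight. -/
lemma IsRate.abs_sub_trunc_le {a : Space d → Space d → ℝ} (ha : IsRate a) {ρ : ℝ} (hρ : 0 < ρ)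
    (p q : Space d) : |a p q - trunc a ρ p q| * (wt p * wt q) ≤
      2 / ρ ^ 2 * (wt p ^ 3 * wt q ^ 2 + wt p ^ 2 * wt q ^ 3) := by
  have hp := wt_pos p
  have hq := wt_pos q
  unfold trunc
  split_ifs with h
  · rw [sub_self, abs_zero, zero_mul]; positivity
  · rw [sub_zero, abs_of_nonneg (ha.nonneg _ _)]
    have hw : ρ ^ 2 ≤ wt p + wt q := by
      rw [not_and_or, not_le, not_le] at h
      rcases h with h | h
      · have := pow_le_pow_left₀ hρ.le h.le 2
        have : wt p = 1 + ‖p‖ ^ 2 := rfl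
        linarith
      · have := pow_le_pow_left₀ hρ.le h.le 2
        have : wt q = 1 + ‖q‖ ^ 2 := rfl
        linarith
    have h1 : a p q * (wt p * wt q) ≤ 2 * (wt p ^ 2 * wt q ^ 2) := by
      have := mul_le_mul_of_nonneg_right (ha.le_wt p q) (mul_pos hp hq).le
      linarith
    rw [div_mul_eq_mul_div, le_div_iff₀ (by positivity)]
    have h2 := mul_le_mul_of_nonneg_right h1 (sq_nonneg ρ)
    have h3 := mul_le_mul_of_nonneg_left hw (by positivity : 0 ≤ 2 * (wt p ^ 2 * wt q ^ 2))
    linarith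

lemma abs_trunc_sub_trunc_le (a : Space d → Space d → ℝ) {ρ ρ' : ℝ}
    (h : ρ ≤ ρ') (p q : Space d) :
    |trunc a ρ' p q - trunc a ρ p q| ≤ |a p q - trunc a ρ p q| := by
  unfold trunc
  by_cases h1 : ‖p‖ ≤ ρ ∧ ‖q‖ ≤ ρ
  · rw [if_pos h1, if_pos ⟨h1.1.trans h, h1.2.trans h⟩]
  · rw [if_neg h1, sub_zero, sub_zero]
    split_ifs
    · exact le_rfl
    · rw [abs_zero]; exact abs_nonneg _

/-! ### Restriction of time -/

/-- Projection on `[0, T]`. -/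
def clamp (T t : ℝ) : ℝ := max 0 (min t T)

@[fun_prop]
lemma measurable_clamp (T : ℝ) : Measurable (clamp T) := by unfold clamp; fun_prop

lemma clamp_mem {T : ℝ} (hT : 0 ≤ T) (t : ℝ) : clamp T t ∈ Icc 0 T :=
  ⟨le_max_left _ _, max_le hT (min_le_right _ _)⟩

lemma clamp_of_mem {T t : ℝ} (ht : t ∈ Icc 0 T) : clamp T t = t := by
  rw [clamp, min_eq_left ht.2, max_eq_right ht.1]

/-- The kernel `f`, frozen outside `[0, T]`. -/
def clampKernel (T : ℝ) (f : Kernel ℝ (Space d)) : Kernel ℝ (Space d) :=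
  f.comap (clamp T) (measurable_clamp T)

lemma clampKernel_apply (T : ℝ) (f : Kernel ℝ (Space d)) (t : ℝ) :
    clampKernel T f t = f (clamp T t) := rfl

/-- The moment bounds depend on the horizon `T`, while `IsStrongSolution` requires them at all
times; freezing the kernel outside `[0, T]` reconciles the two. -/
lemma isStrongSolution_clampKernel {a : Space d → Space d → ℝ} (ha : IsRate a) {T D : ℝ}
    (hT : 0 ≤ T) {f : Kernel ℝ (Space d)} (heven : ∀ t ∈ Icc 0 T, IsEven (f t))
    (hmom : ∀ t ∈ Icc 0 T, MomentBound D (f t))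
    (heq : ∀ φ : Space d → ℝ, Measurable φ → (∃ C, ∀ p, |φ p| ≤ C) → ∀ t ∈ Icc 0 T,
      ∫ p, φ p ∂(f t) = ∫ p, φ p ∂(f 0) + ∫ s in (0 : ℝ)..t, coll a φ (f s)) :
    IsStrongSolution a T D (clampKernel T f) := by
  refine IsStrongSolution.of_bounded ha (fun t => heven _ (clamp_mem hT t))
    (fun t => hmom _ (clamp_mem hT t)) fun φ hφ hb t ht => ?_
  have h0 : (0 : ℝ) ∈ Icc 0 T := ⟨le_rfl, hT⟩
  simp only [clampKernel_apply]
  rw [clamp_of_mem ht, clamp_of_mem h0, heq φ hφ hb t ht]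
  congr 1
  refine intervalIntegral.integral_congr fun s hs => ?_
  rw [uIcc_of_le ht.1] at hs
  rw [clamp_of_mem ⟨hs.1, hs.2.trans ht.2⟩]

/-! ### Existence -/

lemma wt_sq_le (p : Space d) : wt p ^ 2 ≤ 2 * highWt 0 p := by
  have h : highWt 0 p = 1 + (‖p‖ ^ 2) ^ 2 := rfl
  rw [h]
  unfold wt
  nlinarith [sq_nonneg (‖p‖ ^ 2 - 1)]

lemma wt_cube_le (p : Space d) : wt p ^ 3 ≤ 4 * highWt 1 p := by
  have h : highWt 1 p = 1 + (‖p‖ ^ 2) ^ 3 := rfl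
  rw [h]
  unfold wt
  have h := sq_nonneg ‖p‖
  nlinarith [mul_nonneg h (sq_nonneg (‖p‖ ^ 2 - 1)), sq_nonneg (‖p‖ ^ 2 - 1)]

lemma highWt_zero_le (k : ℕ) (p : Space d) : highWt 0 p ≤ 2 * highWt k p := by
  unfold highWt
  set A := ‖p‖ ^ 2
  have hA : 0 ≤ A := sq_nonneg _
  have h0 : 0 ≤ A ^ (k + 2) := by positivity
  rcases le_total A 1 with h | h
  · have : A ^ (0 + 2) ≤ 1 := pow_le_one₀ hA h
    linarith
  · have : A ^ (0 + 2) ≤ A ^ (k + 2) := pow_le_pow_right₀ h (by omega)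
    linarith

lemma integrable_of_support {μ : Measure (Space d)} [IsFiniteMeasure μ] {r : ℝ}
    (h : μ (Metric.closedBall 0 r)ᶜ = 0) {φ : Space d → ℝ} (hφ : Continuous φ) :
    Integrable φ μ := by
  obtain ⟨C, hC⟩ := (isCompact_closedBall (0 : Space d) r).exists_bound_of_continuousOn
    hφ.continuousOn
  refine (integrable_const C).mono' hφ.aestronglyMeasurable ?_
  have hae : ∀ᵐ p ∂μ, p ∈ Metric.closedBall (0 : Space d) r := by rw [ae_iff]; exact h
  filter_upwards [hae] with p hp using hC p hp

lemma continuous_highWt (k : ℕ) : Continuous (highWt k : Space d → ℝ) := by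
  unfold highWt; fun_prop

lemma momentBound_of_highWt {k : ℕ} {μ : Measure (Space d)} (h : Integrable (highWt k) μ)
    {C : ℝ} (hC : ∫ p, highWt k p ∂μ ≤ C) : MomentBound (4 * C) μ := by
  have hle : ∀ p : Space d, wt p ^ 2 ≤ 4 * highWt k p := fun p => by
    linarith [wt_sq_le p, highWt_zero_le k p]
  have hi : Integrable (fun p => wt p ^ 2) μ :=
    (h.const_mul 4).mono' (measurable_wt.pow_const 2).aestronglyMeasurable
      (ae_of_all _ fun p => by rw [Real.norm_of_nonneg (by positivity)]; exact hle p)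
  refine ⟨hi, (integral_mono hi (h.const_mul 4) hle).trans ?_⟩
  rw [integral_const_mul]
  linarith

/-- Approximate solutions, with truncated rate and datum. -/
lemma IsRate.exists_approximation {a : Space d → Space d → ℝ} (ha : IsRate a)
    {μ : Measure (Space d)} [IsFiniteMeasure μ] (hμ : IsEven μ) {N : ℝ} (hN : 1 ≤ N) :
    ∃ (f : Kernel ℝ (Space d)) (D r : ℝ), 0 ≤ r ∧ f 0 = μ.restrict (Metric.closedBall 0 N) ∧
      (∀ T, IsStrongSolution (trunc a (N ^ 2)) T D f) ∧
      ∀ t, f t (Metric.closedBall 0 r)ᶜ = 0 := by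
  have htr := ha.isTruncatedRate_trunc (N ^ 2)
  have hBm : MeasurableSet (Metric.closedBall (0 : Space d) N) :=
    Metric.isClosed_closedBall.measurableSet
  have hc : IsEvenCompact (μ.real univ + 1) (2 * N ^ 2)
      (μ.restrict (Metric.closedBall (0 : Space d) N)) := by
    refine ⟨inferInstance, ?_, ?_, ?_⟩
    · rw [measureReal_restrict_apply .univ, univ_inter]
      linarith [measureReal_mono (μ := μ) (subset_univ (Metric.closedBall (0 : Space d) N))]
    · ext S hS
      rw [Measure.map_apply measurable_neg hS, Measure.restrict_apply hS,
        Measure.restrict_apply (measurable_neg hS)]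
      conv_rhs => rw [← hμ, Measure.map_apply measurable_neg (hS.inter hBm)]
      congr 1
      ext p
      simp
    · rw [Measure.restrict_apply Metric.isClosed_closedBall.measurableSet.compl]
      have : (Metric.closedBall (0 : Space d) (2 * N ^ 2))ᶜ ∩ Metric.closedBall 0 N = ∅ := by
        rw [← disjoint_iff_inter_eq_empty, disjoint_compl_left_iff_subset]
        exact Metric.closedBall_subset_closedBall (by nlinarith)
      rw [this, measure_empty]
  have hl : 0 < 2 * (1 + (N ^ 2) ^ 2 + (N ^ 2) ^ 2) * (μ.real univ + 1) := by positivity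
  exact ⟨wildFlow (trunc a (N ^ 2)) _ _, _, _, by positivity, IsTruncatedRate.wildFlow_zero,
    fun T => htr.isStrongSolution_wildFlow hc hl le_rfl T,
    fun t => (htr.isEvenCompact_wildFlow hc hl le_rfl t).support⟩

lemma abs_setIntegral_sub_le {μ : Measure (Space d)} {D : ℝ} (hμ : MomentBound D μ) {N : ℝ}
    (hN : 0 < N) {S : Set (Space d)} (hS : MeasurableSet S) (hNS : Metric.closedBall 0 N ⊆ S)
    {ψ : Space d → ℝ} (hψm : Measurable ψ) (hψ : ∀ p, |ψ p| ≤ wt p) :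
    |∫ p in S, ψ p ∂μ - ∫ p in Metric.closedBall 0 N, ψ p ∂μ| ≤ D / N ^ 2 := by
  have hi : Integrable ψ μ := hμ.integrable_of_le hψm (C := 1) fun p => by
    rw [one_mul]; exact hψ p
  have hB : MeasurableSet (Metric.closedBall (0 : Space d) N) :=
    Metric.isClosed_closedBall.measurableSet
  rw [← integral_indicator hS, ← integral_indicator hB,
    ← integral_sub (hi.indicator hS) (hi.indicator hB)]
  refine (norm_integral_le_of_norm_le
    (f := fun p => S.indicator ψ p - (Metric.closedBall 0 N).indicator ψ p)
    (hμ.integrable.div_const (N ^ 2)) (ae_of_all _ fun p => ?_)).trans ?_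
  swap
  · rw [integral_div]
    exact div_le_div_of_nonneg_right hμ.le (by positivity)
  by_cases hp : p ∈ Metric.closedBall (0 : Space d) N
  · rw [indicator_of_mem hp, indicator_of_mem (hNS hp), sub_self, norm_zero]
    positivity
  · rw [indicator_of_notMem hp, sub_zero]
    have h1 : N < ‖p‖ := by simpa using hp
    have h2 : N ^ 2 ≤ wt p := by
      unfold wt; nlinarith
    refine (norm_indicator_le_norm_self ψ p).trans ((hψ p).trans ?_)
    rw [le_div_iff₀ (by positivity), sq (wt p)]
    exact mul_le_mul_of_nonneg_left h2 (wt_nonneg p)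

/-- One factor of the product measure is changed at a time. For bounded `φ` the integrand is at most
`6 C wt(p) wt(q)`, so each partial function is an admissible test function up to the factor `6 C
wt`, which is then integrated in the other variable. -/
lemma abs_coll_sub_coll_le {a : Space d → Space d → ℝ} (ha : IsRate a) {D e C : ℝ}
    {μ ν : Measure (Space d)} (hμ : MomentBound D μ) (hν : MomentBound D ν)
    (h : ∀ ψ : Space d → ℝ, Measurable ψ → (∀ p, |ψ p| ≤ wt p) →
      |∫ p, ψ p ∂μ - ∫ p, ψ p ∂ν| ≤ e) {φ : Space d → ℝ} (hφm : Measurable φ) (hC : 0 < C)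
    (hφ : ∀ p, |φ p| ≤ C) : |coll a φ μ - coll a φ ν| ≤ 6 * C * D * e := by
  have := hμ.isFiniteMeasure
  have := hν.isFiniteMeasure
  set F : Space d × Space d → ℝ := fun x => a x.1 x.2 * defect φ x with hF
  have hFm : Measurable F := ha.measurable_mul_defect hφm
  have hφw : ∀ p, |φ p| ≤ C * wt p := fun p =>
    (hφ p).trans (le_mul_of_one_le_right hC.le (one_le_wt p))
  have hFb : ∀ p q, |F (p, q)| ≤ 6 * C * wt p * wt q := fun p q => by
    have h1 := abs_le.1 (hφ (p + q))
    have h2 := abs_le.1 (hφ p)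
    have h3 := abs_le.1 (hφ q)
    have h4 : |defect φ (p, q)| ≤ 3 * C := by
      unfold defect; rw [abs_le]; constructor <;> simp only <;> linarith
    simp only [hF]
    rw [abs_mul, abs_of_nonneg (ha.nonneg p q)]
    refine (mul_le_mul (ha.le_wt p q) h4 (abs_nonneg _)
      (mul_nonneg (mul_nonneg zero_le_two (wt_nonneg p)) (wt_nonneg q))).trans (le_of_eq (by ring))
  have hint : ∀ {D D' : ℝ} {ρ ρ' : Measure (Space d)}, MomentBound D ρ → MomentBound D' ρ' →
      Integrable F (ρ.prod ρ') := fun h h' => ha.integrable_mul_defect hφm hφw h h'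
  have key : ∀ (G : Space d → ℝ), Measurable G → ∀ c, 0 < c → (∀ q, |G q| ≤ c * wt q) →
      |∫ q, G q ∂μ - ∫ q, G q ∂ν| ≤ c * e := by
    intro G hG c hc hGb
    have h1 := h (fun q => c⁻¹ * G q) (hG.const_mul _) fun q => by
      rw [abs_mul, abs_of_pos (inv_pos.2 hc), inv_mul_le_iff₀ hc]
      exact hGb q
    rw [integral_const_mul, integral_const_mul, ← mul_sub, abs_mul, abs_of_pos (inv_pos.2 hc),
      inv_mul_le_iff₀ hc] at h1
    exact h1
  have he : 0 ≤ e := (abs_nonneg _).trans (h (fun _ => 0) measurable_const fun p => by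
    rw [abs_zero]; exact wt_nonneg p)
  have h1 : |∫ x, F x ∂(μ.prod μ) - ∫ x, F x ∂(μ.prod ν)| ≤ 6 * C * e * D := by
    rw [integral_prod _ (hint hμ hμ), integral_prod _ (hint hμ hν),
      ← integral_sub (hint hμ hμ).integral_prod_left (hint hμ hν).integral_prod_left]
    refine (norm_integral_le_of_norm_le
      (f := fun p => ∫ q, F (p, q) ∂μ - ∫ q, F (p, q) ∂ν) (hμ.integrable_wt.const_mul (6 * C * e))
      (ae_of_all _ fun p => ?_)).trans ?_
    · refine (key (fun q => F (p, q)) (hFm.comp measurable_prodMk_left) (6 * C * wt p)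
        (mul_pos (by positivity) (wt_pos p)) (hFb p)).trans (le_of_eq (by ring))
    · rw [integral_const_mul]
      exact mul_le_mul_of_nonneg_left hμ.integral_wt_le (by positivity)
  have h2 : |∫ x, F x ∂(μ.prod ν) - ∫ x, F x ∂(ν.prod ν)| ≤ 6 * C * e * D := by
    rw [integral_prod_symm _ (hint hμ hν), integral_prod_symm _ (hint hν hν),
      ← integral_sub (hint hμ hν).integral_prod_right (hint hν hν).integral_prod_right]
    refine (norm_integral_le_of_norm_le
      (f := fun q => ∫ p, F (p, q) ∂μ - ∫ p, F (p, q) ∂ν) (hν.integrable_wt.const_mul (6 * C * e))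
      (ae_of_all _ fun q => ?_)).trans ?_
    · refine (key (fun p => F (p, q)) (hFm.comp measurable_prodMk_right) (6 * C * wt q)
        (mul_pos (by positivity) (wt_pos q)) (fun p => (hFb p q).trans
          (le_of_eq (by ring)))).trans (le_of_eq (by ring))
    · rw [integral_const_mul]
      exact mul_le_mul_of_nonneg_left hν.integral_wt_le (by positivity)
  have h3 := abs_sub_le (∫ x, F x ∂(μ.prod μ)) (∫ x, F x ∂(μ.prod ν)) (∫ x, F x ∂(ν.prod ν))
  unfold coll
  rw [← mul_sub, abs_mul, abs_of_pos (by norm_num : (0 : ℝ) < 2⁻¹)]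
  linarith

/-- Here the scales are chosen: datum cut at radius `N`, rate at `N²`. The moment of order six may
then grow like `N²`, while the truncation of the rate gains `N⁻⁴`; the error is `O(N⁻²)` and no
moment of the datum beyond the fourth is needed. -/
lemma IsRate.integral_abs_sub_trunc_le {a : Space d → Space d → ℝ} (ha : IsRate a) {N D E : ℝ}
    (hN : 0 < N) {μ : Measure (Space d)} (hμ : MomentBound D μ)
    (hi : Integrable (fun p => wt p ^ 3) μ) (hE : ∫ p, wt p ^ 3 ∂μ ≤ E * N ^ 2) :
    Integrable (fun x : Space d × Space d =>
      |a x.1 x.2 - trunc a (N ^ 2) x.1 x.2| * (wt x.1 * wt x.2)) (μ.prod μ) ∧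
    ∫ x, |a x.1 x.2 - trunc a (N ^ 2) x.1 x.2| * (wt x.1 * wt x.2) ∂(μ.prod μ) ≤
      4 * E * D / N ^ 2 := by
  have := hμ.isFiniteMeasure
  have i1 : Integrable (fun x : Space d × Space d => wt x.1 ^ 3 * wt x.2 ^ 2) (μ.prod μ) :=
    hi.mul_prod hμ.integrable
  have i2 : Integrable (fun x : Space d × Space d => wt x.1 ^ 2 * wt x.2 ^ 3) (μ.prod μ) :=
    hμ.integrable.mul_prod hi
  have i3 := (i1.add i2).const_mul (2 / (N ^ 2) ^ 2)
  have hb := ha.abs_sub_trunc_le (ρ := N ^ 2) (by positivity)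
  have m1 := ha.meas
  have m2 := (ha.isTruncatedRate_trunc (N ^ 2)).meas
  have i4 : Integrable (fun x : Space d × Space d =>
      |a x.1 x.2 - trunc a (N ^ 2) x.1 x.2| * (wt x.1 * wt x.2)) (μ.prod μ) := by
    refine i3.mono' (by fun_prop) (ae_of_all _ fun x => ?_)
    rw [Real.norm_of_nonneg (mul_nonneg (abs_nonneg _) (mul_nonneg (wt_nonneg _) (wt_nonneg _)))]
    exact hb x.1 x.2
  refine ⟨i4, (integral_mono i4 i3 fun x => hb x.1 x.2).trans ?_⟩
  rw [integral_const_mul]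
  simp only [Pi.add_apply]
  rw [integral_add i1 i2, integral_prod_mul (fun p => wt p ^ 3) (fun p => wt p ^ 2),
    integral_prod_mul (fun p => wt p ^ 2) (fun p => wt p ^ 3)]
  have hp : 0 ≤ ∫ p, wt p ^ 3 ∂μ := integral_nonneg fun p => pow_nonneg (wt_nonneg p) 3
  have h1 : (∫ p, wt p ^ 3 ∂μ) * ∫ p, wt p ^ 2 ∂μ ≤ E * N ^ 2 * D :=
    mul_le_mul hE hμ.le (integral_nonneg fun _ => by positivity) (hp.trans hE)
  have h2 : 2 / (N ^ 2) ^ 2 * ((∫ p, wt p ^ 3 ∂μ) * (∫ p, wt p ^ 2 ∂μ) +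
      (∫ p, wt p ^ 2 ∂μ) * ∫ p, wt p ^ 3 ∂μ) ≤ 2 / (N ^ 2) ^ 2 * (2 * (E * N ^ 2 * D)) :=
    mul_le_mul_of_nonneg_left (by linarith) (by positivity)
  refine h2.trans (le_of_eq ?_)
  field_simp
  ring

lemma abs_coll_sub_coll_rate_le {a b : Space d → Space d → ℝ} (ha : IsRate a) (hb : IsRate b)
    {D e C : ℝ} {μ : Measure (Space d)} (hμ : MomentBound D μ)
    (h : ∫ x, |a x.1 x.2 - b x.1 x.2| * (wt x.1 * wt x.2) ∂(μ.prod μ) ≤ e)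
    {φ : Space d → ℝ} (hφm : Measurable φ) (hC : 0 ≤ C) (hφ : ∀ p, |φ p| ≤ C * wt p) :
    |coll a φ μ - coll b φ μ| ≤ 2 * C * e := by
  have m1 := ha.meas
  have m2 := hb.meas
  have hi : Integrable (fun x : Space d × Space d =>
      |a x.1 x.2 - b x.1 x.2| * (wt x.1 * wt x.2)) (μ.prod μ) := by
    refine hμ.integrable_prod_of_le hμ (by fun_prop) (C := 4) fun x => ?_
    rw [abs_mul, abs_abs, abs_of_pos (mul_pos (wt_pos _) (wt_pos _))]
    have h1 := abs_sub (a x.1 x.2) (b x.1 x.2)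
    rw [abs_of_nonneg (ha.nonneg _ _), abs_of_nonneg (hb.nonneg _ _)] at h1
    have h2 := ha.le_wt x.1 x.2
    have h3 := hb.le_wt x.1 x.2
    refine (mul_le_mul_of_nonneg_right (by linarith : _ ≤ 4 * (wt x.1 * wt x.2))
      (mul_pos (wt_pos _) (wt_pos _)).le).trans (le_of_eq (by ring))
  have hd : coll a φ μ - coll b φ μ =
      2⁻¹ * ∫ x, (a x.1 x.2 - b x.1 x.2) * defect φ x ∂(μ.prod μ) := by
    unfold coll
    rw [← mul_sub, ← integral_sub (ha.integrable_mul_defect hφm hφ hμ hμ)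
      (hb.integrable_mul_defect hφm hφ hμ hμ)]
    simp only [sub_mul]
  have hb := norm_integral_le_of_norm_le
    (f := fun x : Space d × Space d => (a x.1 x.2 - b x.1 x.2) * defect φ x)
    (hi.const_mul (4 * C)) (ae_of_all _ fun x => by
      rw [norm_mul, Real.norm_eq_abs, Real.norm_eq_abs]
      exact (mul_le_mul_of_nonneg_left (abs_defect_le hφ x) (abs_nonneg _)).trans
        (le_of_eq (by ring)))
  rw [integral_const_mul, Real.norm_eq_abs] at hb
  rw [hd, abs_mul, abs_of_pos (by norm_num : (0 : ℝ) < 2⁻¹)]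
  have := mul_le_mul_of_nonneg_left h (by positivity : 0 ≤ 4 * C)
  linarith

lemma tendsto_integral_of_close {μ : ℕ → Measure (Space d)} {ν : Measure (Space d)} {e : ℕ → ℝ}
    (he : Tendsto e atTop (𝓝 0))
    (h : ∀ n, ∀ ψ : Space d → ℝ, Measurable ψ → (∀ p, |ψ p| ≤ wt p) →
      |∫ p, ψ p ∂(μ n) - ∫ p, ψ p ∂ν| ≤ e n) {φ : Space d → ℝ} (hφm : Measurable φ)
    {C : ℝ} (hφ : ∀ p, |φ p| ≤ C * wt p) :
    Tendsto (fun n => ∫ p, φ p ∂(μ n)) atTop (𝓝 (∫ p, φ p ∂ν)) := by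
  have hC : 0 < |C| + 1 := by positivity
  have h1 : ∀ n, |∫ p, φ p ∂(μ n) - ∫ p, φ p ∂ν| ≤ (|C| + 1) * e n := fun n => by
    have := h n (fun p => (|C| + 1)⁻¹ * φ p) (hφm.const_mul _) fun p => by
      rw [abs_mul, abs_of_pos (inv_pos.2 hC), inv_mul_le_iff₀ hC]
      exact (hφ p).trans (mul_le_mul_of_nonneg_right (by linarith [le_abs_self C]) (wt_nonneg p))
    rwa [integral_const_mul, integral_const_mul, ← mul_sub, abs_mul, abs_of_pos (inv_pos.2 hC),
      inv_mul_le_iff₀ hC] at this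
  rw [tendsto_iff_norm_sub_tendsto_zero]
  refine squeeze_zero (fun _ => norm_nonneg _) h1 ?_
  simpa using he.const_mul (|C| + 1)

/-- Limits of strong solutions are strong solutions. -/
lemma isStrongSolution_of_tendsto {a : Space d → Space d → ℝ} (ha : IsRate a)
    {b : ℕ → Space d → Space d → ℝ} (hb : ∀ n, IsRate (b n)) {T D : ℝ}
    {g : ℕ → Kernel ℝ (Space d)} (hg : ∀ n, IsStrongSolution (b n) T D (g n)) {e e' : ℕ → ℝ}
    (he : Tendsto e atTop (𝓝 0)) (he' : Tendsto e' atTop (𝓝 0)) {G : Kernel ℝ (Space d)}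
    (hG : ∀ t, MomentBound D (G t))
    (hlim : ∀ n t, ∀ ψ : Space d → ℝ, Measurable ψ → (∀ p, |ψ p| ≤ wt p) →
      |∫ p, ψ p ∂(g n t) - ∫ p, ψ p ∂(G t)| ≤ e n)
    (hab : ∀ n t, ∫ x, |a x.1 x.2 - b n x.1 x.2| * (wt x.1 * wt x.2) ∂((g n t).prod (g n t)) ≤
      e' n) : IsStrongSolution a T D G := by
  have hbd : ∀ {φ : Space d → ℝ} {C : ℝ}, (∀ p, |φ p| ≤ C) → ∀ p, |φ p| ≤ C * wt p :=
    fun {φ C} h p => (h p).trans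
      (le_mul_of_one_le_right ((abs_nonneg _).trans (h p)) (one_le_wt p))
  refine IsStrongSolution.of_bounded ha (fun t => ?_) hG fun φ hφ ⟨C, hC⟩ t ht => ?_
  · have := (hG t).isFiniteMeasure
    refine isEven_of_integral fun φ hφm hφ => ?_
    have h1 := tendsto_integral_of_close he (fun n => hlim n t) (hφm.comp measurable_neg)
      (hbd fun p => hφ (-p))
    have h2 := tendsto_integral_of_close he (fun n => hlim n t) hφm (hbd hφ)
    refine tendsto_nhds_unique h1 (h2.congr fun n => ?_)
    exact (((hg n).even t).integral_comp_neg φ).symm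
  · set c := |C| + 1
    have hc : 0 < c := by positivity
    have hφc : ∀ p, |φ p| ≤ c := fun p => (hC p).trans (by linarith [le_abs_self C])
    have h1 := fun t => tendsto_integral_of_close he (fun n => hlim n t) hφ (hbd hφc)
    have hcoll : ∀ s, Tendsto (fun n => coll (b n) φ (g n s)) atTop (𝓝 (coll a φ (G s))) := by
      intro s
      rw [tendsto_iff_norm_sub_tendsto_zero]
      refine squeeze_zero (g := fun n => 2 * c * e' n + 6 * c * D * e n)
        (fun _ => norm_nonneg _) (fun n => ?_) ?_
      · have h2 := abs_coll_sub_coll_rate_le ha (hb n) ((hg n).moment s) (hab n s) hφ hc.le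
          (hbd hφc)
        have h3 := abs_coll_sub_coll_le ha ((hg n).moment s) (hG s) (hlim n s) hφ hc hφc
        rw [abs_sub_comm] at h2
        exact (abs_sub_le _ _ _).trans (add_le_add h2 h3)
      · simpa using (he'.const_mul (2 * c)).add (he.const_mul (6 * c * D))
    refine tendsto_nhds_unique (h1 t) ?_
    have heq := fun n => (hg n).equation φ hφ ⟨c, hbd hφc⟩ t ht
    simp_rw [heq]
    refine (h1 0).add (intervalIntegral.tendsto_integral_filter_of_dominated_convergence
      (fun _ => 4 * c * D ^ 2) (Eventually.of_forall fun n => ?_)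
      (Eventually.of_forall fun n => ae_of_all _ fun s _ => ?_) intervalIntegrable_const
      (ae_of_all _ fun s _ => hcoll s))
    · have := isFiniteKernel_of_momentBound (hg n).moment
      exact (measurable_coll (hb n) hφ (g n)).aestronglyMeasurable
    · exact (hb n).abs_coll_le hc.le (hbd hφc) ((hg n).moment s)

lemma measurable_of_tendsto_integral {f : ℕ → Kernel ℝ (Space d)} {τ : ℝ → ℝ}
    (hτ : Measurable τ) (hf : ∀ n t, IsFiniteMeasure (f n (τ t))) {F : ℝ → Measure (Space d)}
    (hF : ∀ t, IsFiniteMeasure (F t))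
    (h : ∀ t, ∀ ψ : Space d → ℝ, Measurable ψ → (∀ p, |ψ p| ≤ wt p) →
      Tendsto (fun n => ∫ p, ψ p ∂(f n (τ t))) atTop (𝓝 (∫ p, ψ p ∂(F t)))) : Measurable F := by
  refine Measure.measurable_of_measurable_coe _ fun S hS => ?_
  refine measurable_of_tendsto_metrizable (f := fun n t => f n (τ t) S)
    (fun n => ((f n).measurable_coe hS).comp hτ) (tendsto_pi_nhds.2 fun t => ?_)
  have := hF t
  rw [← ENNReal.tendsto_toReal_iff (fun n => by have := hf n t; exact measure_ne_top _ _)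
    (measure_ne_top _ _)]
  have h1 := h t (S.indicator 1) (measurable_one.indicator hS) fun p => by
    refine le_trans ?_ (one_le_wt p)
    by_cases hp : p ∈ S <;> simp [hp]
  simp only [integral_indicator_one hS] at h1
  exact h1

lemma highWt_one_le {N : ℝ} (hN : 1 ≤ N) {p : Space d} (hp : ‖p‖ ≤ N) :
    highWt 1 p ≤ N ^ 2 * highWt 0 p := by
  have h1 : highWt 1 p = 1 + (‖p‖ ^ 2) ^ 3 := rfl
  have h0 : highWt 0 p = 1 + (‖p‖ ^ 2) ^ 2 := rfl
  rw [h1, h0]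
  have h2 : ‖p‖ ^ 2 ≤ N ^ 2 := pow_le_pow_left₀ (norm_nonneg p) hp 2
  have h3 : 1 ≤ N ^ 2 := one_le_pow₀ hN
  nlinarith [mul_le_mul_of_nonneg_right h2 (sq_nonneg (‖p‖ ^ 2))]

/-- A sequence of approximate solutions, with uniform bounds. -/
lemma IsRate.exists_approximations {a : Space d → Space d → ℝ} (ha : IsRate a) (k : ℕ)
    {μ : Measure (Space d)} [IsFiniteMeasure μ] (hμ : IsEven μ) (hi : Integrable (highWt k) μ) :
    ∃ f : ℕ → Kernel ℝ (Space d),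
      (∀ n : ℕ, f n 0 = μ.restrict (Metric.closedBall 0 ((n : ℝ) + 1))) ∧
      ∀ T, 0 ≤ T → ∃ E, 0 < E ∧ ∀ n : ℕ,
        IsStrongSolution (trunc a (((n : ℝ) + 1) ^ 2)) T E (clampKernel T (f n)) ∧
        ∀ t ∈ Icc 0 T, (Integrable (highWt k) (f n t) ∧ ∫ p, highWt k p ∂(f n t) ≤ E) ∧
          Integrable (fun p => wt p ^ 3) (f n t) ∧
          ∫ p, wt p ^ 3 ∂(f n t) ≤ E * ((n : ℝ) + 1) ^ 2 := by
  have hN : ∀ n : ℕ, 1 ≤ (n : ℝ) + 1 := fun n => by simp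
  choose f D r hr hf0 hf hsupp using fun n : ℕ => ha.exists_approximation hμ (hN n)
  refine ⟨f, hf0, fun T hT => ?_⟩
  -- Two orders are propagated: `2k + 4`, uniformly in `n`, and six, which starts from at most `(n +
  -- 1)²` times a moment of order four because the datum is cut at radius `n + 1`.
  obtain ⟨c, hc, hck⟩ := exists_integral_highWt_le (d := d) k
  obtain ⟨c', hc', hck'⟩ := exists_integral_highWt_le (d := d) 1
  have hμm := momentBound_of_highWt hi le_rfl
  set m := ∫ p, wt p ∂μ + 1 with hm_def
  have hwt0 : 0 ≤ ∫ p, wt p ∂μ := integral_nonneg wt_nonneg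
  have hm : 0 < m := by linarith
  set H := ∫ p, highWt k p ∂μ with hH_def
  have hH : 0 ≤ H := integral_nonneg fun p => (highWt_pos k p).le
  have hi0 : Integrable (highWt 0) μ := (hi.const_mul 2).mono'
    (measurable_highWt 0).aestronglyMeasurable (ae_of_all _ fun p => by
      rw [Real.norm_of_nonneg (highWt_pos 0 p).le]; exact highWt_zero_le k p)
  have hH0 : ∫ p, highWt 0 p ∂μ ≤ 2 * H := by
    rw [hH_def, ← integral_const_mul]
    exact integral_mono hi0 (hi.const_mul 2) (highWt_zero_le k)
  have hm0 : ∀ n, ∫ p, wt p ∂(f n 0) ≤ m := fun n => by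
    rw [hf0]
    have := setIntegral_le_integral (s := Metric.closedBall 0 ((n : ℝ) + 1)) hμm.integrable_wt
      (ae_of_all _ wt_nonneg)
    linarith
  have hfin : ∀ n t, IsFiniteMeasure (f n t) := fun n t => ((hf n T).moment t).isFiniteMeasure
  have htr := fun n : ℕ => (ha.isTruncatedRate_trunc (((n : ℝ) + 1) ^ 2)).toIsRate
  have hexp : ∀ {c t : ℝ}, 0 < c → t ∈ Icc 0 T → Real.exp (c * m * t) ≤ Real.exp (c * m * T) :=
    fun hc ht => Real.exp_le_exp.2 (mul_le_mul_of_nonneg_left ht.2 (by positivity))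
  have hk : ∀ n, ∀ t ∈ Icc 0 T, ∫ p, highWt k p ∂(f n t) ≤ H * Real.exp (c * m * T) := by
    intro n t ht
    refine (hck _ (htr n) T _ _ m _ (hf n T) (hr n) (hsupp n) hm (hm0 n) t ht).trans
      (mul_le_mul ?_ (hexp hc ht) (Real.exp_pos _).le hH)
    rw [hf0]
    exact setIntegral_le_integral hi (ae_of_all _ fun p => (highWt_pos k p).le)
  have hk' : ∀ n : ℕ, ∀ t ∈ Icc 0 T, ∫ p, highWt 1 p ∂(f n t) ≤
      2 * H * Real.exp (c' * m * T) * ((n : ℝ) + 1) ^ 2 := by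
    intro n t ht
    have h1 : ∫ p, highWt 1 p ∂(f n 0) ≤ ((n : ℝ) + 1) ^ 2 * (2 * H) := by
      have hs := hsupp n 0
      have i1 : Integrable (highWt 1) (f n 0) := integrable_of_support hs (continuous_highWt 1)
      rw [hf0] at i1 ⊢
      calc ∫ p in Metric.closedBall 0 ((n : ℝ) + 1), highWt 1 p ∂μ
          ≤ ∫ p in Metric.closedBall 0 ((n : ℝ) + 1), ((n : ℝ) + 1) ^ 2 * highWt 0 p ∂μ :=
            setIntegral_mono_on i1 (hi0.const_mul _).integrableOn
              Metric.isClosed_closedBall.measurableSet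
              fun p hp => highWt_one_le (hN n) (by simpa using hp)
        _ = ((n : ℝ) + 1) ^ 2 * ∫ p in Metric.closedBall 0 ((n : ℝ) + 1), highWt 0 p ∂μ :=
            integral_const_mul _ _
        _ ≤ _ := mul_le_mul_of_nonneg_left ((setIntegral_le_integral hi0
            (ae_of_all _ fun p => (highWt_pos 0 p).le)).trans hH0) (by positivity)
    refine (hck' _ (htr n) T _ _ m _ (hf n T) (hr n) (hsupp n) hm (hm0 n) t ht).trans
      ((mul_le_mul h1 (hexp hc' ht) (Real.exp_pos _).le (by positivity)).trans
        (le_of_eq (by ring)))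
  -- One constant for all bounds: the first `4` comes from `momentBound_of_highWt`, the `8` from
  -- `wt_cube_le` and `hH0`, and the final `1` makes it positive.
  set E := 4 * (H * Real.exp (c * m * T)) + 8 * H * Real.exp (c' * m * T) + 1 with hE
  have e1 : 0 ≤ H * Real.exp (c * m * T) := by positivity
  have e2 : 0 ≤ 8 * H * Real.exp (c' * m * T) := by positivity
  have hik : ∀ n t, Integrable (highWt k) (f n t) := fun n t =>
    integrable_of_support (hsupp n t) (continuous_highWt k)
  refine ⟨E, by positivity, fun n => ⟨?_, fun t ht => ⟨⟨hik n t, ?_⟩, ?_, ?_⟩⟩⟩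
  · refine isStrongSolution_clampKernel (htr n) hT (fun t _ => (hf n T).even t)
      (fun t ht => (momentBound_of_highWt (hik n t) (hk n t ht)).mono (by linarith))
      fun φ hφ ⟨C, hC⟩ t ht => (hf n T).equation φ hφ ⟨C, fun p => (hC p).trans
        (le_mul_of_one_le_right ((abs_nonneg _).trans (hC p)) (one_le_wt p))⟩ t ht
  · linarith [hk n t ht]
  · exact integrable_of_support (hsupp n t) (continuous_wt.pow 3)
  · have h1 : ∫ p, wt p ^ 3 ∂(f n t) ≤ 4 * ∫ p, highWt 1 p ∂(f n t) := by
      rw [← integral_const_mul]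
      exact integral_mono (integrable_of_support (hsupp n t) (continuous_wt.pow 3))
        ((integrable_of_support (hsupp n t) (continuous_highWt 1)).const_mul 4) wt_cube_le
    have h2 := hk' n t ht
    have h3 : 8 * H * Real.exp (c' * m * T) * ((n : ℝ) + 1) ^ 2 ≤ E * ((n : ℝ) + 1) ^ 2 :=
      mul_le_mul_of_nonneg_right (by linarith) (by positivity)
    linarith

/-- Existence of strong solutions. -/
theorem IsRate.exists_strongSolution {a : Space d → Space d → ℝ} (ha : IsRate a) (k : ℕ)
    {μ : Measure (Space d)} [IsFiniteMeasure μ] (hμ : IsEven μ) (hi : Integrable (highWt k) μ) :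
    ∃ f : Kernel ℝ (Space d), f 0 = μ ∧ ∀ T, 0 ≤ T → ∃ E,
      IsStrongSolution a T E (clampKernel T f) ∧
      ∀ t ∈ Icc 0 T, Integrable (highWt k) (f t) ∧ ∫ p, highWt k p ∂(f t) ≤ E := by
  obtain ⟨f, hf0, hf⟩ := ha.exists_approximations k hμ hi
  choose! E hE hfE using hf
  have hμm := momentBound_of_highWt hi le_rfl
  set D₀ := 4 * ∫ p, highWt k p ∂μ
  have hN : ∀ n : ℕ, 0 < (n : ℝ) + 1 := fun n => by positivity
  have h0mem : ∀ {T : ℝ}, 0 ≤ T → (0 : ℝ) ∈ Icc 0 T := fun h => ⟨le_rfl, h⟩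
  -- The stability constant for initial error `D₀ / (n+1)²` and rate error `4 E² / (n+1)²`.
  set c : ℝ → ℝ := fun T => (D₀ + 2 * (4 * E T * E T) * T) * Real.exp (4 * E T * T) with hc
  set e : ℝ → ℕ → ℝ := fun T n => c T / ((n : ℝ) + 1) ^ 2 with he_def
  have hlim0 : ∀ C : ℝ, Tendsto (fun n : ℕ => C / ((n : ℝ) + 1) ^ 2) atTop (𝓝 0) := fun C => by
    refine Tendsto.const_div_atTop ?_ C
    exact (tendsto_pow_atTop two_ne_zero).comp
      (tendsto_atTop_add_const_right _ _ tendsto_natCast_atTop_atTop)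
  have he : ∀ T, Tendsto (e T) atTop (𝓝 0) := fun T => hlim0 _
  have hmom : ∀ T, 0 ≤ T → ∀ n, ∀ t ∈ Icc 0 T, MomentBound (E T) (f n t) := by
    intro T hT n t ht
    have := (hfE T hT n).1.moment t
    rwa [clampKernel_apply, clamp_of_mem ht] at this
  have htr := fun n : ℕ => (ha.isTruncatedRate_trunc (((n : ℝ) + 1) ^ 2)).toIsRate
  have herr : ∀ T : ℝ, 0 ≤ T → ∀ n : ℕ, ∀ t ∈ Icc 0 T, _ := fun T hT n t ht =>
    ha.integral_abs_sub_trunc_le (hN n) (hmom T hT n t ht) ((hfE T hT n).2 t ht).2.1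
      ((hfE T hT n).2 t ht).2.2
  have hcauchy : ∀ T, 0 ≤ T → ∀ t ∈ Icc 0 T, ∀ n m, n ≤ m → ∀ ψ : Space d → ℝ, Measurable ψ →
      (∀ p, |ψ p| ≤ wt p) → |∫ p, ψ p ∂(f m t) - ∫ p, ψ p ∂(f n t)| ≤ e T n := by
    intro T hT t ht n m hnm ψ hψm hψ
    have hnm' : (n : ℝ) + 1 ≤ (m : ℝ) + 1 := by simpa using hnm
    have m1 := (htr m).meas
    have m2 := (htr n).meas
    have key := IsStrongSolution.stability (htr m) (htr n) (hE T hT) (hfE T hT m).1 (hfE T hT n).1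
      (e := 4 * E T * E T / ((n : ℝ) + 1) ^ 2) (N₀ := D₀ / ((n : ℝ) + 1) ^ 2) ?_ ?_ ht hψm hψ
    · rw [clampKernel_apply, clampKernel_apply, clamp_of_mem ht] at key
      refine key.trans ?_
      have hD₀ : 0 ≤ D₀ := hμm.nonneg
      have hET := hE T hT
      have : Real.exp (4 * E T * t) ≤ Real.exp (4 * E T * T) :=
        Real.exp_le_exp.2 (mul_le_mul_of_nonneg_left ht.2 (by positivity))
      refine (mul_le_mul_of_nonneg_left this (by positivity)).trans (le_of_eq ?_)
      simp only [he_def, hc]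
      field_simp
    · intro s hs
      rw [clampKernel_apply, clamp_of_mem hs]
      obtain ⟨h1, h2⟩ := herr T hT n s hs
      refine le_trans (integral_mono_of_nonneg (ae_of_all _ fun x => mul_nonneg (abs_nonneg _)
        (mul_nonneg (wt_nonneg _) (wt_nonneg _))) h1 (ae_of_all _ fun x => ?_)) h2
      exact mul_le_mul_of_nonneg_right (abs_trunc_sub_trunc_le a
        (pow_le_pow_left₀ (hN n).le hnm' 2) _ _) (mul_nonneg (wt_nonneg _) (wt_nonneg _))
    · intro ψ hψm hψ
      rw [clampKernel_apply, clampKernel_apply, clamp_of_mem (h0mem hT), hf0, hf0]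
      exact abs_setIntegral_sub_le hμm (hN n) Metric.isClosed_closedBall.measurableSet
        (Metric.closedBall_subset_closedBall hnm') hψm hψ
  have hex : ∀ t, ∃ ν : Measure (Space d), 0 ≤ t → IsFiniteMeasure ν ∧ ∀ n, ∀ ψ : Space d → ℝ,
      Measurable ψ → (∀ p, |ψ p| ≤ wt p) → |∫ p, ψ p ∂(f n t) - ∫ p, ψ p ∂ν| ≤ e t n := by
    intro t
    by_cases ht : 0 ≤ t
    · obtain ⟨ν, h⟩ := exists_measure_of_cauchy_wt (fun n => f n t)
        (fun n => (hmom t ht n t ⟨ht, le_rfl⟩).integrable_wt) (he t) (hcauchy t ht t ⟨ht, le_rfl⟩)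
      exact ⟨ν, fun _ => h⟩
    · exact ⟨0, fun h => absurd h ht⟩
  choose F hF using hex
  have hmax : ∀ t : ℝ, 0 ≤ max t 0 := fun t => le_max_right _ _
  have hconv : ∀ t, 0 ≤ t → ∀ (φ : Space d → ℝ), Measurable φ → ∀ C, (∀ p, |φ p| ≤ C * wt p) →
      Tendsto (fun n => ∫ p, φ p ∂(f n t)) atTop (𝓝 (∫ p, φ p ∂(F t))) :=
    fun t ht φ hφ C hC => tendsto_integral_of_close (he t) (hF t ht).2 hφ hC
  -- The limit at time `t` was built with the rate of convergence for horizon `t`; passing to the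
  -- limit in the Cauchy estimate for horizon `T` makes the rate uniform on `[0, T]`.
  have hF' : ∀ T, 0 ≤ T → ∀ t ∈ Icc 0 T, ∀ n, ∀ ψ : Space d → ℝ, Measurable ψ →
      (∀ p, |ψ p| ≤ wt p) → |∫ p, ψ p ∂(f n t) - ∫ p, ψ p ∂(F t)| ≤ e T n := by
    intro T hT t ht n ψ hψm hψ
    refine le_of_tendsto ((hconv t ht.1 ψ hψm 1 (by simpa using hψ)).const_sub _).abs ?_
    filter_upwards [eventually_ge_atTop n] with m hm
    rw [abs_sub_comm]
    exact hcauchy T hT t ht n m hm ψ hψm hψ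
  have hmeas : Measurable fun t => F (max t 0) := by
    refine measurable_of_tendsto_integral (f := f) (τ := fun t => max t 0) (by fun_prop)
      (fun n t => (hmom _ (hmax t) n _ ⟨hmax t, le_rfl⟩).isFiniteMeasure)
      (fun t => (hF _ (hmax t)).1) fun t ψ hψm hψ => ?_
    exact hconv _ (hmax t) ψ hψm 1 (by simpa using hψ)
  have hmF : ∀ T, 0 ≤ T → ∀ t ∈ Icc 0 T,
      Integrable (highWt k) (F t) ∧ ∫ p, highWt k p ∂(F t) ≤ E T := by
    intro T hT t ht
    have := (hF t ht.1).1
    refine integrable_of_integral_min_le (measurable_highWt k) (fun p => (highWt_pos k p).le)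
      fun j => ?_
    refine le_of_tendsto (hconv t ht.1 (fun p => min (highWt k p) j)
      ((measurable_highWt k).min measurable_const) j fun p => ?_) (Eventually.of_forall fun n => ?_)
    · rw [abs_of_nonneg (le_min (highWt_pos k p).le (Nat.cast_nonneg j))]
      exact (min_le_right _ _).trans (le_mul_of_one_le_right (Nat.cast_nonneg j) (one_le_wt p))
    · obtain ⟨h1, h2⟩ := ((hfE T hT n).2 t ht).1
      refine le_trans (integral_mono_of_nonneg (ae_of_all _ fun p =>
        le_min (highWt_pos k p).le (Nat.cast_nonneg j)) h1
        (ae_of_all _ fun p => min_le_left _ _)) h2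
  refine ⟨⟨fun t => F (max t 0), hmeas⟩, ?_, fun T hT => ⟨4 * E T, ?_, fun t ht => ?_⟩⟩
  · change F (max 0 0) = μ
    rw [max_self]
    have := (hF 0 le_rfl).1
    ext S hS
    have hb : ∀ p : Space d, |S.indicator (1 : Space d → ℝ) p| ≤ wt p := fun p => by
      refine le_trans ?_ (one_le_wt p)
      by_cases hp : p ∈ S <;> simp [hp]
    have hm : Measurable (S.indicator (1 : Space d → ℝ)) := measurable_one.indicator hS
    have h1 := hconv 0 le_rfl _ hm 1 (by simpa using hb)
    have h2 := tendsto_integral_of_close (μ := fun n => f n 0) (ν := μ) (hlim0 D₀)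
      (fun n ψ hψm hψ => by
        have := abs_setIntegral_sub_le hμm (hN n) MeasurableSet.univ (subset_univ _) hψm hψ
        rw [Measure.restrict_univ, abs_sub_comm] at this
        rwa [hf0]) hm (C := 1) (by simpa using hb)
    have h3 := tendsto_nhds_unique h1 h2
    rw [integral_indicator_one hS, integral_indicator_one hS] at h3
    exact (measureReal_eq_measureReal_iff).1 h3
  · have hcl : ∀ t, clamp T t ∈ Icc 0 T := clamp_mem hT
    have hap : ∀ t, clampKernel T ⟨fun t => F (max t 0), hmeas⟩ t = F (clamp T t) := fun t => by
      rw [clampKernel_apply]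
      change F (max _ _) = _
      rw [max_eq_left (hcl t).1]
    refine isStrongSolution_of_tendsto ha htr
      (fun n => ⟨(hfE T hT n).1.even, fun t => ((hfE T hT n).1.moment t).mono ?_,
        (hfE T hT n).1.equation⟩) (he T) (hlim0 (4 * E T * E T)) (fun t => ?_)
      (fun n t ψ hψm hψ => ?_) (fun n t => ?_)
    · linarith [hE T hT]
    · rw [hap]
      exact momentBound_of_highWt (hmF T hT _ (hcl t)).1 (hmF T hT _ (hcl t)).2
    · rw [hap, clampKernel_apply]
      exact hF' T hT _ (hcl t) n ψ hψm hψ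
    · rw [clampKernel_apply]
      exact (herr T hT n _ (hcl t)).2
  · change Integrable _ (F (max t 0)) ∧ ∫ p, highWt k p ∂(F (max t 0)) ≤ _
    rw [max_eq_left ht.1]
    exact ⟨(hmF T hT t ht).1, (hmF T hT t ht).2.trans (by linarith [hE T hT])⟩

/-! ### The rate `|p - q|^γ` -/

lemma rpow_le_one_add_sq {x γ : ℝ} (hx : 0 ≤ x) (hγ : γ ∈ Icc (0 : ℝ) 2) :
    x ^ γ ≤ 1 + x ^ 2 := by
  rcases le_total x 1 with h | h
  · have := Real.rpow_le_one hx h hγ.1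
    nlinarith [sq_nonneg x]
  · have := Real.rpow_le_rpow_of_exponent_le h hγ.2
    rw [Real.rpow_two] at this
    linarith

lemma measurable_kernel (γ : ℝ) :
    Measurable (fun x : Space d × Space d => kernel γ x.1 x.2) := by
  unfold kernel
  fun_prop

/-- Monotonicity reflects `|p-q| ≤ |p+q|` when `⟨p,q⟩ ≥ 0`; the quadratic bound uses `γ ≤ 2` and the
parallelogram law. -/
lemma isRate_kernel {γ : ℝ} (hγ : γ ∈ Icc (0 : ℝ) 2) :
    IsRate (kernel γ : Space d → Space d → ℝ) where
  meas := measurable_kernel γ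
  nonneg p q := by unfold kernel; positivity
  symm p q := by unfold kernel; rw [norm_sub_rev]
  neg p q := by unfold kernel; rw [← norm_neg]; congr 2; abel
  mono p q h := by
    unfold kernel
    refine Real.rpow_le_rpow (norm_nonneg _) ?_ hγ.1
    rw [sub_neg_eq_add]
    refine le_of_sq_le_sq ?_ (norm_nonneg _)
    rw [norm_sub_sq_real, norm_add_sq_real]
    linarith
  bound p q := by
    refine (rpow_le_one_add_sq (norm_nonneg _) hγ).trans ?_
    rw [norm_sub_sq_real]
    have h := norm_add_sq_real p q
    have := sq_nonneg ‖p + q‖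
    linarith

lemma lintegral_enorm_rpow_eq {μ : Measure (Space d)} {β : ℝ} (hβ : 0 ≤ β) :
    moment β μ = ∫⁻ p, ENNReal.ofReal (‖p‖ ^ β) ∂μ := by
  unfold moment
  congr 1 with p
  rw [← ofReal_norm, ENNReal.ofReal_rpow_of_nonneg (norm_nonneg p) hβ]

lemma moment_eq_ofReal {μ : Measure (Space d)} {β : ℝ} (hβ : 0 ≤ β)
    (h : Integrable (fun p => ‖p‖ ^ β) μ) :
    moment β μ = ENNReal.ofReal (∫ p, ‖p‖ ^ β ∂μ) := by
  rw [lintegral_enorm_rpow_eq hβ,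
    ofReal_integral_eq_lintegral_ofReal h (ae_of_all _ fun p => by positivity)]

lemma weightedMass_eq {μ : Measure (Space d)} (k : ℕ) :
    weightedMass (2 * ((k + 2 : ℕ) : ℝ)) μ = ∫⁻ p, ENNReal.ofReal (highWt k p) ∂μ := by
  unfold weightedMass highWt
  congr 1 with p
  have h0 : (0 : ℝ) ≤ 2 * ((k + 2 : ℕ) : ℝ) := by positivity
  rw [← ofReal_norm, ENNReal.ofReal_rpow_of_nonneg (norm_nonneg p) h0,
    ENNReal.ofReal_add zero_le_one (by positivity), ENNReal.ofReal_one, ← pow_mul,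
    ← Real.rpow_natCast ‖p‖]
  push_cast
  rfl

lemma integrable_highWt_of_weightedMass {μ : Measure (Space d)} {k : ℕ}
    (h : weightedMass (2 * ((k + 2 : ℕ) : ℝ)) μ < ⊤) : Integrable (highWt k) μ := by
  rw [weightedMass_eq] at h
  refine ⟨(measurable_highWt k).aestronglyMeasurable, ?_⟩
  rwa [hasFiniteIntegral_iff_ofReal (ae_of_all _ fun p => (highWt_pos k p).le)]

lemma weightedMass_eq_ofReal {μ : Measure (Space d)} {k : ℕ} (h : Integrable (highWt k) μ) :
    weightedMass (2 * ((k + 2 : ℕ) : ℝ)) μ = ENNReal.ofReal (∫ p, highWt k p ∂μ) := by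
  rw [weightedMass_eq,
    ofReal_integral_eq_lintegral_ofReal h (ae_of_all _ fun p => (highWt_pos k p).le)]

/-! ### The collision operator in weak form -/

lemma IsRate.integrable_mul {a : Space d → Space d → ℝ} (ha : IsRate a) {D C : ℝ}
    {μ : Measure (Space d)} (hμ : MomentBound D μ) {φ : Space d × Space d → ℝ} (hφm : Measurable φ)
    (hφ : ∀ x, |φ x| ≤ C) : Integrable (fun x => a x.1 x.2 * φ x) (μ.prod μ) := by
  refine hμ.integrable_prod_of_le hμ (ha.meas.mul hφm) (C := 2 * C) fun x => ha.abs_mul_le ?_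
  exact (hφ x).trans (le_mul_of_one_le_right ((abs_nonneg _).trans (hφ x))
    (one_le_mul_of_one_le_of_one_le (one_le_wt _) (one_le_wt _)))

lemma IsRate.integral_gain {a : Space d → Space d → ℝ} (ha : IsRate a) {μ : Measure (Space d)}
    {φ : Space d → ℝ} (hφm : Measurable φ) :
    ∫ p, φ p ∂(gain a μ) = 2⁻¹ * ∫ x, a x.1 x.2 * φ (x.1 + x.2) ∂(μ.prod μ) := by
  unfold gain
  rw [integral_smul_measure, integral_map (by fun_prop) hφm.aestronglyMeasurable,
    integral_withDensity_eq_integral_toReal_smul ha.meas.ennreal_ofReal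
      (ae_of_all _ fun _ => ENNReal.ofReal_lt_top), ENNReal.toReal_inv, ENNReal.toReal_ofNat,
    smul_eq_mul]
  congr 2 with x
  rw [ENNReal.toReal_ofReal (ha.nonneg _ _), smul_eq_mul]

lemma IsRate.integral_loss {a : Space d → Space d → ℝ} (ha : IsRate a) {D C : ℝ}
    {μ : Measure (Space d)} (hμ : MomentBound D μ) {φ : Space d → ℝ} (hφm : Measurable φ)
    (hφ : ∀ p, |φ p| ≤ C) :
    ∫ p, φ p ∂(loss a μ) = ∫ x, a x.1 x.2 * φ x.1 ∂(μ.prod μ) := by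
  have := hμ.isFiniteMeasure
  have hap : ∀ p, Integrable (fun q => a p q) μ := fun p =>
    (hμ.integrable_wt.const_mul (2 * wt p)).mono'
      (ha.meas.comp measurable_prodMk_left).aestronglyMeasurable (ae_of_all _ fun q => by
        rw [Real.norm_of_nonneg (ha.nonneg p q)]; exact ha.le_wt p q)
  have hl : ∀ p, ∫⁻ q, ENNReal.ofReal (a p q) ∂μ = ENNReal.ofReal (∫ q, a p q ∂μ) := fun p =>
    (ofReal_integral_eq_lintegral_ofReal (hap p) (ae_of_all _ (ha.nonneg p))).symm
  have i1 : Integrable (fun x : Space d × Space d => a x.1 x.2 * φ x.1) (μ.prod μ) :=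
    ha.integrable_mul hμ (hφm.comp measurable_fst) fun x => hφ x.1
  unfold loss
  rw [integral_withDensity_eq_integral_toReal_smul
      (Measurable.lintegral_prod_right' (f := fun x => ENNReal.ofReal (a x.1 x.2))
        ha.meas.ennreal_ofReal)
      (ae_of_all _ fun p => by rw [hl]; exact ENNReal.ofReal_lt_top),
    integral_prod _ i1]
  congr 1 with p
  rw [hl, ENNReal.toReal_ofReal (integral_nonneg (ha.nonneg p)), smul_eq_mul]
  exact (integral_mul_const _ _).symm

lemma IsRate.integral_gain_sub_loss {a : Space d → Space d → ℝ} (ha : IsRate a) {D C : ℝ}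
    {μ : Measure (Space d)} (hμ : MomentBound D μ) {φ : Space d → ℝ} (hφm : Measurable φ)
    (hφ : ∀ p, |φ p| ≤ C) :
    ∫ p, φ p ∂(gain a μ) - ∫ p, φ p ∂(loss a μ) = coll a φ μ := by
  have := hμ.isFiniteMeasure
  have i0 : Integrable (fun x : Space d × Space d => a x.1 x.2 * φ (x.1 + x.2)) (μ.prod μ) :=
    ha.integrable_mul hμ (hφm.comp (measurable_fst.add measurable_snd)) fun x => hφ (x.1 + x.2)
  have i1 : Integrable (fun x : Space d × Space d => a x.1 x.2 * φ x.1) (μ.prod μ) :=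
    ha.integrable_mul hμ (hφm.comp measurable_fst) fun x => hφ x.1
  have i2 : Integrable (fun x : Space d × Space d => a x.1 x.2 * φ x.2) (μ.prod μ) :=
    ha.integrable_mul hμ (hφm.comp measurable_snd) fun x => hφ x.2
  have hs : ∫ x, a x.1 x.2 * φ x.2 ∂(μ.prod μ) = ∫ x, a x.1 x.2 * φ x.1 ∂(μ.prod μ) := by
    rw [← integral_prod_swap (fun x : Space d × Space d => a x.1 x.2 * φ x.2)]
    congr 1 with x
    rw [Prod.fst_swap, Prod.snd_swap, ha.symm]
  have hc : coll a φ μ = 2⁻¹ * (∫ x, a x.1 x.2 * φ (x.1 + x.2) ∂(μ.prod μ) -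
      ∫ x, a x.1 x.2 * φ x.1 ∂(μ.prod μ) - ∫ x, a x.1 x.2 * φ x.2 ∂(μ.prod μ)) := by
    have i3 : Integrable (fun x : Space d × Space d =>
      a x.1 x.2 * φ (x.1 + x.2) - a x.1 x.2 * φ x.1) (μ.prod μ) := i0.sub i1
    rw [← integral_sub i0 i1, ← integral_sub i3 i2]
    unfold coll defect
    congr 2 with x
    ring
  rw [ha.integral_gain hφm, ha.integral_loss hμ hφm hφ, hc, hs]
  ring

/-! ### Uniqueness of strong solutions -/

lemma IsStrongSolution.unique {a : Space d → Space d → ℝ} (ha : IsRate a) {T D D' : ℝ}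
    {f g : Kernel ℝ (Space d)} (hf : IsStrongSolution a T D f) (hg : IsStrongSolution a T D' g)
    (h0 : f 0 = g 0) {t : ℝ} (ht : t ∈ Icc 0 T) : f t = g t := by
  have := (hf.moment t).isFiniteMeasure
  have := (hg.moment t).isFiniteMeasure
  have hD := (hf.moment 0).nonneg
  have hD' := (hg.moment 0).nonneg
  have hf' : IsStrongSolution a T (D + D' + 1) f :=
    ⟨hf.even, fun t => (hf.moment t).mono (by linarith), hf.equation⟩
  have hg' : IsStrongSolution a T (D + D' + 1) g :=
    ⟨hg.even, fun t => (hg.moment t).mono (by linarith), hg.equation⟩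
  ext S hS
  have h := hf'.stability ha ha (by positivity) hg' (e := 0) (N₀ := 0)
    (fun s _ => by simp) (fun ψ _ _ => by simp [h0]) ht (ψ := S.indicator 1)
    (measurable_one.indicator hS) fun p => by
      refine le_trans ?_ (one_le_wt p)
      by_cases hp : p ∈ S <;> simp [hp]
  rw [integral_indicator_one hS, integral_indicator_one hS] at h
  have h' : |(f t).real S - (g t).real S| ≤ 0 := h.trans (by simp)
  exact (measureReal_eq_measureReal_iff).1 (sub_eq_zero.1 (abs_nonpos_iff.1 h'))

/-! ### Strong solutions are solutions in the sense of distributions -/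

lemma isEvenSolution_of_isStrongSolution {γ : ℝ} (hγ : γ ∈ Icc (0 : ℝ) 2) {k : ℕ}
    {fin : FiniteMeasure (Space d)} {F : Kernel ℝ (Space d)} (h0 : F 0 = fin) {T : ℝ}
    (hT : 0 < T) {E : ℝ} (hF : IsStrongSolution (kernel γ) T E (clampKernel T F))
    (hk : ∀ t ∈ Icc 0 T, Integrable (highWt k) (F t) ∧ ∫ p, highWt k p ∂(F t) ≤ E)
    {f : ℝ → FiniteMeasure (Space d)} (hf : ∀ t, 0 ≤ t → (f t : Measure (Space d)) = F t) :
    IsEvenSolution γ (k + 2) fin T f := by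
  have hker := isRate_kernel (d := d) hγ
  have hfc : ∀ t ∈ Icc 0 T, (f t : Measure (Space d)) = clampKernel T F t := fun t ht => by
    rw [clampKernel_apply, clamp_of_mem ht, hf t ht.1]
  have hsub : Ico 0 T ⊆ Icc 0 T := Ico_subset_Icc_self
  have hbd : ∀ {φ : Space d → ℝ} {C : ℝ}, (∀ p, |φ p| ≤ C) → ∀ p, |φ p| ≤ C * wt p :=
    fun {φ C} h p => (h p).trans
      (le_mul_of_one_le_right ((abs_nonneg _).trans (h p)) (one_le_wt p))
  refine ⟨?_, fun t ht => ?_, fun t ht => ?_, ⟨E.toNNReal, ?_⟩, fun φ hφ hφc t ht => ?_⟩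
  · exact Subtype.ext ((hf 0 le_rfl).trans h0)
  · rw [hfc t (hsub ht)]
    exact hF.even t
  · rw [ContinuousWithinAt, FiniteMeasure.tendsto_iff_forall_integral_tendsto]
    intro φ
    have hφ : ∀ p, |φ p| ≤ ‖φ‖ := fun p => φ.norm_coe_le_norm p
    rw [tendsto_iff_norm_sub_tendsto_zero]
    refine squeeze_zero' (g := fun s => 4 * ‖φ‖ * E ^ 2 * |s - t|)
      (Eventually.of_forall fun _ => norm_nonneg _) ?_ ?_
    · filter_upwards [self_mem_nhdsWithin] with s hs
      rw [hfc t (hsub ht), hfc s (hsub hs)]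
      exact hF.abs_integral_sub_le hker φ.continuous.measurable (norm_nonneg φ) (hbd hφ)
        (hsub ht) (hsub hs)
    · have : Continuous fun s => 4 * ‖φ‖ * E ^ 2 * |s - t| := by fun_prop
      simpa using (this.tendsto t).mono_left nhdsWithin_le_nhds
  · filter_upwards [ae_restrict_mem measurableSet_Ioo] with t ht
    have := hk t (Ioo_subset_Icc_self ht)
    rw [hf t ht.1.le, weightedMass_eq_ofReal this.1]
    exact ENNReal.ofReal_le_ofReal this.2
  · obtain ⟨C, hC⟩ := hφc.exists_bound_of_continuous hφ.continuous
    have h := hF.equation φ hφ.continuous.measurable ⟨C, hbd hC⟩ t (hsub ht)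
    rw [← hfc t (hsub ht), ← hfc 0 ⟨le_rfl, hT.le⟩, hf 0 le_rfl, h0] at h
    rw [h]
    congr 1
    refine intervalIntegral.integral_congr fun s hs => ?_
    rw [uIcc_of_le ht.1] at hs
    have hs' : s ∈ Icc 0 T := ⟨hs.1, hs.2.trans ht.2.le⟩
    rw [hfc s hs', hker.integral_gain_sub_loss (hF.moment s) hφ.continuous.measurable hC]

/-! ### Extension of the class of test functions -/

/-- The equation at time `t`, tested against `φ`. -/
def TestEquation (a : Space d → Space d → ℝ) (f : Kernel ℝ (Space d)) (t : ℝ)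
    (φ : Space d → ℝ) : Prop :=
  ∫ p, φ p ∂(f t) = ∫ p, φ p ∂(f 0) + ∫ s in (0 : ℝ)..t, coll a φ (f s)

lemma TestEquation.add_smul {a : Space d → Space d → ℝ} (ha : IsRate a) {D : ℝ}
    {f : Kernel ℝ (Space d)} (h : ∀ t, MomentBound D (f t)) {t : ℝ} {φ ψ : Space d → ℝ}
    (hφm : Measurable φ) (hψm : Measurable ψ) {C : ℝ} (hC : 0 ≤ C) (hφ : ∀ p, |φ p| ≤ C * wt p)
    (hψ : ∀ p, |ψ p| ≤ C * wt p) (h1 : TestEquation a f t φ) (h2 : TestEquation a f t ψ) (c : ℝ) :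
    TestEquation a f t (fun p => φ p + c * ψ p) := by
  have hi : ∀ s, ∫ p, (φ p + c * ψ p) ∂(f s) = ∫ p, φ p ∂(f s) + c * ∫ p, ψ p ∂(f s) := fun s => by
    rw [integral_add ((h s).integrable_of_le hφm hφ)
      (((h s).integrable_of_le hψm hψ).const_mul c), integral_const_mul]
  have hc : ∀ s, coll a (fun p => φ p + c * ψ p) (f s) = coll a φ (f s) + c * coll a ψ (f s) := by
    intro s
    have i1 := ha.integrable_mul_defect hφm hφ (h s) (h s)
    have i2 := ha.integrable_mul_defect hψm hψ (h s) (h s)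
    unfold coll
    rw [mul_left_comm c, ← mul_add, ← integral_const_mul c, ← integral_add i1 (i2.const_mul c)]
    congr 2 with x
    unfold defect
    ring
  unfold TestEquation at *
  simp_rw [hi, hc]
  rw [intervalIntegral.integral_add (intervalIntegrable_coll ha hφm hC hφ h 0 t)
    ((intervalIntegrable_coll ha hψm hC hψ h 0 t).const_mul c),
    intervalIntegral.integral_const_mul, h1, h2]
  ring

/-- An open set is the support of a smooth `f ≥ 0`. A smooth step applied to `n f` tends to the
indicator, and a second one applied to `n - |p|²` makes the support compact. -/
lemma exists_contDiff_tendsto_indicator {U : Set (Space d)} (hU : IsOpen U) :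
    ∃ ψ : ℕ → Space d → ℝ, (∀ n, ContDiff ℝ ∞ (ψ n)) ∧ (∀ n, HasCompactSupport (ψ n)) ∧
      (∀ n p, |ψ n p| ≤ 1) ∧
      ∀ p, Tendsto (fun n => ψ n p) atTop (𝓝 (U.indicator 1 p)) := by
  obtain ⟨f, hfs, hf, hf1⟩ := hU.exists_contDiff_support_eq (n := ⊤)
  have hst : ContDiff ℝ ∞ Real.smoothTransition := Real.smoothTransition.contDiff
  refine ⟨fun n p => Real.smoothTransition (n * f p) * Real.smoothTransition (n - ‖p‖ ^ 2),
    fun n => ?_, fun n => ?_, fun n p => ?_, fun p => ?_⟩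
  · exact (hst.comp (contDiff_const.mul hf)).mul
      (hst.comp (contDiff_const.sub (contDiff_norm_sq ℝ)))
  · refine HasCompactSupport.intro (isCompact_closedBall (0 : Space d) n) fun p hp => ?_
    have hp' : (n : ℝ) < ‖p‖ := by simpa using hp
    refine mul_eq_zero_of_right _ (Real.smoothTransition.zero_of_nonpos ?_)
    have h0 : (0 : ℝ) ≤ n := Nat.cast_nonneg n
    rcases Nat.eq_zero_or_pos n with rfl | hn
    · simp
    · have : (1 : ℝ) ≤ n := by exact_mod_cast hn
      nlinarith
  · rw [abs_of_nonneg (mul_nonneg (Real.smoothTransition.nonneg _)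
      (Real.smoothTransition.nonneg _))]
    exact mul_le_one₀ (Real.smoothTransition.le_one _) (Real.smoothTransition.nonneg _)
      (Real.smoothTransition.le_one _)
  · by_cases hp : p ∈ U
    · have hp0 : 0 < f p := by
        have h1 : f p ≠ 0 := by rwa [← hfs] at hp
        exact lt_of_le_of_ne (hf1 (mem_range_self p)).1 h1.symm
      rw [indicator_of_mem hp, Pi.one_apply]
      obtain ⟨m, hm⟩ := exists_nat_ge (max (f p)⁻¹ (1 + ‖p‖ ^ 2))
      refine tendsto_const_nhds.congr' ?_
      filter_upwards [eventually_ge_atTop m] with n hn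
      have hn' : (m : ℝ) ≤ n := by exact_mod_cast hn
      rw [Real.smoothTransition.one_of_one_le, Real.smoothTransition.one_of_one_le, mul_one]
      · linarith [le_max_right (f p)⁻¹ (1 + ‖p‖ ^ 2)]
      · have h2 := ((le_max_left (f p)⁻¹ (1 + ‖p‖ ^ 2)).trans hm).trans hn'
        rw [inv_le_iff_one_le_mul₀ hp0] at h2
        exact h2
    · have hp0 : f p = 0 := by rwa [← hfs, Function.notMem_support] at hp
      rw [indicator_of_notMem hp]
      simp [hp0]

/-- The equation is linear in the test function and stable under dominated limits. Sets whose
indicator satisfies it thus form a Dynkin class containing the open sets, hence all Borel sets;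
simple functions and bounded limits follow. -/
lemma testEquation_of_contDiff {a : Space d → Space d → ℝ} (ha : IsRate a) {D : ℝ}
    {f : Kernel ℝ (Space d)} (h : ∀ t, MomentBound D (f t)) {t : ℝ}
    (heq : ∀ φ : Space d → ℝ, ContDiff ℝ ∞ φ → HasCompactSupport φ → TestEquation a f t φ)
    {φ : Space d → ℝ} (hφm : Measurable φ) {C : ℝ} (hφ : ∀ p, |φ p| ≤ C) :
    TestEquation a f t φ := by
  have hbd : ∀ {φ : Space d → ℝ} {C : ℝ}, (∀ p, |φ p| ≤ C) → ∀ p, |φ p| ≤ C * wt p :=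
    fun {φ C} h p => (h p).trans
      (le_mul_of_one_le_right ((abs_nonneg _).trans (h p)) (one_le_wt p))
  have hind : ∀ (S : Set (Space d)) p, |S.indicator (1 : Space d → ℝ) p| ≤ 1 := fun S p => by
    by_cases hp : p ∈ S <;> simp [hp]
  have hzero : TestEquation a f t fun _ => 0 := by
    unfold TestEquation coll defect; simp
  have hopen : ∀ U : Set (Space d), IsOpen U → TestEquation a f t (U.indicator 1) := by
    intro U hU
    obtain ⟨ψ, hψ, hψc, hψ1, hlim⟩ := exists_contDiff_tendsto_indicator hU
    exact equation_of_tendsto ha h (fun n => (hψ n).continuous.measurable) zero_le_one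
      (fun n => hbd (hψ1 n)) hlim fun n => heq _ (hψ n) (hψc n)
  have hset : ∀ S : Set (Space d), MeasurableSet S → TestEquation a f t (S.indicator 1) := by
    intro S hS
    induction S, hS using MeasurableSpace.induction_on_inter
      (s := {S : Set (Space d) | IsOpen S}) BorelSpace.measurable_eq isPiSystem_isOpen with
    | empty => rw [indicator_empty]; exact hzero
    | basic U hU => exact hopen U hU
    | compl S hS ih =>
      have := TestEquation.add_smul ha h (measurable_one.indicator .univ)
        (measurable_one.indicator hS) zero_le_one (hbd (hind univ)) (hbd (hind S))
        (hopen univ isOpen_univ) ih (-1)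
      convert this using 1
      ext p
      by_cases hp : p ∈ S <;> simp [hp]
    | iUnion S hdis hS ih =>
      have hfin : ∀ n, TestEquation a f t ((⋃ i ∈ Finset.range n, S i).indicator 1) := by
        intro n
        induction n with
        | zero => simp only [Finset.range_zero, Finset.notMem_empty, iUnion_of_empty, iUnion_empty,
            indicator_empty]; exact hzero
        | succ n ihn =>
          have := TestEquation.add_smul ha h
            (measurable_one.indicator (Finset.measurableSet_biUnion (Finset.range n) fun i _ => hS i))
            (measurable_one.indicator (hS n)) zero_le_one (hbd (hind _)) (hbd (hind _)) ihn (ih n) 1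
          convert this using 1
          rw [Finset.range_add_one, Finset.set_biUnion_insert, union_comm, indicator_union_of_disjoint]
          · simp
          · exact disjoint_iUnion₂_left.2 fun i hi =>
              hdis (Finset.mem_range.1 hi).ne
      refine equation_of_tendsto ha h (fun n => measurable_one.indicator
        (Finset.measurableSet_biUnion (Finset.range n) fun i _ => hS i)) zero_le_one
        (fun n => hbd (hind _)) (fun p => ?_) hfin
      by_cases hp : p ∈ ⋃ i, S i
      · obtain ⟨i, hi⟩ := mem_iUnion.1 hp
        refine tendsto_const_nhds.congr' ?_
        filter_upwards [eventually_gt_atTop i] with n hn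
        rw [indicator_of_mem hp, indicator_of_mem]
        exact mem_biUnion (Finset.mem_coe.2 (Finset.mem_range.2 hn)) hi
      · refine tendsto_const_nhds.congr fun n => ?_
        rw [indicator_of_notMem hp, indicator_of_notMem]
        exact fun h => hp (iUnion₂_subset_iUnion _ _ h)
  have hsimple : ∀ φ : SimpleFunc (Space d) ℝ, TestEquation a f t φ := by
    intro φ
    induction φ using SimpleFunc.induction with
    | @const c S hS =>
      have := TestEquation.add_smul ha h measurable_const (measurable_one.indicator hS) zero_le_one
        (hbd (C := 1) fun _ => by simp) (hbd (hind _)) hzero (hset _ hS) c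
      convert this using 1
      ext p
      by_cases hp : p ∈ S <;> simp [hp]
    | @add φ ψ _ h1 h2 =>
      obtain ⟨C, hC⟩ := φ.exists_forall_norm_le
      obtain ⟨C', hC'⟩ := ψ.exists_forall_norm_le
      have := TestEquation.add_smul ha h φ.measurable ψ.measurable (C := max 0 (max C C'))
        (le_max_left _ _)
        (hbd fun p => (hC p).trans ((le_max_left _ _).trans (le_max_right _ _)))
        (hbd fun p => (hC' p).trans ((le_max_right _ _).trans (le_max_right _ _))) h1 h2 1
      simp only [one_mul] at this
      exact this
  have hC : 0 ≤ C := (abs_nonneg _).trans (hφ 0)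
  have hs := hφm.stronglyMeasurable
  exact equation_of_tendsto ha h (fun n => (hs.approxBounded C n).measurable) hC
    (fun n => hbd (hs.norm_approxBounded_le hC n))
    (fun p => hs.tendsto_approxBounded_of_norm_le (hφ p)) fun n => hsimple _

/-! ### Solutions in the sense of distributions are strong solutions -/

/-- The mass of a closed set is the limit of integrals of thickened indicators, each continuous in
time, and closed sets form a generating π-system. -/
lemma measurable_toMeasure_of_continuous {h : ℝ → FiniteMeasure (Space d)} (hc : Continuous h) :
    Measurable fun t => (h t : Measure (Space d)) := by
  have hclosed : ∀ S : Set (Space d), IsClosed S →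
      Measurable fun t => (h t : Measure (Space d)) S := by
    intro S hS
    refine measurable_of_tendsto_metrizable (f := fun (n : ℕ) t => ∫⁻ p,
      (thickenedIndicator (Nat.one_div_pos_of_nat (α := ℝ) (n := n)) S p : ℝ≥0∞)
        ∂(h t : Measure (Space d))) (fun n => ?_) (tendsto_pi_nhds.2 fun t => ?_)
    · refine Continuous.measurable (continuous_iff_continuousAt.2 fun t => ?_)
      exact FiniteMeasure.tendsto_iff_forall_lintegral_tendsto.1 (hc.tendsto t) _
    · exact tendsto_lintegral_thickenedIndicator_of_isClosed _ hS _
        tendsto_one_div_add_atTop_nhds_zero_nat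
  exact Measurable.measure_of_isPiSystem
    (BorelSpace.measurable_eq.trans (borel_eq_generateFrom_isClosed (α := Space d)))
    isPiSystem_isClosed (fun S hS => hclosed S hS) (hclosed _ isClosed_univ)

/-- The moment bound is given for almost every time only. The integral of the bounded continuous
function `min (highWt k) n` is continuous in time, so exceeding the bound at one time would mean
exceeding it on a set that meets the full-measure set of good times. -/
lemma IsEvenSolution.exists_integral_highWt_le {γ T : ℝ} {k : ℕ} {fin : FiniteMeasure (Space d)}
    {g : ℝ → FiniteMeasure (Space d)} (hT : 0 < T) (hg : IsEvenSolution γ (k + 2) fin T g) :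
    ∃ C : ℝ, ∀ t ∈ Ico 0 T, Integrable (highWt k) (g t : Measure (Space d)) ∧
      ∫ p, highWt k p ∂(g t : Measure (Space d)) ≤ C := by
  obtain ⟨C, hC⟩ := hg.bounded
  refine ⟨C, fun t ht => ?_⟩
  refine integrable_of_integral_min_le (measurable_highWt k) (fun p => (highWt_pos k p).le)
    fun n => ?_
  by_contra! hlt
  have hnn : ∀ p : Space d, 0 ≤ min (highWt k p) (n : ℝ) := fun p =>
    le_min (highWt_pos k p).le (Nat.cast_nonneg n)
  let φ : BoundedContinuousFunction (Space d) ℝ := BoundedContinuousFunction.ofNormedAddCommGroup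
    (fun p => min (highWt k p) n) ((continuous_highWt k).min continuous_const) n
    fun p => by rw [Real.norm_of_nonneg (hnn p)]; exact min_le_right _ _
  have hcont := FiniteMeasure.tendsto_iff_forall_integral_tendsto.1 (hg.weak_continuous t ht) φ
  have hev := hcont.eventually_const_lt (show (C : ℝ) < _ from hlt)
  obtain ⟨U, hU, htU, hsub⟩ := mem_nhdsWithin.1 hev
  rw [ae_restrict_iff' measurableSet_Ioo] at hC
  have hne : (U ∩ Ioo 0 T).Nonempty := by
    refine mem_closure_iff.1 ?_ U hU htU
    rw [closure_Ioo hT.ne]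
    exact Ico_subset_Icc_self ht
  obtain ⟨s, ⟨hsU, hsT⟩, hs⟩ := (Measure.dense_of_ae hC).inter_open_nonempty _
    (hU.inter isOpen_Ioo) hne
  have hs' := hs hsT
  have h1 : (C : ℝ) < ∫ p, min (highWt k p) n ∂(g s : Measure (Space d)) :=
    hsub ⟨hsU, Ioo_subset_Ico_self hsT⟩
  have hi : Integrable (highWt k) (g s : Measure (Space d)) :=
    integrable_highWt_of_weightedMass (hs'.trans_lt ENNReal.coe_lt_top)
  rw [weightedMass_eq_ofReal hi, ENNReal.ofReal_le_coe] at hs'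
  have h3 := integral_mono_of_nonneg (ae_of_all _ hnn) hi
    (ae_of_all (g s : Measure (Space d)) fun p => min_le_left (highWt k p) (n : ℝ))
  linarith

/-- Stopping at `T' < T` keeps the frozen path inside `[0, T)`, where weak continuity is available;
the path is then continuous on the whole line and defines a kernel. -/
lemma IsEvenSolution.exists_isStrongSolution {γ T T' : ℝ} (hγ : γ ∈ Icc (0 : ℝ) 2) {k : ℕ}
    {fin : FiniteMeasure (Space d)} {g : ℝ → FiniteMeasure (Space d)}
    (hg : IsEvenSolution γ (k + 2) fin T g) (hT' : 0 ≤ T') (hT : T' < T) :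
    ∃ (D : ℝ) (G : Kernel ℝ (Space d)), IsStrongSolution (kernel γ) T' D G ∧
      ∀ t ∈ Icc 0 T', G t = (g t : Measure (Space d)) := by
  have hker := isRate_kernel (d := d) hγ
  obtain ⟨C, hC⟩ := hg.exists_integral_highWt_le (hT'.trans_lt hT)
  have hmem : ∀ t, clamp T' t ∈ Ico 0 T := fun t =>
    ⟨(clamp_mem hT' t).1, (clamp_mem hT' t).2.trans_lt hT⟩
  have hcl : Continuous (clamp T') := by unfold clamp; fun_prop
  have hcont : Continuous fun t => g (clamp T' t) :=
    hg.weak_continuous.comp_continuous hcl hmem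
  let G : Kernel ℝ (Space d) :=
    ⟨fun t => (g (clamp T' t) : Measure (Space d)), measurable_toMeasure_of_continuous hcont⟩
  have hG : ∀ t ∈ Icc 0 T', G t = (g t : Measure (Space d)) := fun t ht => by
    change (g (clamp T' t) : Measure (Space d)) = _
    rw [clamp_of_mem ht]
  have hmom : ∀ t, MomentBound (4 * C) (G t) := fun t =>
    momentBound_of_highWt (hC _ (hmem t)).1 (hC _ (hmem t)).2
  refine ⟨4 * C, G, IsStrongSolution.of_bounded hker (fun t => hg.even _ (hmem t)) hmom
    fun φ hφm ⟨B, hφ⟩ t ht => ?_, hG⟩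
  refine testEquation_of_contDiff hker hmom (fun ψ hψ hψc => ?_) hφm hφ
  obtain ⟨B, hB⟩ := hψc.exists_bound_of_continuous hψ.continuous
  have h := hg.equation ψ hψ hψc t ⟨ht.1, ht.2.trans_lt hT⟩
  rw [← hg.initial, ← hG t ht, ← hG 0 ⟨le_rfl, hT'⟩] at h
  unfold TestEquation
  rw [h]
  congr 1
  refine intervalIntegral.integral_congr fun s hs => ?_
  rw [uIcc_of_le ht.1] at hs
  rw [← hG s ⟨hs.1, hs.2.trans ht.2⟩,
    hker.integral_gain_sub_loss (hmom s) hψ.continuous.measurable hB]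

/-- Uniqueness. -/
lemma IsEvenSolution.eq_of_isStrongSolution {γ T : ℝ} (hγ : γ ∈ Icc (0 : ℝ) 2) {k : ℕ}
    {fin : FiniteMeasure (Space d)} {g : ℝ → FiniteMeasure (Space d)}
    (hg : IsEvenSolution γ (k + 2) fin T g) {t E : ℝ} (ht : t ∈ Ico 0 T) {F : Kernel ℝ (Space d)}
    (h0 : F 0 = fin) (hF : IsStrongSolution (kernel γ) t E (clampKernel t F)) :
    (g t : Measure (Space d)) = F t := by
  obtain ⟨D, G, hGs, hG⟩ := hg.exists_isStrongSolution hγ ht.1 ht.2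
  have htt : t ∈ Icc 0 t := ⟨ht.1, le_rfl⟩
  have := hGs.unique (isRate_kernel hγ) hF (by
    rw [hG 0 ⟨le_rfl, ht.1⟩, clampKernel_apply, clamp_of_mem ⟨le_rfl, ht.1⟩, h0, hg.initial]) htt
  rw [hG t htt, clampKernel_apply, clamp_of_mem htt] at this
  exact this

/-! ### Production of moments of low order -/

/-- Strict subadditivity with `x = B / A ≤ 1`: Bernoulli gives `(1 + x)^θ ≤ 1 + θ x`, and `x ≤ x^θ`.
-/
lemma add_rpow_sub_le {A B θ : ℝ} (hA : 0 ≤ A) (hB : 0 ≤ B) (hBA : B ≤ A) (hθ0 : 0 ≤ θ)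
    (hθ1 : θ ≤ 1) : (A + B) ^ θ - A ^ θ - B ^ θ ≤ -((1 - θ) * B ^ θ) := by
  have hBθ : 0 ≤ B ^ θ := Real.rpow_nonneg hB θ
  rcases hA.eq_or_lt with rfl | hA'
  · have : B = 0 := le_antisymm hBA hB
    subst this
    rw [add_zero]
    nlinarith
  · have h1 : (A + B) ^ θ = A ^ θ * (1 + B / A) ^ θ := by
      rw [← Real.mul_rpow hA (by positivity)]
      congr 1
      field_simp
    have hx0 : 0 ≤ B / A := by positivity
    have hx1 : B / A ≤ 1 := (div_le_one hA').2 hBA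
    have h2 : (1 + B / A) ^ θ ≤ 1 + θ * (B / A) :=
      _root_.rpow_one_add_le_one_add_mul_self (by linarith) hθ0 hθ1
    have h3 : B / A ≤ (B / A) ^ θ := by
      rcases hx0.eq_or_lt with h | h
      · rw [← h]; positivity
      · simpa using Real.rpow_le_rpow_of_exponent_ge h hx1 hθ1
    have h4 : A ^ θ * (B / A) ^ θ = B ^ θ := by
      rw [← Real.mul_rpow hA hx0, mul_div_cancel₀ _ hA'.ne']
    have hAθ : 0 ≤ A ^ θ := Real.rpow_nonneg hA θ
    have h5 := mul_le_mul_of_nonneg_left h2 hAθ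
    have h6 := mul_le_mul_of_nonneg_left (mul_le_mul_of_nonneg_left h3 hθ0) hAθ
    rw [h1]
    nlinarith

lemma abs_rpow_sub_rpow_le {A B θ : ℝ} (hA : 0 ≤ A) (hB : 0 ≤ B) (hθ0 : 0 ≤ θ) (hθ1 : θ ≤ 1) :
    |A ^ θ - B ^ θ| ≤ |A - B| ^ θ := by
  wlog h : B ≤ A generalizing A B
  · rw [abs_sub_comm, abs_sub_comm A]
    exact this hB hA (le_of_not_ge h)
  rw [abs_of_nonneg (sub_nonneg.2 (Real.rpow_le_rpow hB h hθ0)), abs_of_nonneg (sub_nonneg.2 h),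
    sub_le_iff_le_add]
  have := Real.rpow_add_le_add_rpow (sub_nonneg.2 h) hB hθ0 hθ1
  rwa [sub_add_cancel] at this

section Pointwise

variable {A B u v θ : ℝ}

lemma rpow_add_rpow_le (hu : 0 ≤ u) (hv : 0 ≤ v) (huv : u + v = 2 * (A + B)) (hθ0 : 0 ≤ θ)
    (hθ1 : θ ≤ 1) : u ^ θ + v ^ θ ≤ 2 * (A + B) ^ θ := by
  have := (Real.concaveOn_rpow hθ0 hθ1).2 (mem_Ici.2 hu) (mem_Ici.2 hv)
    (by norm_num : (0 : ℝ) ≤ 1 / 2) (by norm_num : (0 : ℝ) ≤ 1 / 2) (by norm_num)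
  simp only [smul_eq_mul] at this
  have h : 1 / 2 * u + 1 / 2 * v = A + B := by linarith
  rw [h] at this
  linarith

/-- The variables stand for `A = |p|²`, `B = |q|²`, `u = |p+q|²`, `v = |p-q|²`, `θ = γ/2`. With `U =
u^θ`, `V = v^θ`, the inequality `2UV ≤ (U+V)²/2` bounds the left side by `(U+V)((U+V)/2 - A^θ -
B^θ)`. By concavity and `add_rpow_sub_le` the second factor is at most `-(1-θ) B^θ`, while `U + V ≥
A^θ` for the larger `A`. -/
lemma production_le (hA : 0 ≤ A) (hB : 0 ≤ B) (hu : 0 ≤ u) (hv : 0 ≤ v)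
    (huv : u + v = 2 * (A + B)) (hθ0 : 0 ≤ θ) (hθ1 : θ ≤ 1) :
    2 * (u ^ θ * v ^ θ) - (u ^ θ + v ^ θ) * (A ^ θ + B ^ θ) ≤ -((1 - θ) * (A ^ θ * B ^ θ)) := by
  wlog h : B ≤ A generalizing A B
  · have := this hB hA (by rw [huv, add_comm A]) (le_of_not_ge h)
    rwa [add_comm (B ^ θ), mul_comm (B ^ θ)] at this
  have h1 := rpow_add_rpow_le hu hv huv hθ0 hθ1
  have h2 := add_rpow_sub_le hA hB h hθ0 hθ1
  have h3 : A ^ θ ≤ u ^ θ + v ^ θ := by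
    refine (Real.rpow_le_rpow hA ?_ hθ0).trans (Real.rpow_add_le_add_rpow hu hv hθ0 hθ1)
    linarith
  have hU := Real.rpow_nonneg hu θ
  have hV := Real.rpow_nonneg hv θ
  have hB' := Real.rpow_nonneg hB θ
  have h4 : (u ^ θ + v ^ θ) * ((u ^ θ + v ^ θ) / 2 - A ^ θ - B ^ θ) ≤
      (u ^ θ + v ^ θ) * -((1 - θ) * B ^ θ) :=
    mul_le_mul_of_nonneg_left (by linarith) (by positivity)
  have h5 := mul_le_mul_of_nonneg_right h3 (mul_nonneg (sub_nonneg.2 hθ1) hB')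
  nlinarith [sq_nonneg (u ^ θ - v ^ θ)]

/-- Since `UV ≥ (A^θ - B^θ)²` and `U + V ≤ 2 (A^θ + B^θ)`, the constant is that of the identity
`2(x-y)² - 2(x+y)² = -8xy`. -/
lemma le_production (hA : 0 ≤ A) (hB : 0 ≤ B) (hu : 0 ≤ u) (hv : 0 ≤ v)
    (huv : u + v = 2 * (A + B)) (hprod : (A - B) ^ 2 ≤ u * v) (hθ0 : 0 ≤ θ) (hθ1 : θ ≤ 1) :
    -(8 * (A ^ θ * B ^ θ)) ≤ 2 * (u ^ θ * v ^ θ) - (u ^ θ + v ^ θ) * (A ^ θ + B ^ θ) := by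
  have h1 := rpow_add_rpow_le hu hv huv hθ0 hθ1
  have h2 := Real.rpow_add_le_add_rpow hA hB hθ0 hθ1
  have hA' := Real.rpow_nonneg hA θ
  have hB' := Real.rpow_nonneg hB θ
  have h3 : (A ^ θ - B ^ θ) ^ 2 ≤ u ^ θ * v ^ θ := by
    rw [← Real.mul_rpow hu hv, ← sq_abs]
    refine (pow_le_pow_left₀ (abs_nonneg _) (abs_rpow_sub_rpow_le hA hB hθ0 hθ1) 2).trans ?_
    rw [← Real.rpow_natCast, ← Real.rpow_mul (abs_nonneg _), mul_comm,
      Real.rpow_mul (abs_nonneg _), Real.rpow_natCast, sq_abs]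
    exact Real.rpow_le_rpow (sq_nonneg _) hprod hθ0
  have h4 := mul_le_mul_of_nonneg_right (h1.trans (mul_le_mul_of_nonneg_left h2 zero_le_two))
    (add_nonneg hA' hB')
  nlinarith

end Pointwise

lemma norm_rpow_eq (p : Space d) (γ : ℝ) : ‖p‖ ^ γ = (‖p‖ ^ 2) ^ (γ / 2) := by
  rw [← Real.rpow_natCast, ← Real.rpow_mul (norm_nonneg p)]
  congr 1
  push_cast
  ring

lemma abs_norm_rpow_le {γ : ℝ} (hγ : γ ∈ Icc (0 : ℝ) 2) (p : Space d) : |‖p‖ ^ γ| ≤ 1 * wt p := by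
  rw [abs_of_nonneg (by positivity), one_mul]
  exact rpow_le_one_add_sq (norm_nonneg p) hγ

lemma measurable_norm_rpow (γ : ℝ) : Measurable fun p : Space d => ‖p‖ ^ γ := by fun_prop

/-- The production of the moment of order `γ`, symmetrized. -/
def production (γ : ℝ) (p q : Space d) : ℝ :=
  2 * (‖p + q‖ ^ γ * ‖p - q‖ ^ γ) - (‖p + q‖ ^ γ + ‖p - q‖ ^ γ) * (‖p‖ ^ γ + ‖q‖ ^ γ)

lemma coll_norm_rpow_eq {γ : ℝ} (hγ : γ ∈ Icc (0 : ℝ) 2) {D : ℝ} {μ : Measure (Space d)}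
    (hμ : MomentBound D μ) (he : IsEven μ) :
    Integrable (fun x : Space d × Space d => production γ x.1 x.2) (μ.prod μ) ∧
    coll (kernel γ) (fun p => ‖p‖ ^ γ) μ =
      4⁻¹ * ∫ x, production γ x.1 x.2 ∂(μ.prod μ) := by
  have := hμ.isFiniteMeasure
  have hi := (isRate_kernel (d := d) hγ).integrable_mul_defect (measurable_norm_rpow γ)
    (abs_norm_rpow_le hγ) hμ hμ
  obtain ⟨h1, h2⟩ := he.integral_prod_symmetrize hi
  have hp : ∀ x : Space d × Space d, production γ x.1 x.2 =
      kernel γ x.1 x.2 * defect (fun p => ‖p‖ ^ γ) x +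
        kernel γ x.1 (-x.2) * defect (fun p => ‖p‖ ^ γ) (x.1, -x.2) := fun x => by
    unfold production kernel defect
    simp only [norm_neg, sub_neg_eq_add, ← sub_eq_add_neg]
    ring
  simp_rw [hp]
  refine ⟨hi.add h1, ?_⟩
  unfold coll
  rw [h2, integral_const_mul, ← mul_assoc]
  norm_num

lemma coll_norm_rpow_bounds {γ : ℝ} (hγ : γ ∈ Icc (0 : ℝ) 2) {D : ℝ} {μ : Measure (Space d)}
    (hμ : MomentBound D μ) (he : IsEven μ) :
    -(2 * (∫ p, ‖p‖ ^ γ ∂μ) ^ 2) ≤ coll (kernel γ) (fun p => ‖p‖ ^ γ) μ ∧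
    coll (kernel γ) (fun p => ‖p‖ ^ γ) μ ≤ -((1 - γ / 2) / 4 * (∫ p, ‖p‖ ^ γ ∂μ) ^ 2) := by
  have := hμ.isFiniteMeasure
  obtain ⟨hi, heq⟩ := coll_norm_rpow_eq hγ hμ he
  have hφ := hμ.integrable_of_le (measurable_norm_rpow γ) (abs_norm_rpow_le hγ)
  have hpr : Integrable (fun x : Space d × Space d => ‖x.1‖ ^ γ * ‖x.2‖ ^ γ) (μ.prod μ) :=
    hφ.mul_prod hφ
  have hM : ∫ x : Space d × Space d, ‖x.1‖ ^ γ * ‖x.2‖ ^ γ ∂(μ.prod μ) =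
      (∫ p, ‖p‖ ^ γ ∂μ) ^ 2 := by
    rw [integral_prod_mul (fun p : Space d => ‖p‖ ^ γ) (fun p : Space d => ‖p‖ ^ γ), sq]
  have hsum : ∀ p q : Space d, ‖p + q‖ ^ 2 + ‖p - q‖ ^ 2 = 2 * (‖p‖ ^ 2 + ‖q‖ ^ 2) := fun p q => by
    rw [norm_add_sq_real, norm_sub_sq_real]; ring
  have hprod : ∀ p q : Space d, (‖p‖ ^ 2 - ‖q‖ ^ 2) ^ 2 ≤ ‖p + q‖ ^ 2 * ‖p - q‖ ^ 2 := by
    intro p q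
    rw [norm_add_sq_real, norm_sub_sq_real]
    have h := abs_real_inner_le_norm p q
    have h' := pow_le_pow_left₀ (abs_nonneg _) h 2
    rw [sq_abs] at h'
    nlinarith
  have hθ0 : 0 ≤ γ / 2 := by linarith [hγ.1]
  have hθ1 : γ / 2 ≤ 1 := by linarith [hγ.2]
  rw [heq]
  constructor
  · have h1 : ∫ x : Space d × Space d, -(8 * (‖x.1‖ ^ γ * ‖x.2‖ ^ γ)) ∂(μ.prod μ) ≤
        ∫ x, production γ x.1 x.2 ∂(μ.prod μ) := by
      refine integral_mono (hpr.const_mul 8).neg hi fun x => ?_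
      simp only [production, norm_rpow_eq _ γ]
      exact le_production (sq_nonneg _) (sq_nonneg _) (sq_nonneg _) (sq_nonneg _)
        (hsum _ _) (hprod _ _) hθ0 hθ1
    rw [integral_neg, integral_const_mul, hM] at h1
    linarith
  · have h1 : ∫ x, production γ x.1 x.2 ∂(μ.prod μ) ≤
        ∫ x : Space d × Space d, -((1 - γ / 2) * (‖x.1‖ ^ γ * ‖x.2‖ ^ γ)) ∂(μ.prod μ) := by
      refine integral_mono hi (hpr.const_mul _).neg fun x => ?_
      simp only [production, norm_rpow_eq _ γ]
      exact production_le (sq_nonneg _) (sq_nonneg _) (sq_nonneg _) (sq_nonneg _)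
        (hsum _ _) hθ0 hθ1
    rw [integral_neg, integral_const_mul, hM] at h1
    linarith

/-- For the matrix `m` of second moments, the left side is `(tr m)²` and the double integral is the
sum of all `m_ij²`. Cauchy–Schwarz on the diagonal gives the factor `d`. -/
lemma sq_integral_norm_sq_le {D : ℝ} {μ : Measure (Space d)} (hμ : MomentBound D μ) :
    (∫ p, ‖p‖ ^ 2 ∂μ) ^ 2 ≤ d * ∫ x : Space d × Space d, inner ℝ x.1 x.2 ^ 2 ∂(μ.prod μ) := by
  have := hμ.isFiniteMeasure
  have hm : ∀ i : Fin d, Measurable fun p : Space d => p i := fun i => by fun_prop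
  have hb : ∀ i j (p : Space d), |p i * p j| ≤ 1 * wt p := fun i j p => by
    have h1 : |p i| ≤ ‖p‖ := PiLp.norm_apply_le p i
    have h2 : |p j| ≤ ‖p‖ := PiLp.norm_apply_le p j
    rw [abs_mul, one_mul]
    have := mul_le_mul h1 h2 (abs_nonneg _) (norm_nonneg p)
    unfold wt
    linarith
  have hi : ∀ i j, Integrable (fun p : Space d => p i * p j) μ := fun i j =>
    hμ.integrable_of_le ((hm i).mul (hm j)) (hb i j)
  have h1 : ∫ p, ‖p‖ ^ 2 ∂μ = ∑ i, ∫ p, p i * p i ∂μ := by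
    rw [← integral_finsetSum _ fun i _ => hi i i]
    congr 1 with p
    rw [EuclideanSpace.real_norm_sq_eq]
    exact Finset.sum_congr rfl fun i _ => sq _
  have h2 : ∫ x : Space d × Space d, inner ℝ x.1 x.2 ^ 2 ∂(μ.prod μ) =
      ∑ i, ∑ j, (∫ p, p i * p j ∂μ) ^ 2 := by
    have hij : ∀ i j, Integrable (fun x : Space d × Space d => (x.1 i * x.1 j) * (x.2 i * x.2 j))
        (μ.prod μ) := fun i j => (hi i j).mul_prod (hi i j)
    have h3 : ∀ x : Space d × Space d, inner ℝ x.1 x.2 ^ 2 =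
        ∑ i, ∑ j, (x.1 i * x.1 j) * (x.2 i * x.2 j) := fun x => by
      rw [PiLp.inner_apply, sq, Finset.sum_mul_sum]
      refine Finset.sum_congr rfl fun i _ => Finset.sum_congr rfl fun j _ => ?_
      simp only [RCLike.inner_apply, conj_trivial]
      ring
    simp_rw [h3]
    rw [integral_finsetSum _ fun i _ => integrable_finsetSum _ fun j _ => hij i j]
    refine Finset.sum_congr rfl fun i _ => ?_
    rw [integral_finsetSum _ fun j _ => hij i j]
    refine Finset.sum_congr rfl fun j _ => ?_
    rw [integral_prod_mul (fun p : Space d => p i * p j) (fun p : Space d => p i * p j), sq]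
  rw [h1, h2]
  have h4 := sq_sum_le_card_mul_sum_sq (s := Finset.univ) (f := fun i => ∫ p, p i * p i ∂μ)
  rw [Finset.card_univ, Fintype.card_fin] at h4
  refine h4.trans (mul_le_mul_of_nonneg_left (Finset.sum_le_sum fun i _ => ?_)
    (Nat.cast_nonneg d))
  exact Finset.single_le_sum (f := fun j => (∫ p, p i * p j ∂μ) ^ 2) (fun j _ => sq_nonneg _)
    (Finset.mem_univ i)

/-- For `γ = 2` the production is exactly `-8 ⟨p,q⟩²`. It vanishes on orthogonal pairs, so
dissipation can only be seen after integration. -/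
lemma coll_norm_sq_le (hd : 1 ≤ d) {D : ℝ} {μ : Measure (Space d)} (hμ : MomentBound D μ)
    (he : IsEven μ) : coll (kernel 2) (fun p => ‖p‖ ^ (2 : ℝ)) μ ≤
      -(2 / d * (∫ p, ‖p‖ ^ (2 : ℝ) ∂μ) ^ 2) := by
  obtain ⟨-, heq⟩ := coll_norm_rpow_eq (γ := 2) (by norm_num) hμ he
  have hp : ∀ x : Space d × Space d, production 2 x.1 x.2 = -8 * inner ℝ x.1 x.2 ^ 2 := fun x => by
    unfold production
    simp only [Real.rpow_two]
    rw [norm_add_sq_real, norm_sub_sq_real]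
    ring
  have h := sq_integral_norm_sq_le hμ
  have hd' : (0 : ℝ) < d := by exact_mod_cast hd
  rw [heq]
  simp_rw [hp, Real.rpow_two]
  rw [integral_const_mul]
  have h2 : 2 / d * (∫ p, ‖p‖ ^ 2 ∂μ) ^ 2 ≤
      2 * ∫ x : Space d × Space d, inner ℝ x.1 x.2 ^ 2 ∂(μ.prod μ) := by
    rw [div_mul_eq_mul_div, div_le_iff₀ hd']
    linarith
  linarith

lemma exists_coll_norm_rpow_le (hd : 1 ≤ d) {γ : ℝ} (hγ : γ ∈ Icc (0 : ℝ) 2) :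
    ∃ k : ℝ, 0 < k ∧ ∀ (D : ℝ) (μ : Measure (Space d)), MomentBound D μ → IsEven μ →
      coll (kernel γ) (fun p => ‖p‖ ^ γ) μ ≤ -(k * (∫ p, ‖p‖ ^ γ ∂μ) ^ 2) := by
  rcases hγ.2.eq_or_lt with rfl | h
  · have hd' : (0 : ℝ) < d := by exact_mod_cast hd
    exact ⟨2 / d, by positivity, fun D μ hμ he => coll_norm_sq_le hd hμ he⟩
  · exact ⟨(1 - γ / 2) / 4, by linarith, fun D μ hμ he => (coll_norm_rpow_bounds hγ hμ he).2⟩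

/-- Subadditivity of `x ↦ x^β` makes the defect nonpositive pointwise; no symmetrization is
involved. -/
lemma coll_norm_rpow_nonpos {γ β : ℝ} (hγ : γ ∈ Icc (0 : ℝ) 2) (hβ : β ∈ Icc (0 : ℝ) 1)
    (μ : Measure (Space d)) : coll (kernel γ) (fun p => ‖p‖ ^ β) μ ≤ 0 := by
  unfold coll
  refine mul_nonpos_of_nonneg_of_nonpos (by norm_num) (integral_nonpos fun x => ?_)
  refine mul_nonpos_of_nonneg_of_nonpos ((isRate_kernel hγ).nonneg _ _) ?_
  unfold defect
  have h1 := Real.rpow_le_rpow (norm_nonneg _) (norm_add_le x.1 x.2) hβ.1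
  have h2 := Real.rpow_add_le_add_rpow (norm_nonneg x.1) (norm_nonneg x.2) hβ.1 hβ.2
  linarith

/-! ### Decay -/

lemma hasDerivAt_integral_sq {y : ℝ → ℝ} (hy : Continuous y) (c k t s : ℝ) :
    HasDerivAt (fun s => c + k * ∫ τ in s..t, y τ ^ 2) (-(k * y s ^ 2)) s := by
  have h := intervalIntegral.integral_hasDerivAt_left
    ((hy.pow 2).intervalIntegrable s t)
    (hy.pow 2).aestronglyMeasurable.stronglyMeasurableAtFilter (hy.pow 2).continuousAt
  have := (h.const_mul k).const_add c
  rwa [mul_neg] at this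

/-- The function `P(s) = y(t) + k ∫_s^t y²` is differentiable even if `y` is not. From `0 < P ≤ y`
follows `P' = -k y² ≤ -k P²`, so `1/P - k s` is nondecreasing. -/
lemma le_inv_of_sub_le {y : ℝ → ℝ} (hy : Continuous y) {k t : ℝ} (hk : 0 ≤ k) (ht : 0 ≤ t)
    (h0 : 0 < y t) (h : ∀ s ∈ Icc 0 t, y t + k * ∫ τ in s..t, y τ ^ 2 ≤ y s) :
    (y 0)⁻¹ + k * t ≤ (y t)⁻¹ := by
  set P : ℝ → ℝ := fun s => y t + k * ∫ τ in s..t, y τ ^ 2 with hP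
  have hd := fun s => hasDerivAt_integral_sq hy (y t) k t s
  have hpos : ∀ s ∈ Icc 0 t, 0 < P s := fun s hs =>
    add_pos_of_pos_of_nonneg h0 (mul_nonneg hk
      (intervalIntegral.integral_nonneg hs.2 fun _ _ => sq_nonneg _))
  have hd' : ∀ s ∈ Icc 0 t, HasDerivAt (fun s => (P s)⁻¹ - k * s)
      (-(-(k * y s ^ 2)) / P s ^ 2 - k) s := fun s hs => by
    have := ((hd s).inv (hpos s hs).ne').sub ((hasDerivAt_id s).const_mul k)
    rw [mul_one] at this
    exact this
  have hmono : MonotoneOn (fun s => (P s)⁻¹ - k * s) (Icc 0 t) := by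
    refine monotoneOn_of_deriv_nonneg (convex_Icc 0 t)
      (fun s hs => (hd' s hs).continuousAt.continuousWithinAt)
      (fun s hs => (hd' s (interior_subset hs)).differentiableAt.differentiableWithinAt)
      fun s hs => ?_
    have hs' := interior_subset hs
    rw [(hd' s hs').deriv, neg_neg, sub_nonneg, le_div_iff₀ (pow_pos (hpos s hs') 2)]
    exact mul_le_mul_of_nonneg_left (pow_le_pow_left₀ (hpos s hs').le (h s hs') 2) hk
  have h1 := hmono ⟨le_rfl, ht⟩ ⟨ht, le_rfl⟩ ht
  have hPt : P t = y t := by simp [hP]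
  simp only [mul_zero, sub_zero, hPt] at h1
  have h2 : (y 0)⁻¹ ≤ (P 0)⁻¹ :=
    inv_anti₀ (hpos 0 ⟨le_rfl, ht⟩) (h 0 ⟨le_rfl, ht⟩)
  linarith

/-- The reverse comparison. Here `y t` is not known to be positive, so `P` is shifted by `ε` before
being inverted. -/
lemma inv_le_of_sub_le {y : ℝ → ℝ} (hy : Continuous y) (hy0 : ∀ s, 0 ≤ y s) {k t : ℝ}
    (hk : 0 ≤ k) (ht : 0 ≤ t) (h0 : 0 < y 0)
    (h : ∀ s ∈ Icc 0 t, y s ≤ y t + k * ∫ τ in s..t, y τ ^ 2) :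
    ((y 0)⁻¹ + k * t)⁻¹ ≤ y t := by
  refine le_of_forall_pos_le_add fun ε hε => ?_
  set P : ℝ → ℝ := fun s => (y t + ε) + k * ∫ τ in s..t, y τ ^ 2 with hP
  have hd := fun s => hasDerivAt_integral_sq hy (y t + ε) k t s
  have hε' : 0 < y t + ε := add_pos_of_nonneg_of_pos (hy0 t) hε
  have hpos : ∀ s ∈ Icc 0 t, 0 < P s := fun s hs =>
    add_pos_of_pos_of_nonneg hε' (mul_nonneg hk
      (intervalIntegral.integral_nonneg hs.2 fun _ _ => sq_nonneg _))
  have hle : ∀ s ∈ Icc 0 t, y s ≤ P s := fun s hs => by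
    have := h s hs
    simp only [hP]
    linarith
  have hd' : ∀ s ∈ Icc 0 t, HasDerivAt (fun s => (P s)⁻¹ - k * s)
      (-(-(k * y s ^ 2)) / P s ^ 2 - k) s := fun s hs => by
    have := ((hd s).inv (hpos s hs).ne').sub ((hasDerivAt_id s).const_mul k)
    rw [mul_one] at this
    exact this
  have hanti : AntitoneOn (fun s => (P s)⁻¹ - k * s) (Icc 0 t) := by
    refine antitoneOn_of_deriv_nonpos (convex_Icc 0 t)
      (fun s hs => (hd' s hs).continuousAt.continuousWithinAt)
      (fun s hs => (hd' s (interior_subset hs)).differentiableAt.differentiableWithinAt)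
      fun s hs => ?_
    have hs' := interior_subset hs
    rw [(hd' s hs').deriv, neg_neg, sub_nonpos, div_le_iff₀ (pow_pos (hpos s hs') 2)]
    exact mul_le_mul_of_nonneg_left (pow_le_pow_left₀ (hy0 s) (hle s hs') 2) hk
  have h1 := hanti ⟨le_rfl, ht⟩ ⟨ht, le_rfl⟩ ht
  have hPt : P t = y t + ε := by simp [hP]
  simp only [mul_zero, sub_zero, hPt] at h1
  have h2 : (P 0)⁻¹ ≤ (y 0)⁻¹ := inv_anti₀ h0 (hle 0 ⟨le_rfl, ht⟩)
  refine inv_le_of_inv_le₀ hε' ?_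
  linarith

namespace IsStrongSolution

variable {γ T D : ℝ} {f : Kernel ℝ (Space d)}

lemma integral_norm_rpow_anti (hγ : γ ∈ Icc (0 : ℝ) 2) (hf : IsStrongSolution (kernel γ) T D f)
    {β : ℝ} (hβ : β ∈ Icc (0 : ℝ) 1) {s t : ℝ} (hs : 0 ≤ s) (hst : s ≤ t) (ht : t ≤ T) :
    ∫ p, ‖p‖ ^ β ∂(f t) ≤ ∫ p, ‖p‖ ^ β ∂(f s) := by
  rw [hf.equation_interval (isRate_kernel hγ) (measurable_norm_rpow β) zero_le_one
    (abs_norm_rpow_le ⟨hβ.1, hβ.2.trans one_le_two⟩) hs hst ht]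
  have := intervalIntegral.integral_nonneg (μ := volume) hst
    (f := fun τ => -coll (kernel γ) (fun p => ‖p‖ ^ β) (f τ))
    fun τ _ => neg_nonneg.2 (coll_norm_rpow_nonpos hγ hβ (f τ))
  rw [intervalIntegral.integral_neg] at this
  linarith

lemma continuous_integral_clampKernel (hγ : γ ∈ Icc (0 : ℝ) 2) (hT : 0 ≤ T)
    (hf : IsStrongSolution (kernel γ) T D (clampKernel T f)) :
    Continuous fun t => ∫ p, ‖p‖ ^ γ ∂(clampKernel T f t) := by
  have hcl : Continuous (clamp T) := by unfold clamp; fun_prop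
  have hcc : ∀ t, clampKernel T f t = clampKernel T f (clamp T t) := fun t => by
    rw [clampKernel_apply, clampKernel_apply, clamp_of_mem (clamp_mem hT t)]
  refine continuous_iff_continuousAt.2 fun t => ?_
  rw [ContinuousAt, tendsto_iff_norm_sub_tendsto_zero]
  refine squeeze_zero (g := fun s => 4 * 1 * D ^ 2 * |clamp T s - clamp T t|)
    (fun _ => norm_nonneg _) (fun s => ?_) ?_
  · rw [hcc s, hcc t]
    exact hf.abs_integral_sub_le (isRate_kernel hγ) (measurable_norm_rpow γ) zero_le_one
      (abs_norm_rpow_le hγ) (clamp_mem hT t) (clamp_mem hT s)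
  · have : Continuous fun s => 4 * 1 * D ^ 2 * |clamp T s - clamp T t| := by fun_prop
    simpa using this.tendsto t

/-- The two-sided decay of the moment of order `γ`. -/
lemma moment_bounds (hγ : γ ∈ Icc (0 : ℝ) 2) {k₂ : ℝ} (hk₂ : 0 < k₂)
    (hcoll : ∀ (D : ℝ) (μ : Measure (Space d)), MomentBound D μ → IsEven μ →
      coll (kernel γ) (fun p => ‖p‖ ^ γ) μ ≤ -(k₂ * (∫ p, ‖p‖ ^ γ ∂μ) ^ 2)) {t : ℝ} (ht : 0 ≤ t)
    (hf : IsStrongSolution (kernel γ) t D (clampKernel t f)) :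
    (0 < ∫ p, ‖p‖ ^ γ ∂(f t) →
      (∫ p, ‖p‖ ^ γ ∂(f 0))⁻¹ + k₂ * t ≤ (∫ p, ‖p‖ ^ γ ∂(f t))⁻¹) ∧
    (0 < ∫ p, ‖p‖ ^ γ ∂(f 0) →
      ((∫ p, ‖p‖ ^ γ ∂(f 0))⁻¹ + 2 * t)⁻¹ ≤ ∫ p, ‖p‖ ^ γ ∂(f t)) ∧
    ∫ p, ‖p‖ ^ γ ∂(f t) ≤ ∫ p, ‖p‖ ^ γ ∂(f 0) := by
  set y : ℝ → ℝ := fun s => ∫ p, ‖p‖ ^ γ ∂(clampKernel t f s) with hy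
  have hyc : Continuous y := continuous_integral_clampKernel hγ ht hf
  have hy0 : ∀ s, 0 ≤ y s := fun s => integral_nonneg fun p => by positivity
  have eq0 : ∫ p, ‖p‖ ^ γ ∂(f 0) = y 0 := by
    simp only [hy]; rw [clampKernel_apply, clamp_of_mem ⟨le_rfl, ht⟩]
  have eqt : ∫ p, ‖p‖ ^ γ ∂(f t) = y t := by
    simp only [hy]; rw [clampKernel_apply, clamp_of_mem ⟨ht, le_rfl⟩]
  have hker := isRate_kernel (d := d) hγ
  have heq : ∀ s ∈ Icc 0 t, y t = y s +
      ∫ τ in s..t, coll (kernel γ) (fun p => ‖p‖ ^ γ) (clampKernel t f τ) := fun s hs =>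
    hf.equation_interval hker (measurable_norm_rpow γ) zero_le_one (abs_norm_rpow_le hγ)
      hs.1 hs.2 le_rfl
  have hii : ∀ s, IntervalIntegrable
      (fun τ => coll (kernel γ) (fun p => ‖p‖ ^ γ) (clampKernel t f τ)) volume s t := fun s =>
    intervalIntegrable_coll hker (measurable_norm_rpow γ) zero_le_one (abs_norm_rpow_le hγ)
      hf.moment s t
  have hiy : ∀ k s : ℝ, IntervalIntegrable (fun τ => -(k * y τ ^ 2)) volume s t := fun k s =>
    (by fun_prop : Continuous fun τ => -(k * y τ ^ 2)).intervalIntegrable s t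
  have hup : ∀ s ∈ Icc 0 t, y t + k₂ * ∫ τ in s..t, y τ ^ 2 ≤ y s := fun s hs => by
    have := intervalIntegral.integral_mono_on hs.2 (hii s) (hiy k₂ s)
      fun τ _ => hcoll D _ (hf.moment τ) (hf.even τ)
    rw [intervalIntegral.integral_neg, intervalIntegral.integral_const_mul] at this
    linarith [heq s hs]
  have hlow : ∀ s ∈ Icc 0 t, y s ≤ y t + 2 * ∫ τ in s..t, y τ ^ 2 := fun s hs => by
    have := intervalIntegral.integral_mono_on hs.2 (hiy 2 s) (hii s)
      fun τ _ => (coll_norm_rpow_bounds hγ (hf.moment τ) (hf.even τ)).1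
    rw [intervalIntegral.integral_neg, intervalIntegral.integral_const_mul] at this
    linarith [heq s hs]
  rw [eq0, eqt]
  refine ⟨fun h => le_inv_of_sub_le hyc hk₂.le ht h hup,
    fun h => inv_le_of_sub_le hyc hy0 zero_le_two ht h hlow, ?_⟩
  have h1 := hup 0 ⟨le_rfl, ht⟩
  have h2 : 0 ≤ ∫ τ in (0 : ℝ)..t, y τ ^ 2 :=
    intervalIntegral.integral_nonneg ht fun _ _ => sq_nonneg _
  nlinarith

/-- The image of a strong solution by an isometry is a strong solution. -/
lemma map_isometry (hγ : γ ∈ Icc (0 : ℝ) 2) (R : Space d ≃ₗᵢ[ℝ] Space d)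
    (hf : IsStrongSolution (kernel γ) T D f) : IsStrongSolution (kernel γ) T D (f.map R) := by
  have hR : Measurable R := R.continuous.measurable
  have hm : ∀ t, f.map R t = (f t).map R := fun t => Kernel.map_apply f hR t
  have hint : ∀ t (φ : Space d → ℝ), Measurable φ →
      ∫ p, φ p ∂(f.map R t) = ∫ p, φ (R p) ∂(f t) := fun t φ hφ => by
    rw [hm, integral_map hR.aemeasurable hφ.aestronglyMeasurable]
  have hwt : ∀ p : Space d, wt (R p) = wt p := fun p => by unfold wt; rw [R.norm_map]
  have hcoll : ∀ t (φ : Space d → ℝ), Measurable φ →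
      coll (kernel γ) φ (f.map R t) = coll (kernel γ) (fun p => φ (R p)) (f t) := fun t φ hφ => by
    have := (hf.moment t).isFiniteMeasure
    unfold coll
    rw [hm, Measure.map_prod_map _ _ hR hR, integral_map (by fun_prop)
      ((isRate_kernel hγ).measurable_mul_defect hφ).aestronglyMeasurable]
    congr 2 with x
    simp only [kernel, defect, Prod.map_fst, Prod.map_snd, ← map_sub, ← map_add, R.norm_map]
  refine ⟨fun t => ?_, fun t => ⟨?_, ?_⟩, fun φ hφ ⟨C, hC⟩ t ht => ?_⟩
  · unfold IsEven
    rw [hm, Measure.map_map measurable_neg hR]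
    conv_rhs => rw [← hf.even t, Measure.map_map hR measurable_neg]
    congr 1
    ext1 p
    simp
  · rw [hm, integrable_map_measure (by fun_prop) hR.aemeasurable]
    simpa only [Function.comp_def, hwt] using (hf.moment t).integrable
  · rw [hint t _ (by fun_prop)]
    simpa only [hwt] using (hf.moment t).le
  · rw [hint t φ hφ, hint 0 φ hφ]
    simp_rw [hcoll _ φ hφ]
    exact hf.equation _ (hφ.comp hR) ⟨C, fun p => by rw [← hwt p]; exact hC (R p)⟩ t ht

end IsStrongSolution

end ImpulsionAggregation

end

/-! ### Assembly of the main theorem -/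

theorem mainTheorem1 (d : ℕ) (hd : 1 ≤ d) (γ : ℝ) (hγ : γ ∈ Set.Icc (0 : ℝ) 2) :
    ∃ k₁ k₂ : ℝ≥0, 0 < k₁ ∧ 0 < k₂ ∧
      ∀ (α : ℕ), 2 ≤ α →
      ∀ fin : FiniteMeasure (ImpulsionAggregation.Space d),
        ImpulsionAggregation.IsEven (fin : Measure (ImpulsionAggregation.Space d)) →
        ImpulsionAggregation.weightedMass (2 * α)
          (fin : Measure (ImpulsionAggregation.Space d)) < ⊤ →
      ∃ f : ℝ → FiniteMeasure (ImpulsionAggregation.Space d),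
        -- existence of a global even solution
        (∀ T : ℝ, 0 < T → ImpulsionAggregation.IsEvenSolution γ α fin T f) ∧
        -- uniqueness, on every time interval
        (∀ T : ℝ, 0 < T → ∀ g : ℝ → FiniteMeasure (ImpulsionAggregation.Space d),
          ImpulsionAggregation.IsEvenSolution γ α fin T g → Set.EqOn g f (Set.Ico 0 T)) ∧
        -- monotonicity of the moments of order at most one
        (∀ β ∈ Set.Icc (0 : ℝ) 1, AntitoneOn
          (fun t => ImpulsionAggregation.moment β
            (f t : Measure (ImpulsionAggregation.Space d))) (Set.Ici 0)) ∧
        -- propagation of radial symmetry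
        (ImpulsionAggregation.IsRadial (fin : Measure (ImpulsionAggregation.Space d)) →
          ∀ t : ℝ, 0 ≤ t →
            ImpulsionAggregation.IsRadial (f t : Measure (ImpulsionAggregation.Space d))) ∧
        -- two-sided decay, in `[0, ∞]` with `0⁻¹ = ∞` and `∞⁻¹ = 0`
        (∀ t : ℝ≥0,
          ((ImpulsionAggregation.moment γ (fin : Measure (ImpulsionAggregation.Space d)))⁻¹
              + k₁ * t)⁻¹
            ≤ ImpulsionAggregation.moment γ
                (f t : Measure (ImpulsionAggregation.Space d)) ∧
          ImpulsionAggregation.moment γ (f t : Measure (ImpulsionAggregation.Space d))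
            ≤ ((ImpulsionAggregation.moment γ
                  (fin : Measure (ImpulsionAggregation.Space d)))⁻¹ + k₂ * t)⁻¹) := by
  obtain ⟨k₂, hk₂, hcoll⟩ := ImpulsionAggregation.exists_coll_norm_rpow_le hd hγ
  lift k₂ to ℝ≥0 using hk₂.le
  -- The constant `k₁ = 2` is that of the lower bound in `coll_norm_rpow_bounds`, namely `8 / 4`.
  refine ⟨2, k₂, by norm_num, NNReal.coe_pos.1 hk₂, fun α hα fin heven hfin => ?_⟩
  obtain ⟨k, rfl⟩ : ∃ k, α = k + 2 := ⟨α - 2, by omega⟩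
  obtain ⟨F, hF0, hF⟩ := (ImpulsionAggregation.isRate_kernel hγ).exists_strongSolution k heven
    (ImpulsionAggregation.integrable_highWt_of_weightedMass hfin)
  have hmom : ∀ t : ℝ, 0 ≤ t → ∃ D, ImpulsionAggregation.MomentBound D (F t) := fun t ht => by
    obtain ⟨E, hE, -⟩ := hF t ht
    have := hE.moment t
    rw [ImpulsionAggregation.clampKernel_apply,
      ImpulsionAggregation.clamp_of_mem ⟨ht, le_rfl⟩] at this
    exact ⟨E, this⟩
  have hfinite : ∀ t : ℝ, IsFiniteMeasure (F (max t 0)) := fun t =>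
    (hmom _ (le_max_right t 0)).choose_spec.isFiniteMeasure
  -- The value at negative times is immaterial; `max t 0` only ensures finiteness everywhere.
  let f : ℝ → FiniteMeasure (ImpulsionAggregation.Space d) := fun t => ⟨F (max t 0), hfinite t⟩
  have hf : ∀ t : ℝ, 0 ≤ t → (f t : Measure (ImpulsionAggregation.Space d)) = F t :=
    fun t ht => by
      change F (max t 0) = F t
      rw [max_eq_left ht]
  have hmoment : ∀ β ∈ Set.Icc (0 : ℝ) 2, ∀ t : ℝ, 0 ≤ t →
      ImpulsionAggregation.moment β (F t) = ENNReal.ofReal (∫ p, ‖p‖ ^ β ∂(F t)) :=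
    fun β hβ t ht => by
      obtain ⟨D, hD⟩ := hmom t ht
      exact ImpulsionAggregation.moment_eq_ofReal hβ.1
        (hD.integrable_of_le (ImpulsionAggregation.measurable_norm_rpow β)
          (ImpulsionAggregation.abs_norm_rpow_le hβ))
  refine ⟨f, fun T hT => ?_, fun T hT g hg t ht => ?_, fun β hβ s hs t ht hst => ?_,
    fun hrad t ht R hR => ?_, fun t => ?_⟩
  · obtain ⟨E, hE, hk⟩ := hF T hT.le
    exact ImpulsionAggregation.isEvenSolution_of_isStrongSolution hγ hF0 hT hE hk hf
  · obtain ⟨E, hE, -⟩ := hF t ht.1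
    exact Subtype.ext ((hg.eq_of_isStrongSolution hγ ht hF0 hE).trans (hf t ht.1).symm)
  · obtain ⟨E, hE, -⟩ := hF t ht
    have hβ' : β ∈ Set.Icc (0 : ℝ) 2 := ⟨hβ.1, hβ.2.trans one_le_two⟩
    simp only
    rw [hf s hs, hf t ht, hmoment β hβ' s hs, hmoment β hβ' t ht]
    refine ENNReal.ofReal_le_ofReal ?_
    have := hE.integral_norm_rpow_anti hγ hβ hs hst le_rfl
    rwa [ImpulsionAggregation.clampKernel_apply, ImpulsionAggregation.clampKernel_apply,
      ImpulsionAggregation.clamp_of_mem ⟨hs, hst⟩,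
      ImpulsionAggregation.clamp_of_mem ⟨ht, le_rfl⟩] at this
  · obtain ⟨E, hE, -⟩ := hF t ht
    have hR' : Measurable R := R.continuous.measurable
    -- The rotated solution solves the same equation with the same datum, so it is the solution
    -- itself.
    have := (hE.map_isometry hγ R).unique (ImpulsionAggregation.isRate_kernel hγ) hE (by
      rw [ProbabilityTheory.Kernel.map_apply _ hR', ImpulsionAggregation.clampKernel_apply,
        ImpulsionAggregation.clamp_of_mem ⟨le_rfl, ht⟩, hF0]
      exact hrad R hR) ⟨ht, le_rfl⟩
    rw [ProbabilityTheory.Kernel.map_apply _ hR', ImpulsionAggregation.clampKernel_apply,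
      ImpulsionAggregation.clamp_of_mem ⟨ht, le_rfl⟩] at this
    rw [hf t ht]
    exact this
  · have ht : (0 : ℝ) ≤ t := t.2
    obtain ⟨E, hE, -⟩ := hF t ht
    obtain ⟨h1, h2, h3⟩ := hE.moment_bounds hγ hk₂ hcoll ht
    rw [hf t ht, hmoment γ hγ t ht, ← hF0, hmoment γ hγ 0 le_rfl]
    set y₀ := ∫ p, ‖p‖ ^ γ ∂(F 0)
    set y := ∫ p, ‖p‖ ^ γ ∂(F t)
    have hy₀ : 0 ≤ y₀ := integral_nonneg fun p => by positivity
    have hy : 0 ≤ y := integral_nonneg fun p => by positivity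
    have hrhs : ∀ k : ℝ≥0, 0 < y₀ → (ENNReal.ofReal y₀)⁻¹ + (k : ℝ≥0∞) * (t : ℝ≥0∞) =
        ENNReal.ofReal (y₀⁻¹ + k * t) := fun k h => by
      rw [ENNReal.ofReal_add (inv_nonneg.2 hy₀) (by positivity), ENNReal.ofReal_inv_of_pos h,
        ENNReal.ofReal_mul k.coe_nonneg, ENNReal.ofReal_coe_nnreal, ENNReal.ofReal_coe_nnreal]
    constructor
    -- If the initial moment vanishes, its inverse is `∞` and the lower bound is `0`.
    · rcases hy₀.eq_or_lt with h | h
      · rw [← h]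
        simp
      · have hpos : 0 < y₀⁻¹ + 2 * (t : ℝ) := add_pos_of_pos_of_nonneg (inv_pos.2 h) (by positivity)
        rw [hrhs 2 h, NNReal.coe_ofNat, ← ENNReal.ofReal_inv_of_pos hpos]
        exact ENNReal.ofReal_le_ofReal (h2 h)
    -- The inverse of `y` requires `y > 0`, the case `y = 0` being trivial; `h3` then gives `y₀ > 0`
    -- as well.
    · rcases hy.eq_or_lt with h | h
      · rw [← h, ENNReal.ofReal_zero]
        exact zero_le
      · rw [hrhs k₂ (h.trans_le h3), ENNReal.le_inv_iff_le_inv, ← ENNReal.ofReal_inv_of_pos h]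
        exact ENNReal.ofReal_le_ofReal (h1 h)
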